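/- Let $\Sigma\subseteq\{1,\dots,m\}^{\mathbb Z}$ be a two-sided subshift of finite type given by a transition matrix, with left shift $T:\Sigma\to\Sigma$, and assume that $T$ is topologically transitive. Let $\mu$ be a Gibbs measure for a Hölder continuous potential $\varphi$ on $\Sigma$: a $T$-invariant probability measure for which there are constants $P\in\mathbb R$ and $C>0$ with $$C^{-1}\le \frac{\mu[x_0,\dots,x_{n-1}]}{e^{S_n\varphi(x)-nP}}\le C\qquad\text{for all } n\ge 0,\ x\in\Sigma .$$ Let $W^s_{loc}(x)=\{y: y_n=x_n\ \forall n\ge 0\}$ and $W^u_{loc}(x)=\{y: y_n=x_n\ \forall n\le 0\}$. Let $d\ge 1$ and let $E$ be a continuous vector bundle of rank $d$ over $\Sigma$; it is trivial, and we identify it with $\Sigma\times\mathbb R^d$. Let $M$ be a linear cocycle on $E$ over $T$, given by $M(x)\in GL_d(\mathbb R)$ and with iterates $M^n(x)$, $n\in\mathbb Z$. Assume that $M$ is *locally constant* in some trivialization: there is a continuous $L:\Sigma\to GL_d(\mathbb R)$ such that $L(Tx)M(x)L(x)^{-1}$ depends only on $(x_0,x_1)$ (in particular, it may depend only on $x_0$).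 In this trivialization the identity is an invariant stable and unstable holonomy; on $E$ it is $H_{x\to y}=L(y)^{-1}L(x)$, for $y\in W^s_{loc}(x)$ or $y\in W^u_{loc}(x)$. Assume that $M$ is *strongly irreducible*: there do not exist integers $0<k<d$ and $N>0$ and, for each $x\in\Sigma$, distinct $k$-dimensional subspaces $V_1(x),\dots,V_N(x)$ of $E(x)$, depending continuously on $x$, such that $M(x)\{V_1(x),\dots,V_N(x)\}=\{V_1(Tx),\dots,V_N(Tx)\}$ for all $x$, and $H_{x\to y}\{V_1(x),\dots,V_N(x)\}=\{V_1(y),\dots,V_N(y)\}$ for all $x$ and all $y\in W^u_{loc}(x)\cup W^s_{loc}(x)$. Let $\lambda_1\ge\dots\ge\lambda_d$ be the Lyapunov exponents of $M$ with respect to $\mu$, i.e., for every $i$, $\frac1n\log\|\Lambda^iM^n(x)\|\to\lambda_1+\dots+\lambda_i$ as $n\to+\infty$ for $\mu$-almost every $x$. Assume that the top exponent is simple: $\lambda_j<\lambda_1$ for all $j>1$. Let $T_{\mathbb P}(x,[v])=(Tx,[M(x)v])$ on $\mathbb P(E)=\Sigma\times\mathbb P(\mathbb R^d)$. A *$u$-state*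 is a probability measure $\nu$ on $\mathbb P(E)$ that projects to $\mu$ and whose fiberwise disintegration $\nu=\mu\otimes\nu_x$ is $\mu$-almost surely invariant under unstable holonomy: there is a set $S$ of full $\mu$-measure such that $(H_{x\to y})_*\nu_x=\nu_y$ for all $x,y\in S$ with $y\in W^u_{loc}(x)$. An *invariant $u$-state* is a $u$-state that is $T_{\mathbb P}$-invariant. Then there is a measurable map $x\mapsto v_1(x)\in E(x)\setminus\{0\}$ such that, for $\mu$-almost every $x$, the line $\mathbb R v_1(x)$ is the Oseledets subspace for the top exponent, $$\mathbb R v_1(x)=\{0\}\cup\Big\{v\ne0:\ \tfrac1n\log\|M^n(x)v\|\to\lambda_1 \text{ as } n\to+\infty \text{ and as } n\to-\infty\Big\},$$ and $T_{\mathbb P}$ has exactly one invariant $u$-state, namely $\mu\otimes\delta_{[v_1]}$, the image of $\mu$ under $x\mapsto(x,[v_1(x)])$. -/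

import Mathlib

open MeasureTheory ProbabilityTheory Filter Topology
open scoped LinearAlgebra.Projectivization

noncomputable section

namespace SFTCocycle

/-! ### Subshifts of finite type -/

/-- The two-sided subshift of finite type on the alphabet `Fin m` with transition matrix `A`,
with the topology and the Borel sigma-algebra inherited from the product `ℤ → Fin m`. -/
abbrev SFT {m : ℕ} (A : Fin m → Fin m → Prop) : Type :=
  {x : ℤ → Fin m // ∀ i, A (x i) (x (i + 1))}

section Shift

variable {m : ℕ} {A : Fin m → Fin m → Prop}

/-- The left shift, as a bijection of the subshift: `(shift A x)_i = x_{i+1}`. -/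
def shift (A : Fin m → Fin m → Prop) : SFT A ≃ SFT A where
  toFun x := ⟨fun i => x.1 (i + 1), fun i => x.2 (i + 1)⟩
  invFun x := ⟨fun i => x.1 (i - 1), fun i => by
    have h := x.2 (i - 1)
    rwa [show i - 1 + 1 = i + 1 - 1 by ring] at h⟩
  left_inv x := by ext i; simp
  right_inv x := by ext i; simp

/-- Topological transitivity of the shift. -/
def IsTransitive (A : Fin m → Fin m → Prop) : Prop :=
  ∀ U V : Set (SFT A), IsOpen U → U.Nonempty → IsOpen V → V.Nonempty →
    ∃ n : ℕ, ((shift A)^[n] '' U ∩ V).Nonempty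

/-- The local stable set `{y | y_n = x_n for all n ≥ 0}`. -/
def Wsloc (x : SFT A) : Set (SFT A) := {y | ∀ n : ℤ, 0 ≤ n → y.1 n = x.1 n}

/-- The local unstable set `{y | y_n = x_n for all n ≤ 0}`. -/
def Wuloc (x : SFT A) : Set (SFT A) := {y | ∀ n : ℤ, n ≤ 0 → y.1 n = x.1 n}

/-- The cylinder `[x_0, …, x_{n-1}]`. -/
def cylinder (x : SFT A) (n : ℕ) : Set (SFT A) :=
  {y | ∀ i : ℤ, 0 ≤ i → i < n → y.1 i = x.1 i}

/-- Hölder continuity of a function on the subshift (with respect to the usual distances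
`θ ^ min {|i| : x_i ≠ y_i}`): its variations on symmetric cylinders decay exponentially. -/
def IsHolder (φ : SFT A → ℝ) : Prop :=
  ∃ C θ : ℝ, 0 < θ ∧ θ < 1 ∧ ∀ (n : ℕ) (x y : SFT A),
    (∀ i : ℤ, |i| ≤ n → x.1 i = y.1 i) → |φ x - φ y| ≤ C * θ ^ n

/-- `μ` is a Gibbs measure for the shift, for some Hölder continuous potential. -/
structure IsGibbs (μ : Measure (SFT A)) : Prop where
  isProbabilityMeasure : IsProbabilityMeasure μ
  invariant : MeasurePreserving (shift A) μ μ
  gibbs : ∃ φ : SFT A → ℝ, IsHolder φ ∧ ∃ P C : ℝ, 0 < C ∧ ∀ (n : ℕ) (x : SFT A),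
    C⁻¹ ≤ μ.real (cylinder x n) / Real.exp (birkhoffSum (shift A) φ n x - n * P) ∧
    μ.real (cylinder x n) / Real.exp (birkhoffSum (shift A) φ n x - n * P) ≤ C

end Shift

/-! ### Linear cocycles -/

/-- The fiber `ℝ^d`, with its Euclidean norm. -/
abbrev Vec (d : ℕ) : Type := EuclideanSpace ℝ (Fin d)

/-- The topological group `GL_d(ℝ)`, as the group of invertible operators of `ℝ^d`. -/
abbrev GLd (d : ℕ) : Type := (Vec d →L[ℝ] Vec d)ˣ

/-- The projective space `P(ℝ^d)`. -/
abbrev Proj (d : ℕ) : Type := ℙ ℝ (Vec d)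

/-- The quotient topology on projective space. -/
instance (d : ℕ) : TopologicalSpace (Proj d) :=
  TopologicalSpace.coinduced (Projectivization.mk' ℝ) inferInstance

instance (d : ℕ) : MeasurableSpace (Proj d) := borel (Proj d)

instance (d : ℕ) : BorelSpace (Proj d) := ⟨rfl⟩

section Cocycle

variable {m d : ℕ} {A : Fin m → Fin m → Prop}

/-- The iterates of the cocycle `M` in positive time, `M^n(x) = M(T^{n-1} x) ⋯ M(x)`. -/
def iterNat (M : SFT A → GLd d) : ℕ → SFT A → GLd d
  | 0, _ => 1
  | n + 1, x => M ((shift A)^[n] x) * iterNat M n x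

/-- The iterates of the cocycle `M` in all integer times, with `M^{-n}(x) = M^n(T^{-n} x)⁻¹`. -/
def iter (M : SFT A → GLd d) : ℤ → SFT A → GLd d
  | Int.ofNat n, x => iterNat M n x
  | Int.negSucc n, x => (iterNat M (n + 1) ((shift A).symm^[n + 1] x))⁻¹

/-- The norm of the exterior power `Λ^{i+1} g` (for `i : Fin d` starting from `0`), i.e. the
product of the `i + 1` largest singular values of `g`. -/
def exteriorNorm (i : Fin d) (g : GLd d) : ℝ :=
  ∏ j ∈ Finset.Iic i, (g.1 : Vec d →ₗ[ℝ] Vec d).singularValues j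

/-- `lam 0 ≥ lam 1 ≥ ⋯ ≥ lam (d-1)` are the Lyapunov exponents of `M` with respect to `μ`, counted
with multiplicity: `log ‖Λ^i M^n(x)‖ / n` converges almost surely to the sum of the first `i` of
them. -/
def IsLyapunovSpectrum (μ : Measure (SFT A)) (M : SFT A → GLd d) (lam : Fin d → ℝ) : Prop :=
  ∀ᵐ x ∂μ, ∀ i : Fin d,
    Tendsto (fun n : ℕ => Real.log (exteriorNorm i (iterNat M n x)) / n) atTop
      (𝓝 (∑ j ∈ Finset.Iic i, lam j))

/-- The Oseledets subspace at `x` for the exponent `l`: the zero vector, and the nonzero vectors `v`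
such that `log ‖M^n(x) v‖ / n → l` when `n → +∞` and when `n → -∞`. -/
def oseledets (M : SFT A → GLd d) (l : ℝ) (x : SFT A) : Set (Vec d) :=
  {v | v = 0 ∨
    (Tendsto (fun n : ℤ => Real.log ‖(iter M n x).1 v‖ / n) atTop (𝓝 l) ∧
     Tendsto (fun n : ℤ => Real.log ‖(iter M n x).1 v‖ / n) atBot (𝓝 l))}

/-- `M` is locally constant in the trivialization `L` of the trivial bundle: in the coordinates
`(x, v) ↦ (x, L(x) v)` it depends only on the symbols `x_0` and `x_1`, which means that the
identity, in these coordinates, is an invariant holonomy along both local stable and local unstable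
sets. -/
def IsLocallyConstantIn (M L : SFT A → GLd d) : Prop :=
  Continuous L ∧ ∃ B : Fin m → Fin m → GLd d,
    ∀ x, L (shift A x) * M x * (L x)⁻¹ = B (x.1 0) (x.1 1)

/-- The identity holonomy in the trivialization `L`, as a map from the fiber at `x` to the fiber
at `y`. It is used for `y` in the local stable or local unstable set of `x`. -/
def trivHolonomy (L : SFT A → GLd d) (x y : SFT A) : GLd d := (L y)⁻¹ * L x

/-- The image of a linear subspace under an invertible operator. -/
def mapSubspace (g : GLd d) (W : Submodule ℝ (Vec d)) : Submodule ℝ (Vec d) :=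
  W.map (g.1 : Vec d →ₗ[ℝ] Vec d)

/-- The distance on the Grassmannian of subspaces of a given dimension, namely the norm of the
orthogonal projection from `U` to the orthogonal complement of `W`. -/
def grassDist (U W : Submodule ℝ (Vec d)) : ℝ :=
  ‖(Wᗮ).starProjection ∘L U.starProjection‖

/-- `M`, with stable holonomy `Hs` and unstable holonomy `Hu`, is *not* strongly irreducible: there
is a continuous family of `N > 0` distinct subspaces `V_1(x), …, V_N(x)` of the same dimension
`0 < k < d` which, as a whole, is invariant under the cocycle and under the holonomies. -/
def NotStronglyIrreducible (M : SFT A → GLd d) (Hs Hu : SFT A → SFT A → GLd d) : Prop :=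
  ∃ (k N : ℕ) (V : Fin N → SFT A → Submodule ℝ (Vec d)),
    0 < k ∧ k < d ∧ 0 < N ∧
    (∀ i x, Module.finrank ℝ (V i x) = k) ∧
    (∀ x, Function.Injective fun i => V i x) ∧
    (∀ i x, Tendsto (fun y => grassDist (V i y) (V i x)) (𝓝 x) (𝓝 0)) ∧
    (∀ x, mapSubspace (M x) '' (Set.range fun i => V i x) = Set.range fun i => V i (shift A x)) ∧
    (∀ x, ∀ y ∈ Wuloc x,
      mapSubspace (Hu x y) '' (Set.range fun i => V i x) = Set.range fun i => V i y) ∧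
    (∀ x, ∀ y ∈ Wsloc x,
      mapSubspace (Hs x y) '' (Set.range fun i => V i x) = Set.range fun i => V i y)

def StronglyIrreducible (M : SFT A → GLd d) (Hs Hu : SFT A → SFT A → GLd d) : Prop :=
  ¬ NotStronglyIrreducible M Hs Hu

/-- The projective action `[v] ↦ [g v]` of an invertible operator. -/
def projMap (g : GLd d) : Proj d → Proj d :=
  Projectivization.map (g.1 : Vec d →ₗ[ℝ] Vec d)
    (ContinuousLinearEquiv.unitsEquiv ℝ (Vec d) g).injective

/-- The fibered map `T_P (x, [v]) = (T x, [M(x) v])` on the projective bundle. -/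
def projFibered (M : SFT A → GLd d) (p : SFT A × Proj d) : SFT A × Proj d :=
  (shift A p.1, projMap (M p.1) p.2)

/-- `ν` is a `u`-state for the unstable holonomy `Hu`: it is a probability measure on the projective
bundle which projects to `μ`, and the measures `ν_x` in its disintegration `ν = μ ⊗ ν_x` are
`μ`-almost surely invariant under the unstable holonomy. -/
def IsUState (μ : Measure (SFT A)) (Hu : SFT A → SFT A → GLd d)
    (ν : Measure (SFT A × Proj d)) : Prop :=
  IsProbabilityMeasure ν ∧ ν.map Prod.fst = μ ∧
  ∃ κ : Kernel (SFT A) (Proj d), IsMarkovKernel κ ∧ ν = μ ⊗ₘ κ ∧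
    ∃ S : Set (SFT A), S ∈ ae μ ∧
      ∀ x ∈ S, ∀ y ∈ S, y ∈ Wuloc x → (κ x).map (projMap (Hu x y)) = κ y

/-- An invariant `u`-state: a `u`-state which is invariant under the fibered projective map. -/
def IsInvariantUState (μ : Measure (SFT A)) (M : SFT A → GLd d) (Hu : SFT A → SFT A → GLd d)
    (ν : Measure (SFT A × Proj d)) : Prop :=
  IsUState μ Hu ν ∧ MeasurePreserving (projFibered M) ν ν

end Cocycle

end SFTCocycle

end

noncomputable section

namespace SFTCocycle

/-! ### Birkhoff averages of bounded functions -/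

section Birkhoff

variable {Y : Type*} {R R' : Y → Y}

/-! In the trivialization, `N x = L (shift A x) * M x * (L x)⁻¹` reads only the symbols `x_0`,
`x_1`, and all holonomies become the identity. Since `L` and its inverse are bounded, growth rates
do not change. Write λ for the top exponent.

The past determines the line. As λ is simple, areas grow at a rate `γ < 2λ` (`exists_area_growth`).
If two vectors at `x` both shrink at rate λ under backward iteration, their parallelogram is the
image under `N^n` of one of area about `exp (-2nλ)`, so its area is at most about `exp (n(γ - 2λ))`,
which tends to zero: the vectors are collinear (`ae_gram_eq_zero_of_bwdGrowth`). A vector with rate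
λ in both time directions exists by a variational argument: a limit of empirical measures started in
the most expanded directions is an invariant measure of mean expansion λ (`exists_maximal_measure`).
Backward growth depends only on the past, so the resulting line field is constant along local
unstable sets and defines an invariant `u`-state.

Uniqueness. It suffices that, for an invariant `u`-state, almost every selected line has backward
rate λ. In the trivialization the fiber measures of a `u`-state depend only on the past, and past
and future are quasi-independent for a Gibbs measure (`IsGibbs.exists_product_structure`). Hence
conditioning on a future cylinder increases the mass of a set of lines by at most a constant factor
(`IsUState.exists_cylinder_le`). The forward iterate `N^n` reads only the future, so it acts on
nearly independent directions. A direction which grows much more slowly than the norm of `N^n` is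
exponentially close to the hyperplane orthogonal to the top right singular vector. If no proper
subspace is charged, compactness makes such neighborhoods uniformly small, and growth at rate λ
holds in mean (`tendsto_integral_logExp`). Invariance and a maximal inequality upgrade this to
almost sure growth in the future and in the past (`ae_growth_of_tendsto_integral`).

Proper subspaces are not charged (`measure_projSet_eq_zero`), by a maximum principle. Take the least
dimension `k` of a charged subspace and the supremum of the masses of `k`-dimensional subspaces
conditionally on future cylinders. The mass over a cylinder is an average over its preimages, each
of weight bounded below, so nearly maximal subspaces pull back to nearly maximal ones. For each
symbol the subspaces which approach the supremum form a finite set, and by transitivity these sets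
have constant cardinality. They form an invariant family depending only on `x_0`, which strong
irreducibility forbids. -/

/-- The running maximum `max (0, S_1 g, …, S_n g)` of the Birkhoff sums of `g`. -/
def birkhoffMax (R : Y → Y) (g : Y → ℝ) : ℕ → Y → ℝ
  | 0, _ => 0
  | n + 1, y => max 0 (g y + birkhoffMax R g n (R y))

lemma birkhoffMax_nonneg (g : Y → ℝ) (n : ℕ) (y : Y) : 0 ≤ birkhoffMax R g n y := by
  cases n with
  | zero => exact le_rfl
  | succ n => exact le_max_left _ _

lemma birkhoffMax_le_succ (g : Y → ℝ) (n : ℕ) (y : Y) :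
    birkhoffMax R g n y ≤ birkhoffMax R g (n + 1) y := by
  induction n generalizing y with
  | zero => exact le_max_left _ _
  | succ n ih => exact max_le_max le_rfl (add_le_add le_rfl (ih (R y)))

lemma birkhoffSum_le_birkhoffMax (g : Y → ℝ) (n : ℕ) (y : Y) :
    birkhoffSum R g n y ≤ birkhoffMax R g n y := by
  induction n generalizing y with
  | zero => simp [birkhoffMax]
  | succ n ih =>
    rw [birkhoffSum_succ']
    exact (add_le_add le_rfl (ih (R y))).trans (le_max_right _ _)

lemma birkhoffMax_le (g : Y → ℝ) {K : ℝ} (hg : ∀ y, |g y| ≤ K) (n : ℕ) (y : Y) :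
    birkhoffMax R g n y ≤ n * K := by
  have hK : 0 ≤ K := (abs_nonneg _).trans (hg y)
  induction n generalizing y with
  | zero => simp [birkhoffMax]
  | succ n ih =>
    refine max_le (by positivity) ?_
    push_cast
    linarith [ih (R y), (abs_le.1 (hg y)).2]

lemma abs_birkhoffSum_le (g : Y → ℝ) {K : ℝ} (hg : ∀ y, |g y| ≤ K) (n : ℕ) (y : Y) :
    |birkhoffSum R g n y| ≤ n * K := by
  induction n generalizing y with
  | zero => simp
  | succ n ih =>
    rw [birkhoffSum_succ']
    push_cast
    linarith [abs_add_le (g y) (birkhoffSum R g n (R y)), hg y, ih (R y)]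

lemma birkhoffSum_comm (g : Y → ℝ) (n N : ℕ) (y : Y) :
    birkhoffSum R (birkhoffSum R g N) n y = birkhoffSum R (birkhoffSum R g n) N y := by
  simp only [birkhoffSum, ← Function.iterate_add_apply]
  rw [Finset.sum_comm]
  simp only [add_comm]

/-- The sum of length `n + j` splits in two ways; the difference consists of `j` terms at each end.
-/
lemma abs_birkhoffSum_sub_iterate_le (g : Y → ℝ) {K : ℝ} (hg : ∀ y, |g y| ≤ K) (n j : ℕ) (y : Y) :
    |birkhoffSum R g n (R^[j] y) - birkhoffSum R g n y| ≤ 2 * j * K := by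
  have h1 := birkhoffSum_add R g n j y
  have h2 := birkhoffSum_add R g j n y
  rw [add_comm j n, h1] at h2
  have h3 := abs_birkhoffSum_le (R := R) g hg j y
  have h4 := abs_birkhoffSum_le (R := R) g hg j (R^[n] y)
  rw [abs_le] at *
  constructor <;> linarith [h3.1, h3.2, h4.1, h4.2]

/-- Birkhoff averages of `g` are close to Birkhoff averages of Birkhoff averages of `g`. -/
lemma abs_birkhoffSum_sub_le (g : Y → ℝ) {K : ℝ} (hg : ∀ y, |g y| ≤ K) (c : ℝ) (n N : ℕ)
    (hN : 0 < N) (y : Y) :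
    |birkhoffSum R g n y - n * c| ≤
      birkhoffSum R (fun y => |birkhoffSum R g N y / N - c|) n y + 2 * N * K := by
  have hK : 0 ≤ K := (abs_nonneg _).trans (hg y)
  have hN' : (0 : ℝ) < N := by exact_mod_cast hN
  -- Moving the starting point by `j < N` steps costs only end effects. Exchanging the two sums then
  -- turns this into a statement on the sum of length `n` of `birkhoffSum R g N`.
  have h1 : |birkhoffSum R (birkhoffSum R g n) N y - N * birkhoffSum R g n y| ≤ N * (2 * N * K) := by
    have : birkhoffSum R (birkhoffSum R g n) N y - N * birkhoffSum R g n y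
        = ∑ j ∈ Finset.range N, (birkhoffSum R g n (R^[j] y) - birkhoffSum R g n y) := by
      rw [Finset.sum_sub_distrib]; simp [birkhoffSum]
    rw [this]
    refine (Finset.abs_sum_le_sum_abs _ _).trans ?_
    calc _ ≤ ∑ j ∈ Finset.range N, 2 * (N : ℝ) * K := by
          refine Finset.sum_le_sum fun j hj => (abs_birkhoffSum_sub_iterate_le g hg n j y).trans ?_
          have : (j : ℝ) ≤ N := by exact_mod_cast (Finset.mem_range.1 hj).le
          gcongr
      _ = _ := by simp
  rw [← birkhoffSum_comm] at h1
  have h2 : |birkhoffSum R (birkhoffSum R g N) n y / N - n * c|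
      ≤ birkhoffSum R (fun y => |birkhoffSum R g N y / N - c|) n y := by
    have : birkhoffSum R (birkhoffSum R g N) n y / N - n * c
        = ∑ j ∈ Finset.range n, (birkhoffSum R g N (R^[j] y) / N - c) := by
      rw [Finset.sum_sub_distrib, ← Finset.sum_div]; simp [birkhoffSum]
    rw [this]
    exact Finset.abs_sum_le_sum_abs _ _
  have h3 : |birkhoffSum R (birkhoffSum R g N) n y / N - birkhoffSum R g n y| ≤ 2 * N * K := by
    have : birkhoffSum R (birkhoffSum R g N) n y / N - birkhoffSum R g n y =
      (birkhoffSum R (birkhoffSum R g N) n y - N * birkhoffSum R g n y) / N := by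
      field_simp
    rw [this, abs_div, abs_of_pos hN', div_le_iff₀ hN']
    linarith
  have := abs_sub_le (birkhoffSum R g n y) (birkhoffSum R (birkhoffSum R g N) n y / N) (n * c)
  rw [abs_sub_comm (birkhoffSum R g n y) (_ / _)] at this
  linarith

variable [MeasurableSpace Y] {ρ : Measure Y}

lemma measurable_birkhoffMax (hR : Measurable R) {g : Y → ℝ} (hg : Measurable g) (n : ℕ) :
    Measurable (birkhoffMax R g n) := by
  induction n with
  | zero => exact measurable_const
  | succ n ih => exact measurable_const.max (hg.add (ih.comp hR))

lemma measurable_birkhoffSum' (hR : Measurable R) {g : Y → ℝ} (hg : Measurable g) (n : ℕ) :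
    Measurable (birkhoffSum R g n) := by
  induction n with
  | zero => rw [birkhoffSum_zero']; exact measurable_const
  | succ n ih =>
    have : birkhoffSum R g (n + 1) = fun y => g y + birkhoffSum R g n (R y) := by
      ext y; exact birkhoffSum_succ' R g n y
    rw [this]
    exact hg.add (ih.comp hR)

/-- A bounded measurable function on a finite measure space is integrable. -/
lemma integrable_of_abs_le [IsFiniteMeasure ρ] {g : Y → ℝ} (hg : Measurable g) {K : ℝ}
    (hK : ∀ y, |g y| ≤ K) : Integrable g ρ :=
  Integrable.of_bound hg.aestronglyMeasurable K (ae_of_all _ hK)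

/-- The maximal ergodic inequality, for bounded nonnegative functions. -/
theorem maximal_ergodic_inequality [IsProbabilityMeasure ρ] (hR : MeasurePreserving R ρ ρ)
    {f : Y → ℝ} (hf : Measurable f) {K : ℝ} (hf0 : ∀ y, 0 ≤ f y) (hfK : ∀ y, f y ≤ K)
    {t : ℝ} (ht : 0 < t) :
    ρ {y | ∃ n : ℕ, n * t < birkhoffSum R f n y} ≤ ENNReal.ofReal ((∫ y, f y ∂ρ) / t) := by
  set g : Y → ℝ := fun y => f y - t with hgdef
  have hg : Measurable g := hf.sub_const t
  have hgK : ∀ y, |g y| ≤ K + t := fun y => by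
    have := hf0 y; have := hfK y
    rw [abs_le]; constructor <;> simp only [hgdef] <;> linarith
  have hfabs : ∀ y, |f y| ≤ K := fun y => by rw [abs_of_nonneg (hf0 y)]; exact hfK y
  have hfi : Integrable f ρ := integrable_of_abs_le hf hfabs
  have hsum : ∀ n y, birkhoffSum R g n y = birkhoffSum R f n y - n * t := fun n y => by
    simp [birkhoffSum, hgdef, Finset.sum_sub_distrib]
  set E : ℕ → Set Y := fun n => {y | 0 < birkhoffMax R g n y} with hE
  have hEm : ∀ n, MeasurableSet (E n) := fun n =>
    measurableSet_lt measurable_const (measurable_birkhoffMax hR.measurable hg n)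
  have hmono : Monotone E := monotone_nat_of_le_succ fun n y hy =>
    lt_of_lt_of_le hy (birkhoffMax_le_succ g n y)
  have hmi : ∀ n, Integrable (birkhoffMax R g n) ρ := fun n =>
    integrable_of_abs_le (measurable_birkhoffMax hR.measurable hg n) (K := n * (K + t)) fun y => by
      rw [abs_of_nonneg (birkhoffMax_nonneg g n y)]; exact birkhoffMax_le g hgK n y
  have key : ∀ n, ρ (E n) ≤ ENNReal.ofReal ((∫ y, f y ∂ρ) / t) := by
    intro n
    -- Passing to `n + 1` allows the recursion to be unfolded: where the maximum is positive it
    -- equals `g y + birkhoffMax R g n (R y)`, which is at most `g y` plus the maximum at `R y`.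
    -- Integrating against an invariant measure gives a nonnegative integral of `g` on `E (n + 1)`.
    have hn : ρ (E n) ≤ ρ (E (n + 1)) := measure_mono (hmono (Nat.le_succ n))
    refine hn.trans ?_
    have h1 : ∫ y, (birkhoffMax R g (n + 1) y - birkhoffMax R g (n + 1) (R y)) ∂ρ
        ≤ ∫ y, (E (n + 1)).indicator g y ∂ρ := by
      refine integral_mono ((hmi _).sub (hR.integrable_comp_of_integrable (hmi _)))
        ((integrable_of_abs_le hg hgK).indicator (hEm _)) fun y => ?_
      by_cases hy : y ∈ E (n + 1)
      · rw [Set.indicator_of_mem hy]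
        have h2 : birkhoffMax R g (n + 1) y = g y + birkhoffMax R g n (R y) := by
          have h3 : 0 < birkhoffMax R g (n + 1) y := hy
          have h4 : birkhoffMax R g (n + 1) y = max 0 (g y + birkhoffMax R g n (R y)) := rfl
          rcases max_choice 0 (g y + birkhoffMax R g n (R y)) with h | h
          · rw [h4, h] at h3; exact absurd h3 (lt_irrefl _)
          · rw [h4, h]
        have := birkhoffMax_le_succ (R := R) g n (R y)
        simp only; linarith
      · rw [Set.indicator_of_notMem hy]
        have h3 : birkhoffMax R g (n + 1) y ≤ 0 := not_lt.1 hy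
        have := birkhoffMax_nonneg (R := R) g (n + 1) (R y)
        simp only; linarith
    have h2 : ∫ y, (birkhoffMax R g (n + 1) y - birkhoffMax R g (n + 1) (R y)) ∂ρ = 0 := by
      have hc : Integrable (fun y => birkhoffMax R g (n + 1) (R y)) ρ :=
        hR.integrable_comp_of_integrable (hmi _)
      rw [integral_sub (hmi _) hc, sub_eq_zero]
      have := integral_map (μ := ρ) hR.measurable.aemeasurable (f := birkhoffMax R g (n + 1))
        (by rw [hR.map_eq]; exact (hmi _).aestronglyMeasurable)
      rwa [hR.map_eq] at this
    rw [h2, integral_indicator (hEm _), integral_sub hfi.integrableOn (integrable_const _)] at h1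
    have h5 : ∫ y in E (n + 1), f y ∂ρ ≤ ∫ y, f y ∂ρ :=
      setIntegral_le_integral hfi (ae_of_all _ hf0)
    rw [setIntegral_const, smul_eq_mul] at h1
    rw [← ofReal_measureReal (measure_ne_top _ _)]
    refine ENNReal.ofReal_le_ofReal ?_
    rw [le_div_iff₀ ht]
    linarith
  have hsub : {y | ∃ n : ℕ, n * t < birkhoffSum R f n y} ⊆ ⋃ n, E n := by
    rintro y ⟨n, hn⟩
    refine Set.mem_iUnion.2 ⟨n, ?_⟩
    have := birkhoffSum_le_birkhoffMax (R := R) g n y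
    rw [hsum] at this
    show 0 < birkhoffMax R g n y
    linarith
  refine (measure_mono hsub).trans ?_
  rw [hmono.measure_iUnion]
  exact iSup_le key

/-- Convergence in mean of the Birkhoff averages to a constant implies almost sure convergence. -/
theorem ae_tendsto_birkhoffSum_div [IsProbabilityMeasure ρ] (hR : MeasurePreserving R ρ ρ)
    {g : Y → ℝ} (hg : Measurable g) {K : ℝ} (hgK : ∀ y, |g y| ≤ K) {c : ℝ}
    (h : Tendsto (fun n : ℕ => ∫ y, |birkhoffSum R g n y / n - c| ∂ρ) atTop (𝓝 0)) :
    ∀ᵐ y ∂ρ, Tendsto (fun n : ℕ => birkhoffSum R g n y / n) atTop (𝓝 c) := by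
  have hgood : ∀ ε : ℝ, 0 < ε → ∀ᵐ y ∂ρ, ∀ᶠ n : ℕ in atTop,
      |birkhoffSum R g n y / n - c| ≤ 2 * ε := by
    intro ε hε
    rw [ae_iff]
    -- The maximal inequality is applied to the deviation of the `N`-step average. Where its
    -- Birkhoff sums stay below `n * ε`, the deviation of the sum of `g` is at most `n * ε + 2 * N *
    -- K`, hence at most `2 * n * ε` for large `n`. Afterwards `N` tends to infinity.
    have hb : ∀ N : ℕ, 0 < N →
        ρ {y | ¬ ∀ᶠ n : ℕ in atTop, |birkhoffSum R g n y / n - c| ≤ 2 * ε} ≤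
          ENNReal.ofReal ((∫ y, |birkhoffSum R g N y / N - c| ∂ρ) / ε) := by
      intro N hN
      have hN' : (0 : ℝ) < N := by exact_mod_cast hN
      have hm : Measurable (fun y => |birkhoffSum R g N y / N - c|) :=
        (((measurable_birkhoffSum' hR.measurable hg N).div_const _).sub_const c).abs
      have hbd : ∀ y, |birkhoffSum R g N y / N - c| ≤ K + |c| := fun y => by
        have h1 := abs_birkhoffSum_le (R := R) g hgK N y
        have h2 : |birkhoffSum R g N y / N| ≤ K := by
          rw [abs_div, abs_of_pos hN', div_le_iff₀ hN']; linarith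
        exact (abs_sub _ _).trans (by linarith)
      refine le_trans (measure_mono ?_) (maximal_ergodic_inequality hR hm (fun y => abs_nonneg _)
        hbd hε)
      intro y hy
      by_contra hcon
      simp only [Set.mem_ofPred_eq, not_exists, not_lt] at hcon
      refine hy ?_
      obtain ⟨n₀, hn₀⟩ := exists_nat_gt (2 * N * K / ε)
      filter_upwards [eventually_ge_atTop n₀, eventually_gt_atTop 0] with n hn hn1
      have hn1' : (0 : ℝ) < n := by exact_mod_cast hn1
      have hn' : (n₀ : ℝ) ≤ n := by exact_mod_cast hn
      have h1 := abs_birkhoffSum_sub_le (R := R) g hgK c n N hN y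
      have h2 := hcon n
      have h3 : 2 * N * K ≤ n * ε := by
        rw [div_lt_iff₀ hε] at hn₀
        have := mul_le_mul_of_nonneg_right hn' hε.le
        linarith
      have : birkhoffSum R g n y / n - c = (birkhoffSum R g n y - n * c) / n := by field_simp
      rw [this, abs_div, abs_of_pos hn1', div_le_iff₀ hn1']
      linarith
    have hlim : Tendsto (fun N : ℕ =>
        ENNReal.ofReal ((∫ y, |birkhoffSum R g N y / N - c| ∂ρ) / ε)) atTop (𝓝 0) := by
      have := (ENNReal.continuous_ofReal.tendsto _).comp (h.div_const ε)
      rw [zero_div, ENNReal.ofReal_zero] at this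
      exact this
    refine le_antisymm (ge_of_tendsto hlim ?_) zero_le
    filter_upwards [eventually_gt_atTop 0] with N hN using hb N hN
  have hall : ∀ᵐ y ∂ρ, ∀ k : ℕ, ∀ᶠ n : ℕ in atTop,
      |birkhoffSum R g n y / n - c| ≤ 2 * (1 / (k + 1)) :=
    ae_all_iff.2 fun k => hgood _ (by positivity)
  filter_upwards [hall] with y hy
  rw [Metric.tendsto_atTop']
  intro ε hε
  obtain ⟨k, hk⟩ := exists_nat_one_div_lt (half_pos hε)
  obtain ⟨n, hn⟩ := eventually_atTop.1 (hy k)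
  refine ⟨n, fun j hj => ?_⟩
  rw [Real.dist_eq]
  linarith [hn j hj.le]

/-- Convergence in mean of the Birkhoff averages to a constant implies almost sure convergence of
the Birkhoff averages in the past. -/
theorem ae_tendsto_birkhoffSum_div_backward [IsProbabilityMeasure ρ]
    (hR : MeasurePreserving R ρ ρ) (hR' : MeasurePreserving R' ρ ρ)
    (hRR' : Function.LeftInverse R R')
    {g : Y → ℝ} (hg : Measurable g) {K : ℝ} (hgK : ∀ y, |g y| ≤ K) {c : ℝ}
    (h : Tendsto (fun n : ℕ => ∫ y, |birkhoffSum R g n y / n - c| ∂ρ) atTop (𝓝 0)) :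
    ∀ᵐ y ∂ρ, Tendsto (fun n : ℕ => birkhoffSum R g n (R'^[n] y) / n) atTop (𝓝 c) := by
  -- Read backwards, the sum ending just before `y` is a sum of `g ∘ R'` along `R'`. The forward
  -- theorem applies to `R'`, and its mean hypothesis transfers because `R'^[n]` preserves `ρ`.
  have hsum : ∀ n y, birkhoffSum R g n (R'^[n] y) = birkhoffSum R' (g ∘ R') n y := by
    intro n
    induction n with
    | zero => intro y; simp
    | succ n ih =>
      intro y
      rw [birkhoffSum_succ' R g, birkhoffSum_succ R' (g ∘ R'), ← ih]
      rw [Function.iterate_succ_apply' R' n y, hRR']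
      simp [add_comm]
  have := ae_tendsto_birkhoffSum_div (c := c) hR' (hg.comp hR'.measurable) (fun y => hgK (R' y))
    (by
      refine h.congr fun n => ?_
      have hm : Measurable fun y => |birkhoffSum R g n y / n - c| :=
        (((measurable_birkhoffSum' hR.measurable hg n).div_const _).sub_const c).abs
      have h2 := integral_map (μ := ρ) (hR'.iterate n).measurable.aemeasurable
        (f := fun y => |birkhoffSum R g n y / n - c|) hm.aestronglyMeasurable
      rw [(hR'.iterate n).map_eq] at h2
      rw [h2]
      simp only [hsum])
  simpa only [hsum] using this

/-- For a uniformly bounded sequence, convergence in measure to a constant implies convergence in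
mean. -/
lemma tendsto_integral_abs_sub [IsProbabilityMeasure ρ] {h : ℕ → Y → ℝ}
    (hm : ∀ n, Measurable (h n)) {K : ℝ} (hK : ∀ n y, |h n y| ≤ K) {c : ℝ}
    (hlim : ∀ ε : ℝ, 0 < ε → Tendsto (fun n => ρ {y | ε < |h n y - c|}) atTop (𝓝 0)) :
    Tendsto (fun n => ∫ y, |h n y - c| ∂ρ) atTop (𝓝 0) := by
  have hbd : ∀ n y, |h n y - c| ≤ K + |c| := fun n y => (abs_sub _ _).trans (by linarith [hK n y])
  have hm' : ∀ n, Measurable fun y => |h n y - c| := fun n => ((hm n).sub_const c).abs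
  have hint : ∀ n, Integrable (fun y => |h n y - c|) ρ := fun n =>
    integrable_of_abs_le (hm' n) fun y => by rw [abs_abs]; exact hbd n y
  rw [Metric.tendsto_atTop]
  intro ε hε
  have hreal : Tendsto (fun n => ρ.real {y | ε / 2 < |h n y - c|} * (K + |c|)) atTop (𝓝 0) := by
    have := ((ENNReal.tendsto_toReal ENNReal.zero_ne_top).comp (hlim _ (half_pos hε))).mul_const
      (K + |c|)
    simpa [Measure.real] using this
  obtain ⟨n₀, hn₀⟩ := eventually_atTop.1 (hreal.eventually (gt_mem_nhds (half_pos hε)))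
  refine ⟨n₀, fun n hn => ?_⟩
  have hE : MeasurableSet {y | ε / 2 < |h n y - c|} := measurableSet_lt measurable_const (hm' n)
  have h1 : ∫ y, |h n y - c| ∂ρ ≤
      ∫ y, (ε / 2 + {y | ε / 2 < |h n y - c|}.indicator (fun _ => K + |c|) y) ∂ρ := by
    refine integral_mono (hint n) ((integrable_const _).add ((integrable_const _).indicator hE))
      fun y => ?_
    by_cases hy : y ∈ {y | ε / 2 < |h n y - c|}
    · simp only [Set.indicator_of_mem hy]; linarith [hbd n y]
    · simp only [Set.indicator_of_notMem hy]; have := not_lt.1 (show ¬ (ε / 2 < |h n y - c|) from hy); linarith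
  rw [integral_add (integrable_const _) ((integrable_const _).indicator hE),
    integral_indicator hE, setIntegral_const, integral_const] at h1
  simp only [smul_eq_mul, probReal_univ, one_mul] at h1
  rw [Real.dist_eq, sub_zero, abs_of_nonneg (integral_nonneg fun y => abs_nonneg _)]
  linarith [hn₀ n hn]

end Birkhoff

/-! ### Norm and area growth of a linear operator -/

section LinearAlgebra

variable {d : ℕ}

/-- The Gram determinant of two vectors: the square of the area of the parallelogram they span. -/
def gram (u v : Vec d) : ℝ := ‖u‖ ^ 2 * ‖v‖ ^ 2 - inner ℝ u v ^ 2

lemma gram_le (u v : Vec d) : gram u v ≤ ‖u‖ ^ 2 * ‖v‖ ^ 2 :=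
  sub_le_self _ (sq_nonneg _)

lemma gram_nonneg (u v : Vec d) : 0 ≤ gram u v := by
  have h := abs_real_inner_le_norm u v
  have := mul_self_le_mul_self (abs_nonneg _) h
  rw [abs_mul_abs_self] at this
  unfold gram
  nlinarith

/-- Vectors with vanishing Gram determinant are collinear. -/
lemma mem_span_of_gram_eq_zero {u v : Vec d} (hu : u ≠ 0) (h : gram u v = 0) :
    v ∈ Submodule.span ℝ {u} := by
  have hu' : ‖u‖ ^ 2 ≠ 0 := by positivity
  refine Submodule.mem_span_singleton.2 ⟨inner ℝ u v / ‖u‖ ^ 2, ?_⟩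
  -- The squared distance from `v` to its projection on the line of `u` is `gram u v / ‖u‖ ^ 2`.
  rw [← sub_eq_zero, ← norm_eq_zero, ← sq_eq_zero_iff, norm_sub_sq_real, norm_smul, mul_pow,
    Real.norm_eq_abs, sq_abs, real_inner_smul_left]
  unfold gram at h
  field_simp
  linear_combination h

/-- The Lagrange identity, with weights. -/
lemma lagrange_identity {n : ℕ} (s a b : Fin n → ℝ) :
    ∑ i, ∑ j, s i * s j * (a i * b j - a j * b i) ^ 2 =
      2 * ((∑ i, s i * a i ^ 2) * (∑ i, s i * b i ^ 2) - (∑ i, s i * (a i * b i)) ^ 2) := by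
  have h1 : ∀ i j, s i * s j * (a i * b j - a j * b i) ^ 2 =
      (s i * a i ^ 2) * (s j * b j ^ 2) + (s i * b i ^ 2) * (s j * a j ^ 2)
        - 2 * ((s i * (a i * b i)) * (s j * (a j * b j))) := fun i j => by ring
  simp only [h1, Finset.sum_sub_distrib, Finset.sum_add_distrib, ← Finset.mul_sum,
    ← Finset.sum_mul]
  ring

/-- The singular value decomposition: coordinates in an orthonormal basis of right singular
vectors. -/
lemma exists_singular_basis (g : Vec d →L[ℝ] Vec d) :
    ∃ b : OrthonormalBasis (Fin d) ℝ (Vec d), ∀ u v : Vec d,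
      inner ℝ (g u) (g v) =
        ∑ i : Fin d, (g : Vec d →ₗ[ℝ] Vec d).singularValues i ^ 2 * (b.repr u i * b.repr v i) := by
  set T : Vec d →ₗ[ℝ] Vec d := (g : Vec d →ₗ[ℝ] Vec d)
  have hn : Module.finrank ℝ (Vec d) = d := by simp
  refine ⟨T.isSymmetric_adjoint_comp_self.eigenvectorBasis hn, fun u v => ?_⟩
  set b := T.isSymmetric_adjoint_comp_self.eigenvectorBasis hn
  have h1 : inner ℝ (g u) (g v) = inner ℝ u ((LinearMap.adjoint T ∘ₗ T) v) := by
    rw [LinearMap.comp_apply, LinearMap.adjoint_inner_right]; rfl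
  rw [h1, ← b.repr.inner_map_map, PiLp.inner_apply]
  refine Finset.sum_congr rfl fun i _ => ?_
  rw [T.isSymmetric_adjoint_comp_self.eigenvectorBasis_apply_self_apply hn,
    T.sq_singularValues_fin hn]
  simp only [RCLike.inner_apply, conj_trivial, RCLike.ofReal_real_eq_id, id_eq]
  ring

lemma sq_norm_eq_sum_repr (b : OrthonormalBasis (Fin d) ℝ (Vec d)) (u : Vec d) :
    ‖u‖ ^ 2 = ∑ i, b.repr u i ^ 2 := by
  rw [← b.repr.norm_map, EuclideanSpace.norm_sq_eq]
  simp

lemma inner_eq_sum_repr (b : OrthonormalBasis (Fin d) ℝ (Vec d)) (u v : Vec d) :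
    inner ℝ u v = ∑ i, b.repr u i * b.repr v i := by
  rw [← b.repr.inner_map_map, PiLp.inner_apply]
  simp [mul_comm]

/-- Area growth is bounded by the product of the two largest singular values. -/
lemma gram_map_le (g : Vec d →L[ℝ] Vec d) (u v : Vec d) :
    gram (g u) (g v) ≤ ((g : Vec d →ₗ[ℝ] Vec d).singularValues 0 *
      (g : Vec d →ₗ[ℝ] Vec d).singularValues 1) ^ 2 * gram u v := by
  obtain ⟨b, hb⟩ := exists_singular_basis g
  set s := (g : Vec d →ₗ[ℝ] Vec d).singularValues
  have h0 : ∀ i, 0 ≤ s i := LinearMap.singularValues_nonneg _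
  have hanti : Antitone s := LinearMap.singularValues_antitone _
  have hl := lagrange_identity (fun i : Fin d => s i ^ 2) (b.repr u) (b.repr v)
  have hr := lagrange_identity (fun i : Fin d => 1) (b.repr u) (b.repr v)
  have e1 : gram (g u) (g v) = (∑ i : Fin d, s i ^ 2 * b.repr u i ^ 2) *
      (∑ i : Fin d, s i ^ 2 * b.repr v i ^ 2) -
      (∑ i : Fin d, s i ^ 2 * (b.repr u i * b.repr v i)) ^ 2 := by
    rw [gram, ← real_inner_self_eq_norm_sq, ← real_inner_self_eq_norm_sq, hb, hb, hb]
    simp only [sq]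
  have e2 : gram u v = (∑ i : Fin d, 1 * b.repr u i ^ 2) *
      (∑ i : Fin d, 1 * b.repr v i ^ 2) -
      (∑ i : Fin d, 1 * (b.repr u i * b.repr v i)) ^ 2 := by
    rw [gram, sq_norm_eq_sum_repr b, sq_norm_eq_sum_repr b, inner_eq_sum_repr b]
    simp
  have hle : ∑ i : Fin d, ∑ j : Fin d, s i ^ 2 * s j ^ 2 *
        (b.repr u i * b.repr v j - b.repr u j * b.repr v i) ^ 2 ≤
      (s 0 * s 1) ^ 2 * ∑ i : Fin d, ∑ j : Fin d, 1 * 1 *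
        (b.repr u i * b.repr v j - b.repr u j * b.repr v i) ^ 2 := by
    rw [Finset.mul_sum]
    refine Finset.sum_le_sum fun i _ => ?_
    rw [Finset.mul_sum]
    refine Finset.sum_le_sum fun j _ => ?_
    rw [one_mul, one_mul]
    by_cases hij : i = j
    · subst hij; simp [sub_self]
    · refine mul_le_mul_of_nonneg_right ?_ (sq_nonneg _)
      rw [← mul_pow]
      refine pow_le_pow_left₀ (mul_nonneg (h0 _) (h0 _)) ?_ 2
      -- Two distinct indices cannot both be `0`, so the product of the two singular values is at
      -- most that of the first two.
      rcases Nat.eq_zero_or_pos (i : ℕ) with hi | hi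
      · have hj : 1 ≤ (j : ℕ) := by
          rcases Nat.eq_zero_or_pos (j : ℕ) with hj | hj
          · exact absurd (Fin.ext (hi.trans hj.symm)) hij
          · exact hj
        exact mul_le_mul (hanti (Nat.zero_le _)) (hanti hj) (h0 _) (h0 _)
      · rw [mul_comm (s 0)]
        exact mul_le_mul (hanti hi) (hanti (Nat.zero_le _)) (h0 _) (h0 _)
  rw [hl, hr] at hle
  rw [e1, e2]
  linarith

lemma norm_map_le_singularValues (g : Vec d →L[ℝ] Vec d) (v : Vec d) :
    ‖g v‖ ≤ (g : Vec d →ₗ[ℝ] Vec d).singularValues 0 * ‖v‖ := by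
  obtain ⟨b, hb⟩ := exists_singular_basis g
  have h0 := LinearMap.singularValues_nonneg (g : Vec d →ₗ[ℝ] Vec d)
  have hanti := LinearMap.singularValues_antitone (g : Vec d →ₗ[ℝ] Vec d)
  refine le_of_sq_le_sq ?_ (mul_nonneg (h0 0) (norm_nonneg _))
  rw [← real_inner_self_eq_norm_sq, hb, mul_pow, sq_norm_eq_sum_repr b, Finset.mul_sum]
  refine Finset.sum_le_sum fun i _ => ?_
  rw [← sq (b.repr v i)]
  exact mul_le_mul_of_nonneg_right (pow_le_pow_left₀ (h0 _) (hanti (Nat.zero_le _)) 2)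
    (sq_nonneg _)

/-- The first right singular vector. -/
lemma exists_top_singular_vector [NeZero d] (g : Vec d →L[ℝ] Vec d) :
    ∃ r : Vec d, ‖r‖ = 1 ∧ ∀ v, (g : Vec d →ₗ[ℝ] Vec d).singularValues 0 * |inner ℝ r v| ≤ ‖g v‖ := by
  obtain ⟨b, hb⟩ := exists_singular_basis g
  have h0 := LinearMap.singularValues_nonneg (g : Vec d →ₗ[ℝ] Vec d)
  refine ⟨b 0, b.orthonormal.1 0, fun v => ?_⟩
  refine le_of_sq_le_sq ?_ (norm_nonneg _)
  rw [← real_inner_self_eq_norm_sq (g v), hb, mul_pow, sq_abs, ← b.repr_apply_apply]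
  have := Finset.single_le_sum (f := fun i : Fin d =>
    (g : Vec d →ₗ[ℝ] Vec d).singularValues i ^ 2 * (b.repr v i * b.repr v i))
    (fun i _ => mul_nonneg (sq_nonneg _) (mul_self_nonneg _)) (Finset.mem_univ (0 : Fin d))
  simpa [sq] using this

lemma singularValues_zero_eq_norm [NeZero d] (g : Vec d →L[ℝ] Vec d) :
    (g : Vec d →ₗ[ℝ] Vec d).singularValues 0 = ‖g‖ := by
  refine le_antisymm ?_ (g.opNorm_le_bound (LinearMap.singularValues_nonneg _ 0)
    (norm_map_le_singularValues g))
  obtain ⟨r, hr, h⟩ := exists_top_singular_vector g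
  have h1 := h r
  rw [real_inner_self_eq_norm_sq, hr] at h1
  have := g.le_opNorm r
  rw [hr] at this
  simp at h1
  linarith

/-- Both leading singular values are at most the norm. This crude form serves for the bounded
changes of trivialization. -/
lemma gram_map_le_norm [NeZero d] (g : Vec d →L[ℝ] Vec d) (u v : Vec d) :
    gram (g u) (g v) ≤ ‖g‖ ^ 4 * gram u v := by
  refine (gram_map_le g u v).trans (mul_le_mul_of_nonneg_right ?_ (gram_nonneg _ _))
  have h0 := LinearMap.singularValues_nonneg (g : Vec d →ₗ[ℝ] Vec d)
  have h1 := LinearMap.singularValues_antitone (g : Vec d →ₗ[ℝ] Vec d) zero_le_one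
  rw [singularValues_zero_eq_norm] at *
  calc (‖g‖ * _) ^ 2 ≤ (‖g‖ * ‖g‖) ^ 2 :=
        pow_le_pow_left₀ (mul_nonneg (norm_nonneg _) (h0 1)) (by gcongr) 2
    _ = _ := by ring

lemma exteriorNorm_zero [NeZero d] (g : GLd d) : exteriorNorm 0 g = ‖g.1‖ := by
  have : Finset.Iic (0 : Fin d) = {0} := by
    ext i; simp
  rw [exteriorNorm, this, Finset.prod_singleton, ← singularValues_zero_eq_norm]
  simp

lemma Iic_one_eq {d : ℕ} [NeZero d] (i : Fin d) (hi : (i : ℕ) = 1) :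
    Finset.Iic i = {0, i} := by
  ext j
  simp only [Finset.mem_Iic, Finset.mem_insert, Finset.mem_singleton, Fin.ext_iff, Fin.le_def, hi,
    Fin.val_zero]
  omega

lemma gram_map_le_exteriorNorm [NeZero d] (g : GLd d) (i : Fin d) (hi : (i : ℕ) = 1) (u v : Vec d) :
    gram (g.1 u) (g.1 v) ≤ exteriorNorm i g ^ 2 * gram u v := by
  have h0 : (0 : Fin d) ≠ i := fun h => by rw [← h] at hi; simp at hi
  rw [exteriorNorm, Iic_one_eq i hi, Finset.prod_pair h0, hi]
  simpa using gram_map_le g.1 u v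

lemma gram_eq_zero_of_subsingleton (hd : d = 1) (u v : Vec d) : gram u v = 0 := by
  subst hd
  simp [gram, EuclideanSpace.norm_sq_eq, PiLp.inner_apply]
  ring

end LinearAlgebra

/-! ### The shift and the iterates of a cocycle -/

section Iterates

variable {m d : ℕ} {A : Fin m → Fin m → Prop}

lemma isClosed_setOf_allowed (A : Fin m → Fin m → Prop) :
    IsClosed {x : ℤ → Fin m | ∀ i, A (x i) (x (i + 1))} := by
  have : {x : ℤ → Fin m | ∀ i, A (x i) (x (i + 1))} =
      ⋂ i : ℤ, (fun x : ℤ → Fin m => (x i, x (i + 1))) ⁻¹' {p | A p.1 p.2} := by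
    ext x; simp
  rw [this]
  exact isClosed_iInter fun i => (isClosed_discrete _).preimage (by fun_prop)

instance : CompactSpace (SFT A) :=
  isCompact_iff_compactSpace.1 (isClosed_setOf_allowed A).isCompact

instance : SecondCountableTopology (SFT A) :=
  Topology.IsEmbedding.subtypeVal.secondCountableTopology

instance : TopologicalSpace.MetrizableSpace (SFT A) :=
  Topology.IsEmbedding.subtypeVal.metrizableSpace

lemma continuous_coord (i : ℤ) : Continuous fun x : SFT A => x.1 i :=
  (continuous_apply i).comp continuous_subtype_val

lemma continuous_shift : Continuous (shift A) :=
  Continuous.subtype_mk (continuous_pi fun i => continuous_coord (i + 1)) _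

lemma continuous_shift_symm : Continuous (shift A).symm :=
  Continuous.subtype_mk (continuous_pi fun i => continuous_coord (i - 1)) _

lemma shift_apply (x : SFT A) (i : ℤ) : (shift A x).1 i = x.1 (i + 1) := rfl

lemma shift_symm_apply (x : SFT A) (i : ℤ) : ((shift A).symm x).1 i = x.1 (i - 1) := rfl

lemma shift_iterate_apply (n : ℕ) (x : SFT A) (i : ℤ) :
    ((shift A)^[n] x).1 i = x.1 (i + n) := by
  induction n generalizing x with
  | zero => simp
  | succ n ih =>
    rw [Function.iterate_succ_apply, ih, shift_apply, Nat.cast_succ, add_assoc]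

lemma shift_symm_iterate_apply (n : ℕ) (x : SFT A) (i : ℤ) :
    ((shift A).symm^[n] x).1 i = x.1 (i - n) := by
  induction n generalizing x with
  | zero => simp
  | succ n ih =>
    rw [Function.iterate_succ_apply, ih, shift_symm_apply, Nat.cast_succ, sub_sub]

lemma shift_iterate_symm_iterate (n : ℕ) (x : SFT A) :
    (shift A)^[n] ((shift A).symm^[n] x) = x :=
  Function.LeftInverse.iterate (shift A).apply_symm_apply n x

lemma measurePreserving_shift_symm {μ : Measure (SFT A)} (h : MeasurePreserving (shift A) μ μ) :
    MeasurePreserving (shift A).symm μ μ := by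
  refine ⟨continuous_shift_symm.measurable, ?_⟩
  conv_lhs => rw [← h.map_eq]
  rw [Measure.map_map continuous_shift_symm.measurable continuous_shift.measurable]
  simp

variable {M N L : SFT A → GLd d}

lemma iterNat_succ_eq (n : ℕ) (x : SFT A) :
    iterNat M (n + 1) x = M ((shift A)^[n] x) * iterNat M n x := rfl

lemma iterNat_conj (hN : ∀ x, N x = L (shift A x) * M x * (L x)⁻¹) (n : ℕ) (x : SFT A) :
    iterNat N n x = L ((shift A)^[n] x) * iterNat M n x * (L x)⁻¹ := by
  induction n with
  | zero => simp [iterNat]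
  | succ n ih =>
    rw [iterNat_succ_eq, iterNat_succ_eq, ih, hN, Function.iterate_succ_apply']
    group

/-- Sets defined through a fixed iterate are therefore clopen, and functions of a fixed iterate are
continuous, whatever choices they involve. -/
lemma isLocallyConstant_iterNat (hM : IsLocallyConstant M) (n : ℕ) :
    IsLocallyConstant (iterNat M n) := by
  induction n with
  | zero => exact IsLocallyConstant.const 1
  | succ n ih => exact (hM.comp_continuous (continuous_shift.iterate n)).mul ih

/-- The vector `v` grows at rate `l` in the future. -/
def FwdGrowth (M : SFT A → GLd d) (l : ℝ) (x : SFT A) (v : Vec d) : Prop :=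
  Tendsto (fun n : ℕ => Real.log ‖(iterNat M n x).1 v‖ / n) atTop (𝓝 l)

/-- The vector `v` grows at rate `l` in the past. -/
def BwdGrowth (M : SFT A → GLd d) (l : ℝ) (x : SFT A) (v : Vec d) : Prop :=
  Tendsto (fun n : ℕ => Real.log ‖((iterNat M n ((shift A).symm^[n] x))⁻¹).1 v‖ / n) atTop (𝓝 (-l))

lemma iter_natCast (n : ℕ) (x : SFT A) : iter M n x = iterNat M n x := rfl

lemma iter_neg_natCast (n : ℕ) (x : SFT A) :
    iter M (-n) x = (iterNat M n ((shift A).symm^[n] x))⁻¹ := by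
  cases n with
  | zero => show iterNat M 0 x = _; simp [iterNat]
  | succ n => rfl

/-- The limit at `-∞` is reindexed by natural numbers; dividing by `-n` instead of `n` accounts for
the rate `-l` in `BwdGrowth`. -/
lemma mem_oseledets {l : ℝ} {x : SFT A} {v : Vec d} :
    v ∈ oseledets M l x ↔ v = 0 ∨ (FwdGrowth M l x v ∧ BwdGrowth M l x v) := by
  have h1 : ∀ f : ℤ → ℝ, Tendsto f atTop (𝓝 l) ↔ Tendsto (fun n : ℕ => f n) atTop (𝓝 l) :=
    fun f => by
      rw [← Nat.map_cast_int_atTop, tendsto_map'_iff]; rfl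
  have h2 : ∀ f : ℤ → ℝ, Tendsto f atBot (𝓝 l) ↔ Tendsto (fun n : ℕ => f (-n)) atTop (𝓝 l) :=
    fun f => by
      rw [← h1 (fun n => f (-n)), ← map_neg_atTop, tendsto_map'_iff]; rfl
  show (v = 0 ∨ _) ↔ _
  rw [h1, h2]
  unfold FwdGrowth BwdGrowth
  simp only [iter_natCast, iter_neg_natCast]
  have h3 : ∀ f : ℕ → ℝ, Tendsto (fun n : ℕ => f n / ((-(n : ℤ) : ℤ) : ℝ)) atTop (𝓝 l) ↔
      Tendsto (fun n : ℕ => f n / n) atTop (𝓝 (-l)) := fun f => by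
    rw [← tendsto_neg_iff]
    simp [div_neg]
  rw [h3]
  simp

lemma units_val_apply_ne_zero (g : GLd d) {v : Vec d} (hv : v ≠ 0) : g.1 v ≠ 0 := fun h => by
  have : (g⁻¹ * g).1 v = 0 := by
    rw [Units.val_mul, mul_apply_eq_comp, h, map_zero]
  rw [inv_mul_cancel] at this
  exact hv this

lemma units_inv_apply_apply (g : GLd d) (v : Vec d) : g⁻¹.1 (g.1 v) = v := by
  rw [← mul_apply_eq_comp, ← Units.val_mul, inv_mul_cancel]; rfl

lemma units_apply_inv_apply (g : GLd d) (v : Vec d) : g.1 (g⁻¹.1 v) = v := by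
  rw [← mul_apply_eq_comp, ← Units.val_mul, mul_inv_cancel]; rfl

/-- A continuous function to `GL_d` on a compact space is bounded together with its inverse. -/
lemma exists_bound_units (hL : Continuous L) :
    ∃ K : ℝ, 1 ≤ K ∧ ∀ x, ‖(L x).1‖ ≤ K ∧ ‖((L x)⁻¹).1‖ ≤ K := by
  obtain ⟨K₁, h₁⟩ := isCompact_univ.exists_bound_of_continuousOn
    (Units.continuous_val.comp hL).continuousOn
  obtain ⟨K₂, h₂⟩ := isCompact_univ.exists_bound_of_continuousOn
    (Units.continuous_val.comp hL.inv).continuousOn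
  exact ⟨max 1 (max K₁ K₂), le_max_left _ _, fun x =>
    ⟨(h₁ x trivial).trans ((le_max_left _ _).trans (le_max_right _ _)),
      (h₂ x trivial).trans ((le_max_right _ _).trans (le_max_right _ _))⟩⟩

/-- Sequences of positive numbers which are comparable up to constants have the same exponential
growth rate. -/
lemma tendsto_log_div_of_comparable {a b : ℕ → ℝ} (ha : ∀ n, 0 < a n) (hb : ∀ n, 0 < b n) {K l : ℝ}
    (hK : 0 < K) (hab : ∀ n, a n ≤ K * b n) (hba : ∀ n, b n ≤ K * a n)
    (h : Tendsto (fun n : ℕ => Real.log (a n) / n) atTop (𝓝 l)) :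
    Tendsto (fun n : ℕ => Real.log (b n) / n) atTop (𝓝 l) := by
  have hz : Tendsto (fun n : ℕ => |Real.log K| / n) atTop (𝓝 0) :=
    tendsto_const_div_atTop_nhds_zero_nat _
  have hd : Tendsto (fun n : ℕ => Real.log (b n) / n - Real.log (a n) / n) atTop (𝓝 0) := by
    refine squeeze_zero_norm (fun n => ?_) hz
    rw [← sub_div, Real.norm_eq_abs, abs_div, Nat.abs_cast]
    refine div_le_div_of_nonneg_right ?_ (Nat.cast_nonneg n)
    have h1 := Real.log_le_log (ha n) (hab n)
    have h2 := Real.log_le_log (hb n) (hba n)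
    rw [Real.log_mul hK.ne' (hb n).ne'] at h1
    rw [Real.log_mul hK.ne' (ha n).ne'] at h2
    have h3 := le_abs_self (Real.log K)
    rw [abs_le]; constructor <;> linarith
  simpa using h.add hd

lemma norm_apply_pos (g : GLd d) {v : Vec d} (hv : v ≠ 0) : 0 < ‖g.1 v‖ :=
  norm_pos_iff.2 (units_val_apply_ne_zero g hv)

lemma norm_mul_apply_le {K : ℝ} (g h : GLd d) (hg : ‖g.1‖ ≤ K) (v : Vec d) :
    ‖(g * h).1 v‖ ≤ K * ‖h.1 v‖ := by
  rw [Units.val_mul, mul_apply_eq_comp]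
  exact (g.1.le_opNorm _).trans (by gcongr)

lemma norm_apply_le_mul {K : ℝ} (g h : GLd d) (hg : ‖g⁻¹.1‖ ≤ K) (v : Vec d) :
    ‖h.1 v‖ ≤ K * ‖(g * h).1 v‖ := by
  have := norm_mul_apply_le g⁻¹ (g * h) hg v
  rwa [inv_mul_cancel_left] at this

/-- The two vector norms differ by factors `L` and `L⁻¹` along the orbit, which are bounded by
compactness and vanish after taking logarithms and dividing by `n`. -/
lemma fwdGrowth_conj (hL : Continuous L) (hN : ∀ x, N x = L (shift A x) * M x * (L x)⁻¹) {l : ℝ}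
    {x : SFT A} {v : Vec d} (hv : v ≠ 0) :
    FwdGrowth N l x ((L x).1 v) ↔ FwdGrowth M l x v := by
  obtain ⟨K, hK1, hK⟩ := exists_bound_units hL
  have hK0 : 0 < K := by linarith
  have e : ∀ n, (iterNat N n x).1 ((L x).1 v) = (L ((shift A)^[n] x) * iterNat M n x).1 v := by
    intro n
    rw [iterNat_conj hN, Units.val_mul _ (L x)⁻¹, mul_apply_eq_comp,
      units_inv_apply_apply]
  unfold FwdGrowth
  simp only [e]
  have h1 : ∀ n, ‖(L ((shift A)^[n] x) * iterNat M n x).1 v‖ ≤ K * ‖(iterNat M n x).1 v‖ :=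
    fun n => norm_mul_apply_le _ _ (hK _).1 v
  have h2 : ∀ n, ‖(iterNat M n x).1 v‖ ≤ K * ‖(L ((shift A)^[n] x) * iterNat M n x).1 v‖ :=
    fun n => norm_apply_le_mul _ _ (hK _).2 v
  exact ⟨tendsto_log_div_of_comparable (fun n => norm_apply_pos _ hv)
    (fun n => norm_apply_pos _ hv) hK0 h1 h2, tendsto_log_div_of_comparable
    (fun n => norm_apply_pos _ hv) (fun n => norm_apply_pos _ hv) hK0 h2 h1⟩

lemma bwdGrowth_conj (hL : Continuous L) (hN : ∀ x, N x = L (shift A x) * M x * (L x)⁻¹) {l : ℝ}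
    {x : SFT A} {v : Vec d} (hv : v ≠ 0) :
    BwdGrowth N l x ((L x).1 v) ↔ BwdGrowth M l x v := by
  obtain ⟨K, hK1, hK⟩ := exists_bound_units hL
  have hK0 : 0 < K := by linarith
  have e : ∀ n, ((iterNat N n ((shift A).symm^[n] x))⁻¹).1 ((L x).1 v) =
      (L ((shift A).symm^[n] x) * (iterNat M n ((shift A).symm^[n] x))⁻¹).1 v := by
    intro n
    rw [iterNat_conj hN, shift_iterate_symm_iterate]
    rw [← mul_apply_eq_comp, ← Units.val_mul]
    congr 2
    group
  unfold BwdGrowth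
  simp only [e]
  have h1 := fun n => norm_mul_apply_le (L ((shift A).symm^[n] x))
    (iterNat M n ((shift A).symm^[n] x))⁻¹ (hK _).1 v
  have h2 := fun n => norm_apply_le_mul (L ((shift A).symm^[n] x))
    (iterNat M n ((shift A).symm^[n] x))⁻¹ (hK _).2 v
  exact ⟨tendsto_log_div_of_comparable (fun n => norm_apply_pos _ hv)
    (fun n => norm_apply_pos _ hv) hK0 h1 h2, tendsto_log_div_of_comparable
    (fun n => norm_apply_pos _ hv) (fun n => norm_apply_pos _ hv) hK0 h2 h1⟩

lemma log_norm_smul_div (c : ℝ) (hc : c ≠ 0) {u : Vec d} (hu : u ≠ 0) :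
    Real.log ‖c • u‖ = Real.log |c| + Real.log ‖u‖ := by
  rw [norm_smul, Real.norm_eq_abs, Real.log_mul (abs_ne_zero.2 hc) (norm_ne_zero_iff.2 hu)]

lemma tendsto_log_norm_smul_div {l : ℝ} {g : ℕ → GLd d} {c : ℝ} (hc : c ≠ 0) {v : Vec d}
    (hv : v ≠ 0) (h : Tendsto (fun n : ℕ => Real.log ‖(g n).1 v‖ / n) atTop (𝓝 l)) :
    Tendsto (fun n : ℕ => Real.log ‖(g n).1 (c • v)‖ / n) atTop (𝓝 l) := by
  have := h.add (tendsto_const_div_atTop_nhds_zero_nat (Real.log |c|))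
  rw [add_zero] at this
  refine this.congr fun n => ?_
  rw [map_smul, log_norm_smul_div c hc (units_val_apply_ne_zero _ hv)]
  ring

lemma FwdGrowth.smul {l : ℝ} {x : SFT A} {v : Vec d} (h : FwdGrowth M l x v) {c : ℝ} (hc : c ≠ 0)
    (hv : v ≠ 0) : FwdGrowth M l x (c • v) :=
  tendsto_log_norm_smul_div hc hv h

lemma BwdGrowth.smul {l : ℝ} {x : SFT A} {v : Vec d} (h : BwdGrowth M l x v) {c : ℝ} (hc : c ≠ 0)
    (hv : v ≠ 0) : BwdGrowth M l x (c • v) :=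
  tendsto_log_norm_smul_div (g := fun n => (iterNat M n ((shift A).symm^[n] x))⁻¹) hc hv h

end Iterates

/-! ### The projective action -/

section Projective

variable {m d : ℕ} {A : Fin m → Fin m → Prop}

/-- The saturation of an open set is the union of its multiples by nonzero scalars, hence open.
Openness matters because it survives products, which gives joint continuity on the projective
bundle. -/
lemma isOpenQuotientMap_mk' :
    IsOpenQuotientMap (Projectivization.mk' ℝ : {v : Vec d // v ≠ 0} → Proj d) := by
  have hq : IsQuotientMap (Projectivization.mk' ℝ : {v : Vec d // v ≠ 0} → Proj d) :=
    ⟨⟨rfl⟩, fun p => ⟨⟨p.rep, p.rep_nonzero⟩, p.mk_rep⟩⟩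
  refine ⟨hq.surjective, hq.continuous, fun U hU => ?_⟩
  rw [← hq.isOpen_preimage]
  have : Projectivization.mk' ℝ ⁻¹' (Projectivization.mk' ℝ '' U) =
      ⋃ c : ℝˣ, (fun v : {v : Vec d // v ≠ 0} =>
        (⟨c • v.1, (smul_ne_zero_iff_ne c).2 v.2⟩ : {v : Vec d // v ≠ 0})) ⁻¹' U := by
    ext v
    simp only [Set.mem_preimage, Set.mem_image, Set.mem_iUnion]
    constructor
    · rintro ⟨w, hw, h⟩
      obtain ⟨c, hc⟩ := (Projectivization.mk_eq_mk_iff ℝ _ _ w.2 v.2).1 h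
      exact ⟨c, by convert hw⟩
    · rintro ⟨c, hc⟩
      exact ⟨_, hc, (Projectivization.mk_eq_mk_iff ℝ _ _ _ v.2).2 ⟨c, rfl⟩⟩
  rw [this]
  refine isOpen_iUnion fun c => hU.preimage ?_
  exact Continuous.subtype_mk (continuous_subtype_val.const_smul (c : ℝ)) _

lemma projMap_mk (g : GLd d) (v : Vec d) (hv : v ≠ 0) :
    projMap g (Projectivization.mk ℝ v hv) =
      Projectivization.mk ℝ (g.1 v) (units_val_apply_ne_zero g hv) := rfl

lemma projMap_mul (g h : GLd d) (p : Proj d) : projMap (g * h) p = projMap g (projMap h p) := by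
  induction p using Projectivization.ind with
  | h v hv => rfl

lemma projMap_one (p : Proj d) : projMap (1 : GLd d) p = p := by
  induction p using Projectivization.ind with
  | h v hv => rfl

lemma projMap_inv_projMap (g : GLd d) (p : Proj d) : projMap g⁻¹ (projMap g p) = p := by
  rw [← projMap_mul, inv_mul_cancel, projMap_one]

lemma projMap_projMap_inv (g : GLd d) (p : Proj d) : projMap g (projMap g⁻¹ p) = p := by
  rw [← projMap_mul, mul_inv_cancel, projMap_one]

/-- The projective action is jointly continuous. -/
lemma continuous_projMap_prod {X : Type*} [TopologicalSpace X] {M : X → GLd d}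
    (hM : Continuous M) : Continuous fun p : X × Proj d => projMap (M p.1) p.2 := by
  have hq := (IsOpenQuotientMap.id (X := X)).prodMap (isOpenQuotientMap_mk' (d := d))
  rw [hq.isQuotientMap.continuous_iff]
  have : ((fun p : X × Proj d => projMap (M p.1) p.2) ∘
      Prod.map id (Projectivization.mk' ℝ)) =
      Projectivization.mk' ℝ ∘ fun p : X × {v : Vec d // v ≠ 0} =>
        ⟨(M p.1).1 p.2.1, units_val_apply_ne_zero _ p.2.2⟩ := rfl
  rw [this]
  refine isOpenQuotientMap_mk'.continuous.comp (Continuous.subtype_mk ?_ _)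
  exact (Units.continuous_val.comp (hM.comp continuous_fst)).clm_apply
    (continuous_subtype_val.comp continuous_snd)

lemma continuous_projMap (g : GLd d) : Continuous (projMap g) :=
  (continuous_projMap_prod (X := Unit) (M := fun _ => g) continuous_const).comp
    (Continuous.prodMk_right ())

lemma measurable_projMap_prod {M : SFT A → GLd d} (hM : Continuous M) :
    Measurable fun p : SFT A × Proj d => projMap (M p.1) p.2 :=
  (continuous_projMap_prod hM).measurable

lemma measurable_projFibered {M : SFT A → GLd d} (hM : Continuous M) :
    Measurable (projFibered M) :=
  (continuous_shift.measurable.comp measurable_fst).prodMk (measurable_projMap_prod hM)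

/-- The logarithmic expansion rate of `g` along a line. -/
def logExp (g : GLd d) (p : Proj d) : ℝ := Real.log (‖g.1 p.rep‖ / ‖p.rep‖)

lemma logExp_mk (g : GLd d) (v : Vec d) (hv : v ≠ 0) :
    logExp g (Projectivization.mk ℝ v hv) = Real.log (‖g.1 v‖ / ‖v‖) := by
  obtain ⟨c, hc⟩ := Projectivization.exists_smul_eq_mk_rep ℝ v hv
  have hc0 : ‖(c : ℝ)‖ ≠ 0 := norm_ne_zero_iff.2 c.ne_zero
  rw [logExp, ← hc, Units.smul_def, map_smul, norm_smul, norm_smul, mul_div_mul_left _ _ hc0]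

lemma logExp_mk_unit (g : GLd d) (v : Vec d) (hv : v ≠ 0) (h1 : ‖v‖ = 1) :
    logExp g (Projectivization.mk ℝ v hv) = Real.log ‖g.1 v‖ := by
  rw [logExp_mk, h1, div_one]

/-- This additivity makes the expansion of the iterates a Birkhoff sum over the projective bundle.
-/
lemma logExp_mul (g h : GLd d) (p : Proj d) :
    logExp (g * h) p = logExp g (projMap h p) + logExp h p := by
  induction p using Projectivization.ind with
  | h v hv =>
    rw [projMap_mk, logExp_mk, logExp_mk, logExp_mk, ← Real.log_mul]
    · congr 1
      have := (norm_apply_pos h hv).ne'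
      have := (norm_pos_iff.2 hv).ne'
      rw [Units.val_mul, mul_apply_eq_comp]
      field_simp
    · exact (div_pos (norm_apply_pos _ (units_val_apply_ne_zero h hv)) (norm_apply_pos h hv)).ne'
    · exact (div_pos (norm_apply_pos _ hv) (norm_pos_iff.2 hv)).ne'

lemma logExp_one (p : Proj d) : logExp (1 : GLd d) p = 0 := by
  have := logExp_mul (1 : GLd d) 1 p
  rw [mul_one, projMap_one] at this
  linarith

lemma continuous_logExp_prod {X : Type*} [TopologicalSpace X] {M : X → GLd d}
    (hM : Continuous M) : Continuous fun p : X × Proj d => logExp (M p.1) p.2 := by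
  have hq := (IsOpenQuotientMap.id (X := X)).prodMap (isOpenQuotientMap_mk' (d := d))
  rw [hq.isQuotientMap.continuous_iff]
  have : ((fun p : X × Proj d => logExp (M p.1) p.2) ∘
      Prod.map id (Projectivization.mk' ℝ)) = fun p : X × {v : Vec d // v ≠ 0} =>
        Real.log (‖(M p.1).1 p.2.1‖ / ‖p.2.1‖) := by
    ext p; exact logExp_mk _ _ p.2.2
  rw [this]
  refine Continuous.log (Continuous.div ?_ ?_ ?_) ?_
  · exact ((Units.continuous_val.comp (hM.comp continuous_fst)).clm_apply
      (continuous_subtype_val.comp continuous_snd)).norm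
  · exact (continuous_subtype_val.comp continuous_snd).norm
  · exact fun p => (norm_pos_iff.2 p.2.2).ne'
  · exact fun p => (div_pos (norm_apply_pos _ p.2.2) (norm_pos_iff.2 p.2.2)).ne'

lemma logExp_le {K : ℝ} (g : GLd d) (hg : ‖g.1‖ ≤ K) (p : Proj d) : logExp g p ≤ Real.log K := by
  have hp := norm_pos_iff.2 p.rep_nonzero
  refine Real.log_le_log (div_pos (norm_apply_pos _ p.rep_nonzero) hp) ?_
  rw [div_le_iff₀ hp]
  exact (g.1.le_opNorm _).trans (by gcongr)

/-- The lower bound is the upper bound for the inverse, since the two expansions cancel. -/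
lemma abs_logExp_le {K : ℝ} (g : GLd d) (hg : ‖g.1‖ ≤ K) (hg' : ‖g⁻¹.1‖ ≤ K) (p : Proj d) :
    |logExp g p| ≤ Real.log K := by
  have h1 := logExp_mul g⁻¹ g p
  rw [inv_mul_cancel, logExp_one] at h1
  have := logExp_le g hg p
  have := logExp_le g⁻¹ hg' (projMap g p)
  rw [abs_le]
  constructor <;> linarith

variable {N : SFT A → GLd d}

/-- The logarithmic expansion of the cocycle, as a function on the projective bundle. -/
def logExpFibered (N : SFT A → GLd d) (q : SFT A × Proj d) : ℝ := logExp (N q.1) q.2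

lemma projFibered_iterate (n : ℕ) (q : SFT A × Proj d) :
    (projFibered N)^[n] q = ((shift A)^[n] q.1, projMap (iterNat N n q.1) q.2) := by
  induction n with
  | zero => simp [iterNat, projMap_one]
  | succ n ih =>
    rw [Function.iterate_succ_apply', ih, iterNat_succ_eq, projMap_mul,
      Function.iterate_succ_apply' (shift A)]
    rfl

lemma birkhoffSum_logExpFibered (n : ℕ) (q : SFT A × Proj d) :
    birkhoffSum (projFibered N) (logExpFibered N) n q = logExp (iterNat N n q.1) q.2 := by
  induction n with
  | zero => simp [iterNat, logExp_one]
  | succ n ih =>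
    rw [birkhoffSum_succ, ih, projFibered_iterate, iterNat_succ_eq, logExp_mul, add_comm]
    rfl

/-- The inverse of the fibered projective map. -/
def projFiberedInv (N : SFT A → GLd d) (q : SFT A × Proj d) : SFT A × Proj d :=
  ((shift A).symm q.1, projMap (N ((shift A).symm q.1))⁻¹ q.2)

lemma projFibered_projFiberedInv (N : SFT A → GLd d) :
    Function.LeftInverse (projFibered N) (projFiberedInv N) := fun q => by
  simp [projFibered, projFiberedInv, projMap_projMap_inv]

lemma projFiberedInv_projFibered (N : SFT A → GLd d) :
    Function.LeftInverse (projFiberedInv N) (projFibered N) := fun q => by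
  simp [projFibered, projFiberedInv, projMap_inv_projMap]

lemma projFiberedInv_iterate (n : ℕ) (q : SFT A × Proj d) :
    (projFiberedInv N)^[n] q = ((shift A).symm^[n] q.1,
      projMap (iterNat N n ((shift A).symm^[n] q.1))⁻¹ q.2) := by
  have h := (projFiberedInv_projFibered N).iterate n
    ((shift A).symm^[n] q.1, projMap (iterNat N n ((shift A).symm^[n] q.1))⁻¹ q.2)
  rw [projFibered_iterate] at h
  simp only [shift_iterate_symm_iterate, projMap_projMap_inv] at h
  exact h

/-- The expansion along the orbit segment that ends at `q` is undone by the inverse iterate; the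
sign matches the rate `-l` of `BwdGrowth`. -/
lemma birkhoffSum_logExpFibered_backward (n : ℕ) (q : SFT A × Proj d) :
    birkhoffSum (projFibered N) (logExpFibered N) n ((projFiberedInv N)^[n] q) =
      - logExp (iterNat N n ((shift A).symm^[n] q.1))⁻¹ q.2 := by
  rw [projFiberedInv_iterate, birkhoffSum_logExpFibered]
  simp only
  have h := logExp_mul (iterNat N n ((shift A).symm^[n] q.1))
    (iterNat N n ((shift A).symm^[n] q.1))⁻¹ q.2
  rw [mul_inv_cancel, logExp_one] at h
  linarith

lemma measurable_projFiberedInv (hN : Continuous N) : Measurable (projFiberedInv N) := by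
  refine (continuous_shift_symm.measurable.comp measurable_fst).prodMk ?_
  exact (measurable_projMap_prod (M := fun x => (N x)⁻¹) hN.inv).comp
    ((continuous_shift_symm.measurable.comp measurable_fst).prodMk measurable_snd)

lemma measurePreserving_projFiberedInv (hN : Continuous N) {ν : Measure (SFT A × Proj d)}
    (h : MeasurePreserving (projFibered N) ν ν) : MeasurePreserving (projFiberedInv N) ν ν := by
  refine ⟨measurable_projFiberedInv hN, ?_⟩
  conv_lhs => rw [← h.map_eq]
  rw [Measure.map_map (measurable_projFiberedInv hN) h.measurable,
    (projFiberedInv_projFibered N).comp_eq_id, Measure.map_id]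

lemma measurable_logExpFibered (hN : Continuous N) : Measurable (logExpFibered N) :=
  (continuous_logExp_prod hN).measurable

/-- The growth of the lines selected by an invariant measure along which the mean growth rate
converges. -/
theorem ae_growth_of_tendsto_integral (hN : Continuous N) {ν : Measure (SFT A × Proj d)}
    [IsProbabilityMeasure ν] (hν : MeasurePreserving (projFibered N) ν ν) {l : ℝ}
    (h : Tendsto (fun n : ℕ => ∫ q, |logExp (iterNat N n q.1) q.2 / n - l| ∂ν) atTop (𝓝 0)) :
    ∀ᵐ q ∂ν, FwdGrowth N l q.1 q.2.rep ∧ BwdGrowth N l q.1 q.2.rep := by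
  obtain ⟨K, hK1, hK⟩ := exists_bound_units hN
  have hb : ∀ q, |logExpFibered N q| ≤ Real.log K := fun q => abs_logExp_le _ (hK _).1 (hK _).2 _
  have hm := measurable_logExpFibered hN
  simp only [← birkhoffSum_logExpFibered] at h
  have h1 := ae_tendsto_birkhoffSum_div hν hm hb h
  have h2 := ae_tendsto_birkhoffSum_div_backward hν (measurePreserving_projFiberedInv hN hν)
    (projFibered_projFiberedInv N) hm hb h
  -- The representative of a line need not be a unit vector; its norm contributes a term which
  -- vanishes after division by `n`.
  have hlog : ∀ (g : GLd d) (p : Proj d) (n : ℕ), Real.log ‖g.1 p.rep‖ / n =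
      logExp g p / n + Real.log ‖p.rep‖ / n := fun g p n => by
    rw [logExp, Real.log_div (norm_apply_pos _ p.rep_nonzero).ne'
      (norm_ne_zero_iff.2 p.rep_nonzero)]
    ring
  filter_upwards [h1, h2] with q hq1 hq2
  simp only [birkhoffSum_logExpFibered] at hq1
  simp only [birkhoffSum_logExpFibered_backward] at hq2
  have hz := tendsto_const_div_atTop_nhds_zero_nat (Real.log ‖q.2.rep‖)
  constructor
  · unfold FwdGrowth
    simp only [hlog]
    simpa using hq1.add hz
  · unfold BwdGrowth
    simp only [hlog]
    simpa [neg_div] using hq2.neg.add hz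

end Projective

/-! ### The Oseledets line of the top exponent -/

section BackwardUniqueness

variable {m d : ℕ} {A : Fin m → Fin m → Prop} {μ : Measure (SFT A)} {N : SFT A → GLd d}

/-- Under a backward sequence of events whose complements become negligible, almost every point is
recurrent to the events. -/
lemma ae_frequently_of_tendsto_measure_zero {Y : Type*} [MeasurableSpace Y] {ρ : Measure Y}
    {E : ℕ → Set Y} (h : Tendsto (fun n => ρ (E n)) atTop (𝓝 0)) :
    ∀ᵐ x ∂ρ, ∃ᶠ n in atTop, x ∉ E n := by
  have h1 : ∀ k : ℕ, ∀ᵐ x ∂ρ, ∃ n ≥ k, x ∉ E n := by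
    intro k
    rw [ae_iff]
    refine le_antisymm (ge_of_tendsto h ?_) zero_le
    filter_upwards [eventually_ge_atTop k] with n hn
    refine measure_mono fun x hx => ?_
    by_contra hxn
    exact hx ⟨n, hn, hxn⟩
  filter_upwards [ae_all_iff.2 h1] with x hx
  exact frequently_atTop.2 hx

lemma tendsto_measure_zero_of_ae_eventually {Y : Type*} [MeasurableSpace Y] {ρ : Measure Y}
    [IsFiniteMeasure ρ] {E : ℕ → Set Y} (hE : ∀ n, MeasurableSet (E n))
    (h : ∀ᵐ x ∂ρ, ∀ᶠ n in atTop, x ∉ E n) : Tendsto (fun n => ρ (E n)) atTop (𝓝 0) := by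
  have := tendsto_measure_of_ae_tendsto_indicator_of_isFiniteMeasure (μ := ρ) (A := ∅) atTop
    MeasurableSet.empty hE (by
      filter_upwards [h] with x hx
      filter_upwards [hx] with n hn
      exact iff_of_false hn (Set.notMem_empty x))
  simpa using this

/-- Almost surely, the vectors with backward growth rate `l` are on a line, if the area growth rate
is less than `2 l`. -/
theorem ae_gram_eq_zero_of_bwdGrowth [IsProbabilityMeasure μ]
    (hT : MeasurePreserving (shift A) μ μ) (hN : IsLocallyConstant N) {l γ : ℝ} (hγ : γ < 2 * l)
    (harea : ∀ᵐ x ∂μ, ∀ᶠ n : ℕ in atTop, ∀ u v : Vec d,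
      gram ((iterNat N n x).1 u) ((iterNat N n x).1 v) ≤ Real.exp (2 * n * γ) * gram u v) :
    ∀ᵐ x ∂μ, ∀ u v : Vec d, u ≠ 0 → v ≠ 0 → BwdGrowth N l x u → BwdGrowth N l x v →
      gram u v = 0 := by
  set E : ℕ → Set (SFT A) := fun n => {x | ¬ ∀ u v : Vec d,
      gram ((iterNat N n x).1 u) ((iterNat N n x).1 v) ≤ Real.exp (2 * n * γ) * gram u v} with hE
  have hEm : ∀ n, MeasurableSet (E n) := fun n =>
    (isLocallyConstant_iterNat hN n {g | ¬ ∀ u v : Vec d,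
      gram (g.1 u) (g.1 v) ≤ Real.exp (2 * n * γ) * gram u v}).measurableSet
  have h1 := tendsto_measure_zero_of_ae_eventually hEm
    (by filter_upwards [harea] with x hx; filter_upwards [hx] with n hn; exact fun h => h hn)
  -- The area bound is needed from the base point `T^{-n} x`, which moves with `n`. Almost sure
  -- validity does not survive this move, but convergence in measure does, and it still leaves
  -- infinitely many good `n` for almost every `x`.
  have h2 : Tendsto (fun n => μ ((shift A).symm^[n] ⁻¹' E n)) atTop (𝓝 0) := by
    refine h1.congr fun n => ?_
    exact (((measurePreserving_shift_symm hT).iterate n).measure_preimage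
      (hEm n).nullMeasurableSet).symm
  filter_upwards [ae_frequently_of_tendsto_measure_zero h2] with x hx u v hu hv hbu hbv
  refine le_antisymm ?_ (gram_nonneg u v)
  -- With this value `2 * γ + 4 * (-l + ε) = -4 * ε`. The area rate `γ` is doubled because `gram` is
  -- a squared area.
  set ε := (2 * l - γ) / 4 with hε
  have hε0 : 0 < ε := by rw [hε]; linarith
  have hgrow : ∀ w : Vec d, w ≠ 0 → BwdGrowth N l x w → ∀ᶠ n : ℕ in atTop,
      ‖((iterNat N n ((shift A).symm^[n] x))⁻¹).1 w‖ ≤ Real.exp (n * (-l + ε)) := by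
    intro w hw hb
    filter_upwards [hb.eventually (gt_mem_nhds (show -l < -l + ε by linarith)),
      eventually_gt_atTop 0] with n hn hn0
    have hn0' : (0 : ℝ) < n := by exact_mod_cast hn0
    rw [div_lt_iff₀ hn0'] at hn
    rw [← Real.log_le_iff_le_exp (norm_apply_pos _ hw)]
    linarith
  have hlim : Tendsto (fun n : ℕ => Real.exp (n * (-(8 * ε - 4 * ε)))) atTop (𝓝 0) := by
    refine Real.tendsto_exp_atBot.comp ?_
    refine tendsto_natCast_atTop_atTop.atTop_mul_const_of_neg ?_
    linarith
  refine ge_of_tendsto_of_frequently hlim ?_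
  refine (hx.and_eventually ((hgrow u hu hbu).and (hgrow v hv hbv))).mono ?_
  rintro n ⟨hn, hnu, hnv⟩
  have hn' : ∀ u v : Vec d, gram ((iterNat N n ((shift A).symm^[n] x)).1 u)
      ((iterNat N n ((shift A).symm^[n] x)).1 v) ≤ Real.exp (2 * n * γ) * gram u v :=
    not_not.1 hn
  have h3 := hn' (((iterNat N n ((shift A).symm^[n] x))⁻¹).1 u)
    (((iterNat N n ((shift A).symm^[n] x))⁻¹).1 v)
  rw [units_apply_inv_apply, units_apply_inv_apply] at h3
  refine h3.trans ?_
  calc _ ≤ Real.exp (2 * n * γ) *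
        (Real.exp (n * (-l + ε)) ^ 2 * Real.exp (n * (-l + ε)) ^ 2) := by
        gcongr
        refine (gram_le _ _).trans ?_
        gcongr
    _ = _ := by
        rw [← Real.exp_nat_mul, ← Real.exp_add, ← Real.exp_add, hε]
        congr 1
        push_cast
        ring

end BackwardUniqueness

/-! ### Invariant measures as limits of empirical averages. -/

section KrylovBogolyubov

variable {X : Type*} [TopologicalSpace X]

lemma continuous_birkhoffSum {G : X → X} (hG : Continuous G) {f : X → ℝ} (hf : Continuous f)
    (n : ℕ) : Continuous (birkhoffSum G f n) :=
  continuous_finsetSum _ fun k _ => hf.comp (hG.iterate k)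

variable [CompactSpace X] [MeasurableSpace X] [BorelSpace X]

lemma integrable_of_continuous {ρ : Measure X} [IsFiniteMeasure ρ] {f : X → ℝ}
    (hf : Continuous f) : Integrable f ρ := by
  obtain ⟨K, hK⟩ := isCompact_univ.exists_bound_of_continuousOn hf.continuousOn
  exact integrable_of_abs_le hf.measurable fun x => hK x trivial

/-- The Krylov–Bogolyubov procedure: an invariant measure as a limit of the empirical averages of a
sequence of probability measures. -/
theorem exists_invariant_measure [TopologicalSpace.MetrizableSpace X] {G : X → X} (hG : Continuous G) (β : ℕ → Measure X)
    (hβ : ∀ n, IsProbabilityMeasure (β n)) :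
    ∃ ρ : Measure X, IsProbabilityMeasure ρ ∧ MeasurePreserving G ρ ρ ∧
      ∀ (f : X → ℝ) (c : ℝ), Continuous f →
        Tendsto (fun n : ℕ => (∫ x, birkhoffSum G f n x ∂(β n)) / n) atTop (𝓝 c) →
        ∫ x, f x ∂ρ = c := by
  -- The index is shifted by one so that no average is empty.
  set E : ℕ → Measure X := fun n =>
    ((n + 1 : ℕ) : ENNReal)⁻¹ • ∑ k ∈ Finset.range (n + 1), (β (n + 1)).map (G^[k]) with hE
  have hprob : ∀ n, IsProbabilityMeasure (E n) := by
    intro n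
    constructor
    have : ∀ k, (β (n + 1)).map (G^[k]) Set.univ = 1 := fun k => by
      rw [Measure.map_apply (hG.iterate k).measurable MeasurableSet.univ]; simp
    simp only [hE, Measure.smul_apply, Measure.finsetSum_apply, this, Finset.sum_const,
      Finset.card_range, smul_eq_mul, nsmul_eq_mul, mul_one]
    exact ENNReal.inv_mul_cancel (by simp) (by simp)
  have hint : ∀ n (f : X → ℝ), Continuous f →
      ∫ x, f x ∂(E n) = (∫ x, birkhoffSum G f (n + 1) x ∂(β (n + 1))) / ((n + 1 : ℕ) : ℝ) := by
    intro n f hf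
    have h1 : ∀ k, Integrable f ((β (n + 1)).map (G^[k])) := fun k =>
      have := Measure.isProbabilityMeasure_map (μ := β (n + 1)) (hG.iterate k).aemeasurable
      integrable_of_continuous hf
    have hc : ∀ k, Integrable (fun x => f (G^[k] x)) (β (n + 1)) := fun k =>
      integrable_of_continuous (hf.comp (hG.iterate k))
    simp only [hE]
    rw [integral_smul_measure, integral_finsetSum_measure fun k _ => h1 k]
    simp only [birkhoffSum]
    rw [integral_finsetSum _ fun k _ => hc k]
    simp only [integral_map (hG.iterate _).aemeasurable hf.aestronglyMeasurable]
    rw [ENNReal.toReal_inv, ENNReal.toReal_natCast, smul_eq_mul, div_eq_inv_mul]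
  set P : ℕ → ProbabilityMeasure X := fun n => ⟨E n, hprob n⟩
  -- A limit along a nonprincipal ultrafilter replaces a convergent subsequence; ordinary limits of
  -- integrals persist along it.
  obtain ⟨ρ, -, hρ⟩ := isCompact_univ.ultrafilter_le_nhds
    ((hyperfilter ℕ).map P) (by simp)
  have hlim : Tendsto P (hyperfilter ℕ) (𝓝 ρ) := hρ
  rw [ProbabilityMeasure.tendsto_iff_forall_integral_tendsto] at hlim
  have key : ∀ (f : X → ℝ) (c : ℝ), Continuous f →
        Tendsto (fun n : ℕ => (∫ x, birkhoffSum G f n x ∂(β n)) / n) atTop (𝓝 c) →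
        ∫ x, f x ∂(ρ : Measure X) = c := by
    intro f c hf h
    have h1 := hlim (BoundedContinuousFunction.mkOfCompact ⟨f, hf⟩)
    have h2 : Tendsto (fun n : ℕ => ∫ x, f x ∂(E n)) atTop (𝓝 c) := by
      simp only [hint _ f hf]
      exact h.comp (tendsto_add_atTop_nat 1)
    exact tendsto_nhds_unique h1 (h2.mono_left Nat.hyperfilter_le_atTop)
  refine ⟨ρ, inferInstance, ⟨hG.measurable, ?_⟩, key⟩
  have := Measure.isProbabilityMeasure_map (μ := (ρ : Measure X)) hG.aemeasurable
  refine ext_of_forall_integral_eq_of_IsFiniteMeasure fun f => ?_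
  have hc : Integrable (fun x => f (G x)) (ρ : Measure X) :=
    integrable_of_continuous (f.continuous.comp hG)
  rw [integral_map hG.aemeasurable f.continuous.aestronglyMeasurable, ← sub_eq_zero,
    ← integral_sub hc (integrable_of_continuous f.continuous)]
  -- Invariance: the Birkhoff sums of this coboundary telescope, so they stay bounded by `2 * ‖f‖`.
  refine key (fun x => f (G x) - f x) 0 ((f.continuous.comp hG).sub f.continuous) ?_
  refine squeeze_zero_norm (fun n => ?_) (tendsto_const_div_atTop_nhds_zero_nat (2 * ‖f‖))
  rw [norm_div, Real.norm_natCast]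
  refine div_le_div_of_nonneg_right ?_ (Nat.cast_nonneg n)
  have h3 : ∀ x, birkhoffSum G (fun x => f (G x) - f x) n x = f (G^[n] x) - f x := fun x => by
    have := Finset.sum_range_sub (fun k => f (G^[k] x)) n
    simp only [Function.iterate_succ_apply'] at this
    simpa [birkhoffSum] using this
  simp only [h3]
  have := norm_integral_le_of_norm_le_const (μ := β n) (f := fun x => f (G^[n] x) - f x)
    (C := 2 * ‖f‖) (ae_of_all _ fun x => by
      have h1 := f.norm_coe_le_norm (G^[n] x)
      have h2 := f.norm_coe_le_norm x
      exact (norm_sub_le _ _).trans (by linarith))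
  simpa using this

end KrylovBogolyubov

/-! ### An invariant measure on the sphere bundle with maximal growth. -/

section MaximalMeasure

variable {m d : ℕ} {A : Fin m → Fin m → Prop} {μ : Measure (SFT A)} {N : SFT A → GLd d}

/-- The unit sphere of `ℝ^d`. -/
abbrev USphere (d : ℕ) : Type := Metric.sphere (0 : Vec d) 1

lemma usphere_norm (v : USphere d) : ‖v.1‖ = 1 := mem_sphere_zero_iff_norm.1 v.2

lemma usphere_ne_zero (v : USphere d) : v.1 ≠ 0 :=
  norm_ne_zero_iff.1 (by rw [usphere_norm]; exact one_ne_zero)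

/-- The action of an invertible operator on the unit sphere. -/
def sphMap (g : GLd d) (v : USphere d) : USphere d :=
  ⟨‖g.1 v.1‖⁻¹ • g.1 v.1, by
    rw [mem_sphere_zero_iff_norm, norm_smul, norm_inv, norm_norm,
      inv_mul_cancel₀ (norm_apply_pos g (usphere_ne_zero v)).ne']⟩

/-- The line spanned by a unit vector. -/
def toProj (v : USphere d) : Proj d := Projectivization.mk ℝ v.1 (usphere_ne_zero v)

lemma continuous_toProj : Continuous (toProj (d := d)) :=
  isOpenQuotientMap_mk'.continuous.comp (Continuous.subtype_mk continuous_subtype_val _)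

lemma toProj_sphMap (g : GLd d) (v : USphere d) : toProj (sphMap g v) = projMap g (toProj v) := by
  have h0 : ‖g.1 v.1‖⁻¹ ≠ 0 := inv_ne_zero (norm_apply_pos g (usphere_ne_zero v)).ne'
  rw [toProj, toProj, projMap_mk, Projectivization.mk_eq_mk_iff]
  exact ⟨Units.mk0 _ h0, rfl⟩

lemma logExp_toProj (g : GLd d) (v : USphere d) : logExp g (toProj v) = Real.log ‖g.1 v.1‖ :=
  logExp_mk_unit _ _ _ (usphere_norm v)

/-- The fibered map on the sphere bundle. -/
def sphFibered (N : SFT A → GLd d) (q : SFT A × USphere d) : SFT A × USphere d :=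
  (shift A q.1, sphMap (N q.1) q.2)

/-- The projection from the sphere bundle to the projective bundle. -/
def sphToProj (q : SFT A × USphere d) : SFT A × Proj d := (q.1, toProj q.2)

lemma continuous_sphFibered (hN : Continuous N) : Continuous (sphFibered N) := by
  refine (continuous_shift.comp continuous_fst).prodMk (Continuous.subtype_mk ?_ _)
  have h : Continuous fun q : SFT A × USphere d => (N q.1).1 q.2.1 :=
    (Units.continuous_val.comp (hN.comp continuous_fst)).clm_apply
      (continuous_subtype_val.comp continuous_snd)
  exact (h.norm.inv₀ fun q => (norm_apply_pos _ (usphere_ne_zero q.2)).ne').smul h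

lemma continuous_sphToProj : Continuous (sphToProj (A := A) (d := d)) :=
  continuous_fst.prodMk (continuous_toProj.comp continuous_snd)

lemma measurable_sphToProj : Measurable (sphToProj (A := A) (d := d)) :=
  measurable_fst.prodMk (continuous_toProj.measurable.comp measurable_snd)

lemma sphToProj_semiconj (N : SFT A → GLd d) :
    Function.Semiconj sphToProj (sphFibered N) (projFibered N) := fun q => by
  simp [sphToProj, sphFibered, projFibered, toProj_sphMap]

lemma birkhoffSum_sph (n : ℕ) (q : SFT A × USphere d) :
    birkhoffSum (sphFibered N) (logExpFibered N ∘ sphToProj) n q =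
      Real.log ‖(iterNat N n q.1).1 q.2.1‖ := by
  have h := birkhoffSum_logExpFibered (N := N) n (sphToProj q)
  have h2 : logExp (iterNat N n (sphToProj q).1) (sphToProj q).2 =
    Real.log ‖(iterNat N n q.1).1 q.2.1‖ := logExp_toProj _ _
  rw [← h2, ← h]
  refine Finset.sum_congr rfl fun k _ => ?_
  rw [Function.comp_apply, (sphToProj_semiconj N).iterate_right k q]

/-- A unit vector of maximal expansion. -/
lemma exists_norm_apply_eq [NeZero d] (g : GLd d) : ∃ r : USphere d, ‖g.1 r.1‖ = ‖g.1‖ := by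
  obtain ⟨r, hr, h⟩ := exists_top_singular_vector g.1
  refine ⟨⟨r, mem_sphere_zero_iff_norm.2 hr⟩, le_antisymm ?_ ?_⟩
  · simpa [hr] using g.1.le_opNorm r
  · have := h r
    rw [real_inner_self_eq_norm_sq, hr, singularValues_zero_eq_norm] at this
    simpa using this

lemma abs_birkhoffSum_div_le {Y : Type*} {R : Y → Y} {g : Y → ℝ} {K : ℝ} (hg : ∀ y, |g y| ≤ K)
    (n : ℕ) (y : Y) : |birkhoffSum R g n y / n| ≤ K := by
  have hK : 0 ≤ K := (abs_nonneg _).trans (hg y)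
  rcases Nat.eq_zero_or_pos n with h | h
  · simpa [h] using hK
  · have : (0 : ℝ) < n := by exact_mod_cast h
    rw [abs_div, Nat.abs_cast, div_le_iff₀ this]
    linarith [abs_birkhoffSum_le (R := R) g hg n y]

/-- For a bounded sequence with constant mean `c`, an asymptotic upper bound by `c` implies
convergence in mean. -/
lemma tendsto_integral_abs_sub_of_le {Y : Type*} [MeasurableSpace Y] {ρ : Measure Y}
    [IsProbabilityMeasure ρ] {h u : ℕ → Y → ℝ} (hm : ∀ n, Measurable (h n)) {K : ℝ}
    (hK : ∀ n y, |h n y| ≤ K) {c : ℝ} (hc : ∀ᶠ n in atTop, ∫ y, h n y ∂ρ = c)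
    (hu : ∀ n y, h n y ≤ u n y) (hlim : ∀ᵐ y ∂ρ, Tendsto (fun n => u n y) atTop (𝓝 c)) :
    Tendsto (fun n => ∫ y, |h n y - c| ∂ρ) atTop (𝓝 0) := by
  have h1 : Tendsto (fun n => ∫ y, max (h n y - c) 0 ∂ρ) atTop (𝓝 (∫ y, (0 : ℝ) ∂ρ)) := by
    refine tendsto_integral_of_dominated_convergence (fun _ => K + |c|)
      (fun n => (((hm n).sub_const c).max measurable_const).aestronglyMeasurable)
      (integrable_const _) (fun n => ae_of_all _ fun y => ?_) ?_
    · rw [Real.norm_eq_abs, abs_of_nonneg (le_max_right _ _)]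
      have := (le_abs_self (h n y - c)).trans (abs_sub _ _)
      exact max_le (by linarith [hK n y]) ((abs_nonneg _).trans
        ((abs_sub (h n y) c).trans (by linarith [hK n y])))
    · filter_upwards [hlim] with y hy
      have h2 : Tendsto (fun n => max (u n y - c) 0) atTop (𝓝 0) := by
        simpa using (hy.sub_const c).max (tendsto_const_nhds (x := (0 : ℝ)))
      exact squeeze_zero (fun n => le_max_right _ _)
        (fun n => max_le_max (sub_le_sub_right (hu n y) c) le_rfl) h2
  rw [integral_zero] at h1
  have h2 := h1.const_mul 2
  rw [mul_zero] at h2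
  refine h2.congr' ?_
  filter_upwards [hc] with n hn
  have hi : Integrable (fun y => h n y - c) ρ := (integrable_of_abs_le (hm n) (hK n)).sub
    (integrable_const c)
  have e : ∀ y, |h n y - c| = 2 * max (h n y - c) 0 - (h n y - c) := fun y => by
    rcases le_total 0 (h n y - c) with h0 | h0
    · rw [abs_of_nonneg h0, max_eq_left h0]; ring
    · rw [abs_of_nonpos h0, max_eq_right h0]; ring
  simp only [e]
  rw [integral_sub ((hi.pos_part).const_mul 2) hi, integral_const_mul,
    integral_sub (integrable_of_abs_le (hm n) (hK n)) (integrable_const c), hn]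
  simp

/-- The sphere bundle is compact and metrizable, so the Krylov–Bogolyubov procedure applies to the
graphs of the most expanded directions of `N^n`. Their average expansion per step is the mean of
`log ‖N^n‖ / n`, so the limit has mean expansion `l`. No direction beats the norm, whose rate is
`l`, and a mean equal to an upper bound leaves no room for deviations below. This yields convergence
in mean without ergodicity of the limit measure. -/
theorem exists_maximal_measure [NeZero d] [IsProbabilityMeasure μ]
    (hT : MeasurePreserving (shift A) μ μ) (hN : IsLocallyConstant N) {l : ℝ}
    (hnorm : ∀ᵐ x ∂μ, Tendsto (fun n : ℕ => Real.log ‖(iterNat N n x).1‖ / n) atTop (𝓝 l)) :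
    ∃ ρ : Measure (SFT A × USphere d), IsProbabilityMeasure ρ ∧ ρ.fst = μ ∧
      ∀ᵐ q ∂ρ, FwdGrowth N l q.1 q.2.1 ∧ BwdGrowth N l q.1 q.2.1 := by
  choose r hr using exists_norm_apply_eq (d := d)
  have hNc := hN.continuous
  obtain ⟨K, hK1, hK⟩ := exists_bound_units hNc
  have hrm : ∀ n, Continuous fun x : SFT A => r (iterNat N n x) := fun n =>
    ((isLocallyConstant_iterNat hN n).comp r).continuous
  have hβc : ∀ n, Continuous fun x : SFT A => (x, r (iterNat N n x)) := fun n =>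
    continuous_id.prodMk (hrm n)
  obtain ⟨ρ, hρ, hinv, hlim⟩ := exists_invariant_measure (continuous_sphFibered hNc)
    (fun n => μ.map fun x => (x, r (iterNat N n x)))
    (fun n => Measure.isProbabilityMeasure_map (hβc n).aemeasurable)
  have hψc : Continuous (logExpFibered N ∘ sphToProj) :=
    (continuous_logExp_prod hNc).comp continuous_sphToProj
  have hb : ∀ q, |logExpFibered N q| ≤ Real.log K := fun q => abs_logExp_le _ (hK _).1 (hK _).2 _
  have hψ : ∫ q, (logExpFibered N ∘ sphToProj) q ∂ρ = l := by
    refine hlim _ _ hψc ?_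
    have e : ∀ n : ℕ, (∫ q, birkhoffSum (sphFibered N) (logExpFibered N ∘ sphToProj) n q
        ∂(μ.map fun x => (x, r (iterNat N n x)))) / n =
        ∫ x, Real.log ‖(iterNat N n x).1‖ / n ∂μ := fun n => by
      rw [integral_map (hβc n).aemeasurable
        (continuous_birkhoffSum (continuous_sphFibered hNc) hψc n).aestronglyMeasurable,
        integral_div]
      simp only [birkhoffSum_sph, hr]
    simp only [e]
    have h1 := tendsto_integral_of_dominated_convergence (μ := μ)
      (F := fun (n : ℕ) x => Real.log ‖(iterNat N n x).1‖ / n) (f := fun _ => l)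
      (fun _ => Real.log K)
      (fun n => (((isLocallyConstant_iterNat hN n).comp
        fun g => Real.log ‖g.1‖ / n).continuous).aestronglyMeasurable)
      (integrable_const _) (fun n => ae_of_all _ fun x => by
        rw [← hr, ← birkhoffSum_sph (N := N) n (x, r (iterNat N n x))]
        exact abs_birkhoffSum_div_le (fun q => hb _) n _) hnorm
    simpa using h1
  -- Every empirical average projects to an average of images of `μ` under the shift, that is, to
  -- `μ`.
  have hfst : ρ.fst = μ := by
    refine ext_of_forall_integral_eq_of_IsFiniteMeasure fun f => ?_
    rw [Measure.fst, integral_map measurable_fst.aemeasurable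
      f.continuous.aestronglyMeasurable]
    refine hlim (fun q => f q.1) _ (f.continuous.comp continuous_fst) ?_
    refine (tendsto_const_nhds).congr' ?_
    filter_upwards [eventually_gt_atTop 0] with n hn
    have hn' : (n : ℝ) ≠ 0 := by exact_mod_cast hn.ne'
    have hfc : Continuous fun q : SFT A × USphere d => f q.1 := f.continuous.comp continuous_fst
    rw [eq_div_iff hn', integral_map (hβc n).aemeasurable
      (continuous_birkhoffSum (continuous_sphFibered hNc) hfc n).aestronglyMeasurable]
    have e : ∀ x, birkhoffSum (sphFibered N) (fun q => f q.1) n (x, r (iterNat N n x)) =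
        ∑ k ∈ Finset.range n, f ((shift A)^[k] x) := fun x => by
      refine Finset.sum_congr rfl fun k _ => congrArg f ?_
      have : Function.Semiconj Prod.fst (sphFibered N) (shift A) := fun q => rfl
      exact this.iterate_right k _
    simp only [e]
    have hi : ∀ k, Integrable (fun x => f ((shift A)^[k] x)) μ := fun k =>
      integrable_of_continuous (f.continuous.comp (continuous_shift.iterate k))
    rw [integral_finsetSum _ fun k _ => hi k]
    have e2 : ∀ k, ∫ x, f ((shift A)^[k] x) ∂μ = ∫ x, f x ∂μ := fun k => by
      have h1 := integral_map (μ := μ) (hT.iterate k).measurable.aemeasurable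
        (f := fun x => f x) f.continuous.aestronglyMeasurable
      rw [(hT.iterate k).map_eq] at h1
      exact h1.symm
    simp only [e2]
    simp [mul_comm]
  refine ⟨ρ, hρ, hfst, ?_⟩
  set ν := ρ.map sphToProj with hν
  have hνp : IsProbabilityMeasure ν := Measure.isProbabilityMeasure_map
    measurable_sphToProj.aemeasurable
  have hνinv : MeasurePreserving (projFibered N) ν ν := by
    refine ⟨measurable_projFibered hNc, ?_⟩
    rw [hν, Measure.map_map (measurable_projFibered hNc) measurable_sphToProj,
      ← (sphToProj_semiconj N).comp_eq, ← Measure.map_map measurable_sphToProj hinv.measurable,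
      hinv.map_eq]
  have hνfst : ν.map Prod.fst = μ := by
    rw [hν, Measure.map_map measurable_fst measurable_sphToProj, ← hfst]
    rfl
  have hνψ : ∫ q, logExpFibered N q ∂ν = l := by
    rw [hν, integral_map measurable_sphToProj.aemeasurable
      (measurable_logExpFibered hNc).aestronglyMeasurable]
    exact hψ
  have hmS : ∀ n : ℕ, Measurable fun q : SFT A × Proj d => logExp (iterNat N n q.1) q.2 / n :=
    fun n => ((continuous_logExp_prod
      (isLocallyConstant_iterNat hN n).continuous).measurable).div_const _
  have hL1 : Tendsto (fun n : ℕ => ∫ q, |logExp (iterNat N n q.1) q.2 / n - l| ∂ν) atTop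
      (𝓝 0) := by
    -- By invariance the expansion over `n` steps has mean `n * l`, and `log ‖N^n‖` dominates it
    -- pointwise.
    refine tendsto_integral_abs_sub_of_le hmS (K := Real.log K)
      (u := fun n q => Real.log ‖(iterNat N n q.1).1‖ / n) (fun n q => ?_) ?_ (fun n q => ?_) ?_
    · rw [← birkhoffSum_logExpFibered]
      exact abs_birkhoffSum_div_le hb n q
    · filter_upwards [eventually_gt_atTop 0] with n hn
      have hn' : (n : ℝ) ≠ 0 := by exact_mod_cast hn.ne'
      rw [integral_div, div_eq_iff hn']
      simp only [← birkhoffSum_logExpFibered]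
      simp only [birkhoffSum]
      have hi : ∀ k, Integrable (fun q => logExpFibered N ((projFibered N)^[k] q)) ν := fun k =>
        integrable_of_abs_le ((measurable_logExpFibered hNc).comp (hνinv.iterate k).measurable)
          fun q => hb _
      rw [integral_finsetSum _ fun k _ => hi k]
      have e2 : ∀ k, ∫ q, logExpFibered N ((projFibered N)^[k] q) ∂ν = l := fun k => by
        have h1 := integral_map (μ := ν) (hνinv.iterate k).measurable.aemeasurable
          (f := logExpFibered N) (measurable_logExpFibered hNc).aestronglyMeasurable
        rw [(hνinv.iterate k).map_eq, hνψ] at h1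
        exact h1.symm
      simp only [e2]
      simp [mul_comm]
    · exact div_le_div_of_nonneg_right (logExp_le _ le_rfl _) (Nat.cast_nonneg n)
    · have h1 : ∀ᵐ x ∂(ν.map Prod.fst),
          Tendsto (fun n : ℕ => Real.log ‖(iterNat N n x).1‖ / n) atTop (𝓝 l) := by
        rw [hνfst]; exact hnorm
      exact ae_of_ae_map measurable_fst.aemeasurable h1
  have h := ae_growth_of_tendsto_integral hNc hνinv hL1
  have h2 := ae_of_ae_map measurable_sphToProj.aemeasurable h
  filter_upwards [h2] with q hq
  have hq' : FwdGrowth N l q.1 (toProj q.2).rep ∧ BwdGrowth N l q.1 (toProj q.2).rep := hq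
  obtain ⟨c, hc⟩ := Projectivization.exists_smul_eq_mk_rep ℝ q.2.1 (usphere_ne_zero q.2)
  have hq2 : q.2.1 = ((c⁻¹ : ℝˣ) : ℝ) • (toProj q.2).rep := by
    rw [toProj, ← hc, ← Units.smul_def, inv_smul_smul]
  rw [hq2]
  exact ⟨hq'.1.smul (Units.ne_zero _) (Projectivization.rep_nonzero _),
    hq'.2.smul (Units.ne_zero _) (Projectivization.rep_nonzero _)⟩

end MaximalMeasure

/-! ### Measurable choice of the Oseledets line. -/

section OseledetsLine

variable {m d : ℕ} {A : Fin m → Fin m → Prop} {μ : Measure (SFT A)} {N : SFT A → GLd d}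

/-- A measurable selection of a nonzero value among finitely many functions. -/
lemma exists_measurable_ne_zero [NeZero d] {X ι : Type*} [MeasurableSpace X] (s : Finset ι)
    (c : ι → X → Vec d) (hc : ∀ i, Measurable (c i)) :
    ∃ v : X → Vec d, Measurable v ∧ (∀ x, v x ≠ 0) ∧
      ∀ x, (∃ i ∈ s, c i x ≠ 0) → ∃ i ∈ s, v x = c i x := by
  classical
  induction s using Finset.induction_on with
  | empty =>
    obtain ⟨e, he⟩ := exists_ne (0 : Vec d)
    exact ⟨fun _ => e, measurable_const, fun _ => he, fun x ⟨i, hi, _⟩ => absurd hi (by simp)⟩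
  | insert i s _ ih =>
    obtain ⟨v, hv, hv0, hvs⟩ := ih
    refine ⟨fun x => if c i x = 0 then v x else c i x,
      Measurable.ite ((hc i) (measurableSet_singleton 0)) hv (hc i), fun x => ?_, fun x hx => ?_⟩
    · by_cases h : c i x = 0
      · simpa [h] using hv0 x
      · simp [h]
    · by_cases h : c i x = 0
      · obtain ⟨j, hj, hjx⟩ := hx
        have hjs : j ∈ s := by
          rcases Finset.mem_insert.1 hj with h' | h'
          · rw [h'] at hjx; exact absurd h hjx
          · exact h'
        obtain ⟨k, hk, hkx⟩ := hvs x ⟨j, hjs, hjx⟩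
        exact ⟨k, Finset.mem_insert_of_mem hk, by simp [h, hkx]⟩
      · exact ⟨i, Finset.mem_insert_self _ _, by simp [h]⟩

/-- A measurable choice of a vector with growth rate `l` in the future and in the past. -/
theorem exists_measurable_growth [NeZero d] [IsProbabilityMeasure μ]
    (hT : MeasurePreserving (shift A) μ μ) (hN : IsLocallyConstant N) {l : ℝ}
    (hnorm : ∀ᵐ x ∂μ, Tendsto (fun n : ℕ => Real.log ‖(iterNat N n x).1‖ / n) atTop (𝓝 l))
    (huniq : ∀ᵐ x ∂μ, ∀ u v : Vec d, u ≠ 0 → v ≠ 0 → BwdGrowth N l x u → BwdGrowth N l x v →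
      gram u v = 0) :
    ∃ v₁ : SFT A → Vec d, Measurable v₁ ∧ (∀ x, v₁ x ≠ 0) ∧
      ∀ᵐ x ∂μ, FwdGrowth N l x (v₁ x) ∧ BwdGrowth N l x (v₁ x) := by
  obtain ⟨ρ, hρ, hfst, hgrow⟩ := exists_maximal_measure hT hN hnorm
  have : Nonempty (USphere d) := by
    obtain ⟨r, -⟩ := exists_norm_apply_eq (1 : GLd d)
    exact ⟨r⟩
  rw [← ρ.disintegrate ρ.condKernel, hfst] at hgrow
  have hae := Measure.ae_ae_of_ae_compProd hgrow
  set κ := ρ.condKernel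
  -- The integrand `v_i v` is even, so opposite unit vectors do not cancel. By uniqueness of the
  -- line, `κ x` is carried by `{u, -u}`, and the integral is `u_i u`, which is nonzero for some
  -- `i`.
  have hcm : ∀ i : Fin d, Measurable fun x => ∫ v : USphere d, v.1 i • v.1 ∂(κ x) := fun i => by
    have : StronglyMeasurable fun v : USphere d => v.1 i • v.1 := by
      refine Continuous.stronglyMeasurable ?_
      fun_prop
    exact (this.integral_kernel (κ := κ)).measurable
  obtain ⟨v₁, hv₁, hv0, hsel⟩ := exists_measurable_ne_zero (Finset.univ : Finset (Fin d)) _ hcm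
  refine ⟨v₁, hv₁, hv0, ?_⟩
  filter_upwards [hae, huniq] with x hx hux
  obtain ⟨u, hu⟩ := hx.exists
  have hu0 := usphere_ne_zero u
  have hall : ∀ᵐ v ∂(κ x), ∀ i, v.1 i • v.1 = u.1 i • u.1 := by
    filter_upwards [hx] with v hv i
    obtain ⟨c, hc⟩ := Submodule.mem_span_singleton.1
      (mem_span_of_gram_eq_zero hu0 (hux u.1 v.1 hu0 (usphere_ne_zero v) hu.2 hv.2))
    have hc1 : |c| = 1 := by
      have := congrArg norm hc
      rwa [norm_smul, usphere_norm, usphere_norm, mul_one, Real.norm_eq_abs] at this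
    have hc2 : c * c = 1 := by rw [← abs_mul_abs_self, hc1, one_mul]
    rw [← hc, PiLp.smul_apply, smul_smul, smul_eq_mul]
    congr 1
    linear_combination (u.1 i) * hc2
  have hint : ∀ i, ∫ v : USphere d, v.1 i • v.1 ∂(κ x) = u.1 i • u.1 := fun i => by
    rw [integral_congr_ae (g := fun _ => u.1 i • u.1) (by filter_upwards [hall] with v hv using hv i)]
    simp
  obtain ⟨i, hi⟩ : ∃ i, u.1 i ≠ 0 := by
    by_contra! h
    exact hu0 (PiLp.ext h)
  obtain ⟨j, -, hj⟩ := hsel x ⟨i, Finset.mem_univ _, by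
    rw [hint]; exact smul_ne_zero hi hu0⟩
  have hj2 : v₁ x = u.1 j • u.1 := by rw [hj, hint]
  have hj0 : u.1 j ≠ 0 := fun h => hv0 x (by rw [hj2, h, zero_smul])
  rw [hj2]
  exact ⟨hu.1.smul hj0 hu0, hu.2.smul hj0 hu0⟩

end OseledetsLine

/-! ### The product structure of Gibbs measures -/

section Cylinders

variable {m : ℕ} {A : Fin m → Fin m → Prop}

/-- The symmetric cylinder `[x_{-n}, …, x_n]`. -/
def symCylinder (x : SFT A) (n : ℕ) : Set (SFT A) :=
  {y | ∀ i : ℤ, -n ≤ i → i ≤ n → y.1 i = x.1 i}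

/-- The cylinder `[x_{-n}, …, x_0]`. -/
def pastCylinder (x : SFT A) (n : ℕ) : Set (SFT A) :=
  {y | ∀ i : ℤ, -n ≤ i → i ≤ 0 → y.1 i = x.1 i}

/-- The cylinder of the points with a given symbol in position `0`. -/
def symbolSet (A : Fin m → Fin m → Prop) (a : Fin m) : Set (SFT A) := {x | x.1 0 = a}

lemma measurableSet_coord (i : ℤ) (a : Fin m) : MeasurableSet {x : SFT A | x.1 i = a} :=
  (continuous_coord i).measurable (measurableSet_singleton a)

lemma measurableSet_symbolSet (a : Fin m) : MeasurableSet (symbolSet A a) :=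
  measurableSet_coord 0 a

lemma measurableSet_cylinder (x : SFT A) (n : ℕ) : MeasurableSet (cylinder x n) := by
  have : cylinder x n = ⋂ i : ℤ, ⋂ _ : 0 ≤ i, ⋂ _ : i < n, {y | y.1 i = x.1 i} := by
    ext y; simp [cylinder]
  rw [this]
  exact MeasurableSet.iInter fun i => MeasurableSet.iInter fun _ => MeasurableSet.iInter fun _ =>
    measurableSet_coord i _

lemma measurableSet_symCylinder (x : SFT A) (n : ℕ) : MeasurableSet (symCylinder x n) := by
  have : symCylinder x n = ⋂ i : ℤ, ⋂ _ : -(n : ℤ) ≤ i, ⋂ _ : i ≤ n, {y | y.1 i = x.1 i} := by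
    ext y; simp [symCylinder]
  rw [this]
  exact MeasurableSet.iInter fun i => MeasurableSet.iInter fun _ => MeasurableSet.iInter fun _ =>
    measurableSet_coord i _

lemma cylinder_subset_symbolSet (x : SFT A) (n : ℕ) : cylinder x (n + 1) ⊆ symbolSet A (x.1 0) :=
  fun _ hy => hy 0 le_rfl (by positivity)

/-- Shift invariance thus reduces two-sided cylinders to the one-sided cylinders of the Gibbs
bounds. -/
lemma symCylinder_eq_preimage (x : SFT A) (n : ℕ) :
    symCylinder x n = (shift A).symm^[n] ⁻¹' cylinder ((shift A).symm^[n] x) (n + (n + 1)) := by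
  ext y
  simp only [Set.mem_preimage]
  constructor
  · intro h i h0 h1
    rw [shift_symm_iterate_apply, shift_symm_iterate_apply]
    exact h _ (by omega) (by push_cast at h1; omega)
  · intro h i h0 h1
    have := h (i + n) (by omega) (by push_cast; omega)
    rw [shift_symm_iterate_apply, shift_symm_iterate_apply] at this
    simpa using this

lemma pastCylinder_eq_preimage (x : SFT A) (n : ℕ) :
    pastCylinder x n = (shift A).symm^[n] ⁻¹' cylinder ((shift A).symm^[n] x) (n + 1) := by
  ext y
  simp only [Set.mem_preimage]
  constructor
  · intro h i h0 h1
    rw [shift_symm_iterate_apply, shift_symm_iterate_apply]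
    exact h _ (by omega) (by push_cast at h1; omega)
  · intro h i h0 h1
    have := h (i + n) (by omega) (by push_cast; omega)
    rw [shift_symm_iterate_apply, shift_symm_iterate_apply] at this
    simpa using this

lemma exists_symCylinder_subset {U : Set (SFT A)} (hU : IsOpen U) {x : SFT A} (hx : x ∈ U) :
    ∃ n, symCylinder x n ⊆ U := by
  obtain ⟨V, hV, rfl⟩ := isOpen_induced_iff.1 hU
  obtain ⟨I, u, hu, hIu⟩ := isOpen_pi_iff.1 hV x.1 hx
  refine ⟨∑ i ∈ I, i.natAbs, fun y hy => hIu fun i hi => ?_⟩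
  have h1 : i.natAbs ≤ ∑ i ∈ I, i.natAbs :=
    Finset.single_le_sum (f := fun i : ℤ => i.natAbs) (fun _ _ => Nat.zero_le _) hi
  rw [hy i (by omega) (by omega)]
  exact (hu i hi).2

/-- Comparison of two measures through their values on symmetric cylinders. -/
theorem measure_le_of_symCylinder_le {μ₁ μ₂ : Measure (SFT A)} [IsFiniteMeasure μ₁]
    [IsFiniteMeasure μ₂] {D : ENNReal} (hD : D ≠ ⊤)
    (h : ∀ x n, μ₁ (symCylinder x n) ≤ D * μ₂ (symCylinder x n)) : μ₁ ≤ D • μ₂ := by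
  have hopen : ∀ U : Set (SFT A), IsOpen U → μ₁ U ≤ (D • μ₂) U := by
    intro U hU
    -- The open set is exhausted by the unions of the symmetric cylinders of rank `n` that it
    -- contains. The alphabet is finite, so each union involves finitely many disjoint cylinders.
    set W : ℕ → Set (SFT A) := fun n => {x | symCylinder x n ⊆ U}
    have hmono : Monotone W := fun n k hnk x hx y hy =>
      hx fun i h1 h2 => hy i (by omega) (by omega)
    have hUW : U = ⋃ n, W n := by
      ext x
      refine ⟨fun hx => Set.mem_iUnion.2 (exists_symCylinder_subset hU hx), fun hx => ?_⟩
      obtain ⟨n, hn⟩ := Set.mem_iUnion.1 hx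
      exact hn fun i _ _ => rfl
    have hW : ∀ n, μ₁ (W n) ≤ (D • μ₂) (W n) := by
      classical
      intro n
      set r : SFT A → (Set.Icc (-(n : ℤ)) n → Fin m) := fun x i => x.1 i
      have hfib : ∀ x, r ⁻¹' {r x} = symCylinder x n := by
        intro x
        ext y
        simp only [Set.mem_preimage, Set.mem_singleton_iff, funext_iff, r]
        exact ⟨fun hy i h1 h2 => hy ⟨i, h1, h2⟩, fun hy i => hy i i.2.1 i.2.2⟩
      have hmeas : ∀ s, MeasurableSet (r ⁻¹' {s}) := by
        intro s
        by_cases hs : ∃ x, r x = s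
        · obtain ⟨x, rfl⟩ := hs
          rw [hfib]; exact measurableSet_symCylinder x n
        · have : r ⁻¹' {s} = ∅ := by
            ext y; exact iff_of_false (fun hy => hs ⟨y, hy⟩) (Set.notMem_empty y)
          rw [this]; exact MeasurableSet.empty
      set S : Finset (Set.Icc (-(n : ℤ)) n → Fin m) := Finset.univ.filter fun s => s ∈ r '' W n
      have hWS : W n = r ⁻¹' (S : Set _) := by
        ext x
        simp only [Set.mem_preimage, S, Finset.coe_filter, Finset.mem_univ, true_and]
        refine ⟨fun hx => ⟨x, hx, rfl⟩, ?_⟩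
        rintro ⟨y, hy, hyx⟩
        have h1 : symCylinder x n = symCylinder y n := by rw [← hfib, ← hfib, hyx]
        show symCylinder x n ⊆ U
        rw [h1]; exact hy
      rw [hWS, ← sum_measure_preimage_singleton S (fun s _ => hmeas s),
        ← sum_measure_preimage_singleton S (fun s _ => hmeas s)]
      refine Finset.sum_le_sum fun s hs => ?_
      obtain ⟨x, -, rfl⟩ := (Finset.mem_filter.1 hs).2
      rw [hfib]
      exact h x n
    rw [hUW, hmono.measure_iUnion, hmono.measure_iUnion]
    exact iSup_mono hW
  have : IsFiniteMeasure (D • μ₂) := μ₂.smul_finite hD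
  refine Measure.le_iff.2 fun E _ => ?_
  -- Outer regularity of the larger measure is enough to pass from open sets to all measurable sets.
  rw [E.measure_eq_iInf_isOpen (D • μ₂)]
  refine le_iInf fun U => le_iInf fun hEU => le_iInf fun hU => ?_
  exact (measure_mono hEU).trans (hopen U hU)

/-- The point with the past of `y` and the future of `x` (if `x_0 = y_0`; otherwise it is `y`). -/
def bracket (p : SFT A × SFT A) : SFT A :=
  ⟨fun i => if p.1.1 0 = p.2.1 0 then (if i ≤ 0 then p.1.1 i else p.2.1 i) else p.1.1 i, fun i => by
    by_cases h : p.1.1 0 = p.2.1 0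
    · simp only [h, if_true]
      rcases lt_trichotomy i 0 with hi | hi | hi
      · rw [if_pos hi.le, if_pos (by omega)]; exact p.1.2 i
      · subst hi
        rw [if_pos le_rfl, if_neg (by omega), h]; exact p.2.2 0
      · rw [if_neg (by omega), if_neg (by omega)]; exact p.2.2 i
    · simp only [h, if_false]; exact p.1.2 i⟩

lemma bracket_apply_of_nonpos (p : SFT A × SFT A) {i : ℤ} (hi : i ≤ 0) :
    (bracket p).1 i = p.1.1 i := by
  simp [bracket, hi]

lemma bracket_apply_of_nonneg {p : SFT A × SFT A} (h : p.1.1 0 = p.2.1 0) {i : ℤ} (hi : 0 ≤ i) :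
    (bracket p).1 i = p.2.1 i := by
  rcases hi.lt_or_eq with hi' | rfl
  · simp [bracket, h, not_le.2 hi']
  · simp [bracket, h]

lemma measurable_bracket : Measurable (bracket (A := A)) := by
  refine Measurable.subtype_mk (measurable_pi_lambda _ fun i => ?_)
  have h1 : ∀ j : ℤ, Measurable fun p : SFT A × SFT A => p.1.1 j := fun j =>
    (continuous_coord j).measurable.comp measurable_fst
  have h2 : ∀ j : ℤ, Measurable fun p : SFT A × SFT A => p.2.1 j := fun j =>
    (continuous_coord j).measurable.comp measurable_snd
  refine Measurable.ite (measurableSet_eq_fun (h1 0) (h2 0)) ?_ (h1 i)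
  by_cases hi : i ≤ 0
  · simpa only [if_pos hi] using h1 i
  · simpa only [if_neg hi] using h2 i

end Cylinders

/-! ### Quasi-independence of the past and the future. -/

section Gibbs

variable {m : ℕ} {A : Fin m → Fin m → Prop} {μ : Measure (SFT A)}

/-- The case `n = 0` of the Hölder condition bounds the oscillation over points with the same symbol
`x_0`, and there are finitely many symbols. -/
lemma IsHolder.exists_bound {φ : SFT A → ℝ} (hφ : IsHolder φ) : ∃ K, ∀ x, |φ x| ≤ K := by
  obtain ⟨C, θ, -, -, h⟩ := hφ
  have h1 : ∀ a : Fin m, ∃ K, ∀ x : SFT A, x.1 0 = a → |φ x| ≤ K := by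
    intro a
    by_cases ha : ∃ x : SFT A, x.1 0 = a
    · obtain ⟨x, hx⟩ := ha
      refine ⟨|φ x| + C, fun y hy => ?_⟩
      have h2 := h 0 y x (fun i hi => by
        have : i = 0 := by simpa using hi
        rw [this, hx, hy])
      rw [pow_zero, mul_one] at h2
      have := abs_sub_abs_le_abs_sub (φ y) (φ x)
      linarith
    · exact ⟨0, fun x hx => absurd ⟨x, hx⟩ ha⟩
  choose K hK using h1
  refine ⟨∑ a, |K a|, fun x => (hK _ x rfl).trans ((le_abs_self _).trans ?_)⟩
  exact Finset.single_le_sum (f := fun a => |K a|) (fun _ _ => abs_nonneg _) (Finset.mem_univ _)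

/-- Gibbs measures are quasi-Bernoulli. -/
lemma IsGibbs.exists_quasiBernoulli (hμ : IsGibbs μ) :
    ∃ D : ℝ, 0 < D ∧ ∀ (n k : ℕ) (x : SFT A),
      0 < μ.real (cylinder x n) ∧
      μ.real (cylinder x (n + (k + 1))) ≤
        D * (μ.real (cylinder x (n + 1)) * μ.real (cylinder ((shift A)^[n] x) (k + 1))) ∧
      μ.real (cylinder x (n + 1)) * μ.real (cylinder ((shift A)^[n] x) (k + 1)) ≤
        D * μ.real (cylinder x (n + (k + 1))) ∧
      μ.real (cylinder (shift A x) n) ≤ D * μ.real (cylinder x (n + 1)) := by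
  obtain ⟨φ, hφ, P, C, hC, h⟩ := hμ.gibbs
  obtain ⟨K, hK⟩ := hφ.exists_bound
  set g : ℕ → SFT A → ℝ := fun n x => Real.exp (birkhoffSum (shift A) φ n x - n * P)
  have hg : ∀ n x, 0 < g n x := fun n x => Real.exp_pos _
  have hlo : ∀ n x, g n x ≤ C * μ.real (cylinder x n) := fun n x => by
    have := (h n x).1
    rw [le_div_iff₀ (hg n x), inv_mul_le_iff₀ hC] at this
    exact this
  have hup : ∀ n x, μ.real (cylinder x n) ≤ C * g n x := fun n x => by
    have := (h n x).2
    rwa [div_le_iff₀ (hg n x)] at this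
  have hpos : ∀ n x, 0 < μ.real (cylinder x n) := fun n x =>
    pos_of_mul_pos_right ((hg n x).trans_le (hlo n x)) hC.le
  set E := Real.exp (K + |P|)
  have hE : 0 < E := Real.exp_pos _
  have hgadd : ∀ n k x, g n x * g k ((shift A)^[n] x) = g (n + k) x := fun n k x => by
    simp only [g]
    rw [← Real.exp_add, birkhoffSum_add]
    congr 1; push_cast; ring
  have hg1 : ∀ x, g 1 x ≤ E ∧ 1 ≤ E * g 1 x := fun x => by
    have h1 := abs_le.1 (hK x)
    have h2 := abs_le.1 (le_refl |P|)
    simp only [g, E, birkhoffSum_one, ← Real.exp_add, Nat.cast_one, one_mul]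
    exact ⟨Real.exp_le_exp.2 (by linarith), Real.one_le_exp (by linarith)⟩
  -- The two cylinders share the symbol in position `n`. The weight `g 1` counted twice there is
  -- bounded above by `E` and below by `E⁻¹`. As the Gibbs bounds hold at every point, the same
  -- orbit serves for all cylinders and no distortion estimate is needed.
  have hsplit : ∀ n k x, g (n + 1) x * g (k + 1) ((shift A)^[n] x) =
      g (n + (k + 1)) x * g 1 ((shift A)^[n] x) := fun n k x => by
    rw [← hgadd n 1, ← hgadd n (k + 1)]; ring
  have hC3 : 0 < C ^ 3 * E + C ^ 2 * E := by positivity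
  refine ⟨C ^ 3 * E + C ^ 2 * E, hC3, fun n k x => ⟨hpos n x, ?_, ?_, ?_⟩⟩
  · have h1 : g (n + (k + 1)) x ≤ E * (g (n + 1) x * g (k + 1) ((shift A)^[n] x)) := by
      rw [hsplit]
      have := mul_le_mul_of_nonneg_left (hg1 ((shift A)^[n] x)).2 (hg (n + (k + 1)) x).le
      linarith
    have h2 := mul_le_mul (hlo (n + 1) x) (hlo (k + 1) ((shift A)^[n] x)) (hg _ _).le
      (mul_nonneg hC.le (hpos _ _).le)
    calc μ.real (cylinder x (n + (k + 1))) ≤ C * g (n + (k + 1)) x := hup _ _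
      _ ≤ C * (E * ((C * μ.real (cylinder x (n + 1))) *
          (C * μ.real (cylinder ((shift A)^[n] x) (k + 1))))) := by
        gcongr
        exact h1.trans (by gcongr)
      _ = (C ^ 3 * E) * (μ.real (cylinder x (n + 1)) *
          μ.real (cylinder ((shift A)^[n] x) (k + 1))) := by ring
      _ ≤ _ := by
        have := mul_pos (hpos (n + 1) x) (hpos (k + 1) ((shift A)^[n] x))
        gcongr
        exact le_add_of_nonneg_right (by positivity)
  · calc μ.real (cylinder x (n + 1)) * μ.real (cylinder ((shift A)^[n] x) (k + 1))
        ≤ (C * g (n + 1) x) * (C * g (k + 1) ((shift A)^[n] x)) :=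
          mul_le_mul (hup _ _) (hup _ _) (hpos _ _).le (mul_nonneg hC.le (hg _ _).le)
      _ = C ^ 2 * (g (n + (k + 1)) x * g 1 ((shift A)^[n] x)) := by rw [← hsplit]; ring
      _ ≤ C ^ 2 * ((C * μ.real (cylinder x (n + (k + 1)))) * E) := by
        gcongr
        · exact hlo _ _
        · exact (hg1 _).1
      _ = (C ^ 3 * E) * μ.real (cylinder x (n + (k + 1))) := by ring
      _ ≤ _ := by
        have := hpos (n + (k + 1)) x
        gcongr
        exact le_add_of_nonneg_right (by positivity)
  -- This last bound says that each preimage branch of a cylinder carries a definite proportion of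
  -- its mass; it feeds the maximum principle.
  · have h1 : g n (shift A x) ≤ E * g (n + 1) x := by
      have h2 := hgadd 1 n x
      rw [Function.iterate_one, add_comm 1 n] at h2
      rw [← h2]
      have := mul_le_mul_of_nonneg_right (hg1 x).2 (hg n (shift A x)).le
      linarith
    calc μ.real (cylinder (shift A x) n) ≤ C * (E * (C * μ.real (cylinder x (n + 1)))) := by
          refine (hup _ _).trans ?_
          gcongr
          exact h1.trans (by gcongr; exact hlo _ _)
      _ = (C ^ 2 * E) * μ.real (cylinder x (n + 1)) := by ring
      _ ≤ _ := by
        have := hpos (n + 1) x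
        gcongr
        exact le_add_of_nonneg_left (by positivity)

/-- The conditional product measure of a Gibbs measure, given the symbol in position `0`. -/
def bracketMeasure (μ : Measure (SFT A)) (a : Fin m) : Measure (SFT A) :=
  ((μ.restrict (symbolSet A a)).prod (μ.restrict (symbolSet A a))).map bracket

/-- The bracket lies in the symmetric cylinder exactly when its first argument has the right past
and its second argument the right future, so the product measure factors. Position `0` is read by
both. -/
lemma bracketMeasure_symCylinder [IsFiniteMeasure μ] (x : SFT A) (n : ℕ) :
    bracketMeasure μ (x.1 0) (symCylinder x n) =
      μ (pastCylinder x n) * μ (cylinder x (n + 1)) := by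
  have hp : pastCylinder x n ⊆ symbolSet A (x.1 0) := fun y hy => hy 0 (by simp) le_rfl
  have hc := cylinder_subset_symbolSet x n
  rw [bracketMeasure, Measure.map_apply measurable_bracket (measurableSet_symCylinder x n),
    Measure.prod_restrict, Measure.restrict_apply (measurable_bracket (measurableSet_symCylinder x n)),
    ← Measure.prod_prod]
  congr 1
  ext p
  constructor
  · rintro ⟨h1, h2, h3⟩
    have h4 : p.1.1 0 = p.2.1 0 := Eq.trans h2 (Eq.symm h3)
    refine ⟨fun i hi hi' => ?_, fun i hi hi' => ?_⟩
    · rw [← bracket_apply_of_nonpos p hi']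
      exact h1 i hi (by omega)
    · rw [← bracket_apply_of_nonneg h4 hi]
      exact h1 i (by omega) (by push_cast at hi'; omega)
  · rintro ⟨h1, h2⟩
    have h4 : p.1.1 0 = p.2.1 0 := Eq.trans (hp h1) (Eq.symm (hc h2))
    refine ⟨fun i hi hi' => ?_, hp h1, hc h2⟩
    rcases le_total i 0 with h | h
    · rw [bracket_apply_of_nonpos p h]; exact h1 i hi h
    · rw [bracket_apply_of_nonneg h4 h]; exact h2 i h (by push_cast; omega)

lemma restrict_symCylinder (x : SFT A) (n : ℕ) :
    μ.restrict (symbolSet A (x.1 0)) (symCylinder x n) = μ (symCylinder x n) := by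
  rw [Measure.restrict_apply (measurableSet_symCylinder x n), Set.inter_eq_left.2]
  exact fun y hy => hy 0 (by simp) (by simp)

lemma symCylinder_inter_symbolSet {x : SFT A} {a : Fin m} (h : x.1 0 ≠ a) (n : ℕ) :
    symCylinder x n ∩ symbolSet A a = ∅ := by
  ext y
  refine iff_of_false ?_ (Set.notMem_empty y)
  rintro ⟨h1, h2⟩
  exact h ((h1 0 (by simp) (by simp)).symm.trans h2)

lemma bracketMeasure_compl [SFinite μ] (a : Fin m) : bracketMeasure μ a (symbolSet A a)ᶜ = 0 := by
  rw [bracketMeasure, Measure.map_apply measurable_bracket (measurableSet_symbolSet a).compl,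
    Measure.prod_restrict, Measure.restrict_apply
      (measurable_bracket (measurableSet_symbolSet a).compl)]
  have : bracket ⁻¹' (symbolSet A a)ᶜ ∩ symbolSet A a ×ˢ symbolSet A a = ∅ := by
    ext p
    refine iff_of_false ?_ (Set.notMem_empty p)
    rintro ⟨h1, h2, -⟩
    exact h1 ((bracket_apply_of_nonpos p le_rfl).trans h2)
  rw [this, measure_empty]

instance [IsFiniteMeasure μ] (a : Fin m) : IsFiniteMeasure (bracketMeasure μ a) := by
  unfold bracketMeasure; infer_instance

/-- The local product structure of Gibbs measures. -/
theorem IsGibbs.exists_product_structure (hμ : IsGibbs μ) :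
    ∃ D : ENNReal, D ≠ ⊤ ∧ ∀ a : Fin m,
      μ.restrict (symbolSet A a) ≤ D • bracketMeasure μ a ∧
      bracketMeasure μ a ≤ D • μ.restrict (symbolSet A a) := by
  have := hμ.isProbabilityMeasure
  obtain ⟨D, hD, h⟩ := hμ.exists_quasiBernoulli
  have hsym : ∀ (x : SFT A) n, μ (symCylinder x n) =
      ENNReal.ofReal (μ.real (cylinder ((shift A).symm^[n] x) (n + (n + 1)))) := fun x n => by
    rw [symCylinder_eq_preimage, ((measurePreserving_shift_symm hμ.invariant).iterate
      n).measure_preimage (measurableSet_cylinder _ _).nullMeasurableSet, ofReal_measureReal]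
  have hprod : ∀ (x : SFT A) n, μ (pastCylinder x n) * μ (cylinder x (n + 1)) =
      ENNReal.ofReal (μ.real (cylinder ((shift A).symm^[n] x) (n + 1)) *
        μ.real (cylinder x (n + 1))) := fun x n => by
    rw [pastCylinder_eq_preimage, ((measurePreserving_shift_symm hμ.invariant).iterate
      n).measure_preimage (measurableSet_cylinder _ _).nullMeasurableSet,
      ENNReal.ofReal_mul measureReal_nonneg, ofReal_measureReal, ofReal_measureReal]
  refine ⟨ENNReal.ofReal D, ENNReal.ofReal_ne_top, fun a => ⟨?_, ?_⟩⟩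
  · refine measure_le_of_symCylinder_le ENNReal.ofReal_ne_top fun x n => ?_
    by_cases hx : x.1 0 = a
    · subst hx
      rw [restrict_symCylinder, bracketMeasure_symCylinder, hsym, hprod, ← ENNReal.ofReal_mul hD.le]
      have := (h n n ((shift A).symm^[n] x)).2.1
      rw [shift_iterate_symm_iterate] at this
      exact ENNReal.ofReal_le_ofReal this
    · rw [Measure.restrict_apply (measurableSet_symCylinder x n), symCylinder_inter_symbolSet hx,
        measure_empty]
      exact zero_le
  · refine measure_le_of_symCylinder_le ENNReal.ofReal_ne_top fun x n => ?_
    by_cases hx : x.1 0 = a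
    · subst hx
      rw [restrict_symCylinder, bracketMeasure_symCylinder, hsym, hprod, ← ENNReal.ofReal_mul hD.le]
      have := (h n n ((shift A).symm^[n] x)).2.2.1
      rw [shift_iterate_symm_iterate] at this
      exact ENNReal.ofReal_le_ofReal this
    · have h0 : bracketMeasure μ a (symCylinder x n) ≤ 0 := by
        rw [← bracketMeasure_compl (μ := μ) a]
        refine measure_mono fun y hy hya => ?_
        have : y ∈ symCylinder x n ∩ symbolSet A a := ⟨hy, hya⟩
        rw [symCylinder_inter_symbolSet hx] at this
        exact this
      exact h0.trans zero_le

/-- The past and the future of a Gibbs measure are quasi-independent: a function which is constant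
along local unstable sets is quasi-independent from the future cylinders. -/
theorem IsGibbs.exists_lintegral_cylinder_le (hμ : IsGibbs μ) :
    ∃ D : ENNReal, D ≠ ⊤ ∧ ∀ (f : SFT A → ENNReal) (S : Set (SFT A)), Measurable f → S ∈ ae μ →
      (∀ x ∈ S, ∀ y ∈ S, y ∈ Wuloc x → f x = f y) → ∀ (x : SFT A) (n : ℕ),
        ∫⁻ y in cylinder x (n + 1), f y ∂μ ≤
          D * (μ (cylinder x (n + 1)) * ∫⁻ y in symbolSet A (x.1 0), f y ∂μ) := by
  have := hμ.isProbabilityMeasure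
  obtain ⟨D, hD, h⟩ := hμ.exists_product_structure
  refine ⟨D, hD, fun f S hf hS hfS x n => ?_⟩
  obtain ⟨h1, h2⟩ := h (x.1 0)
  have hcm := measurableSet_cylinder x (n + 1)
  set μa := μ.restrict (symbolSet A (x.1 0))
  have hind : Measurable ((cylinder x (n + 1)).indicator f) := hf.indicator hcm
  have hSa : ∀ᵐ y ∂μa, y ∈ S := ae_restrict_of_ae hS
  -- Absolute continuity puts almost every bracket in `S`. There `f (bracket p) = f p.1`, because
  -- the bracket has the past of `p.1`, whereas membership in the future cylinder depends on `p.2`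
  -- only: the integral factors.
  have hab : bracketMeasure μ (x.1 0) ≪ μa :=
    (Measure.absolutelyContinuous_of_le h2).trans Measure.smul_absolutelyContinuous
  have hSb : ∀ᵐ p ∂(μa.prod μa), bracket p ∈ S :=
    ae_of_ae_map measurable_bracket.aemeasurable (hab.ae_le hSa)
  have hS1 : ∀ᵐ p ∂(μa.prod μa), p.1 ∈ S := Measure.quasiMeasurePreserving_fst.ae hSa
  have hsym : ∀ᵐ y ∂μa, y ∈ symbolSet A (x.1 0) :=
    ae_restrict_mem (measurableSet_symbolSet _)
  have e1 : ∀ᵐ p ∂(μa.prod μa), p.1 ∈ symbolSet A (x.1 0) :=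
    Measure.quasiMeasurePreserving_fst.ae hsym
  have e2 : ∀ᵐ p ∂(μa.prod μa), p.2 ∈ symbolSet A (x.1 0) :=
    Measure.quasiMeasurePreserving_snd.ae hsym
  have hμac : μa (cylinder x (n + 1)) = μ (cylinder x (n + 1)) := by
    rw [Measure.restrict_apply hcm, Set.inter_eq_left.2 (cylinder_subset_symbolSet x n)]
  calc ∫⁻ y in cylinder x (n + 1), f y ∂μ
      = ∫⁻ y, (cylinder x (n + 1)).indicator f y ∂μa := by
        rw [lintegral_indicator hcm, Measure.restrict_restrict hcm,
          Set.inter_eq_left.2 (cylinder_subset_symbolSet x n)]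
    _ ≤ ∫⁻ y, (cylinder x (n + 1)).indicator f y ∂(D • bracketMeasure μ (x.1 0)) :=
        lintegral_mono' h1 le_rfl
    _ = D * ∫⁻ p, (cylinder x (n + 1)).indicator f (bracket p) ∂(μa.prod μa) := by
        rw [lintegral_smul_measure, bracketMeasure, lintegral_map hind measurable_bracket,
          smul_eq_mul]
    _ = D * ∫⁻ p, f p.1 * (cylinder x (n + 1)).indicator (fun _ => 1) p.2 ∂(μa.prod μa) := by
        congr 1
        refine lintegral_congr_ae ?_
        filter_upwards [hSb, hS1, e1, e2] with p hp1 hp2 hp3 hp4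
        have h0 : p.1.1 0 = p.2.1 0 := Eq.trans hp3 (Eq.symm hp4)
        have hb : bracket p ∈ cylinder x (n + 1) ↔ p.2 ∈ cylinder x (n + 1) :=
          forall_congr' fun i => forall_congr' fun hi => by rw [bracket_apply_of_nonneg h0 hi]
        by_cases hc : p.2 ∈ cylinder x (n + 1)
        · rw [Set.indicator_of_mem hc, Set.indicator_of_mem (hb.2 hc), mul_one]
          exact (hfS _ hp2 _ hp1 fun i hi => bracket_apply_of_nonpos p hi).symm
        · rw [Set.indicator_of_notMem hc, Set.indicator_of_notMem (fun h => hc (hb.1 h)), mul_zero]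
    _ = D * ((∫⁻ y, f y ∂μa) * μ (cylinder x (n + 1))) := by
        rw [lintegral_prod_mul hf.aemeasurable
          (measurable_const.indicator hcm).aemeasurable, lintegral_indicator_const hcm, one_mul,
          hμac]
    _ = _ := by rw [mul_comm (∫⁻ y, f y ∂μa)]

end Gibbs

/-! ### Strong irreducibility for locally constant cocycles -/

section Irreducibility

variable {m d : ℕ} {A : Fin m → Fin m → Prop} {M L : SFT A → GLd d}

lemma mem_mapSubspace {g : GLd d} {W : Submodule ℝ (Vec d)} {v : Vec d} :
    v ∈ mapSubspace g W ↔ g⁻¹.1 v ∈ W := by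
  constructor
  · rintro ⟨w, hw, rfl⟩
    show g⁻¹.1 (g.1 w) ∈ W
    rwa [units_inv_apply_apply]
  · intro h
    exact ⟨_, h, units_apply_inv_apply g v⟩

lemma mapSubspace_mul (g h : GLd d) (W : Submodule ℝ (Vec d)) :
    mapSubspace (g * h) W = mapSubspace g (mapSubspace h W) := by
  ext v
  rw [mem_mapSubspace, mem_mapSubspace, mem_mapSubspace, mul_inv_rev, Units.val_mul,
    mul_apply_eq_comp]

lemma mapSubspace_one (W : Submodule ℝ (Vec d)) : mapSubspace (1 : GLd d) W = W := by
  ext v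
  rw [mem_mapSubspace, inv_one]; rfl

lemma mapSubspace_inv_mapSubspace (g : GLd d) (W : Submodule ℝ (Vec d)) :
    mapSubspace g⁻¹ (mapSubspace g W) = W := by
  rw [← mapSubspace_mul, inv_mul_cancel, mapSubspace_one]

lemma mapSubspace_mapSubspace_inv (g : GLd d) (W : Submodule ℝ (Vec d)) :
    mapSubspace g (mapSubspace g⁻¹ W) = W := by
  rw [← mapSubspace_mul, mul_inv_cancel, mapSubspace_one]

lemma mapSubspace_injective (g : GLd d) : Function.Injective (mapSubspace g) :=
  Function.LeftInverse.injective (mapSubspace_inv_mapSubspace g)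

lemma finrank_mapSubspace (g : GLd d) (W : Submodule ℝ (Vec d)) :
    Module.finrank ℝ (mapSubspace g W) = Module.finrank ℝ W :=
  (Submodule.equivMapOfInjective _
    (ContinuousLinearEquiv.unitsEquiv ℝ (Vec d) g).injective W).finrank_eq.symm

/-- If `u` is in the image of `W`, then `g⁻¹ u` is in `W` and is killed by the projection to the
orthogonal complement, so `u` may be replaced by `(1 - g⁻¹) u`. -/
lemma grassDist_mapSubspace_le (g : GLd d) (W : Submodule ℝ (Vec d)) :
    grassDist (mapSubspace g W) W ≤ ‖1 - (g⁻¹).1‖ := by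
  refine ContinuousLinearMap.opNorm_le_bound _ (norm_nonneg _) fun v => ?_
  set u := (mapSubspace g W).starProjection v
  have hu : g⁻¹.1 u ∈ W := mem_mapSubspace.1 (Submodule.starProjection_apply_mem _ v)
  have h1 : (Wᗮ).starProjection u = (Wᗮ).starProjection ((1 - g⁻¹.1) u) := by
    have h2 : (Wᗮ).starProjection (g⁻¹.1 u) = 0 := by
      rw [Submodule.starProjection_apply_eq_zero_iff]
      exact Submodule.le_orthogonal_orthogonal W hu
    have h3 : (1 - g⁻¹.1) u = u - g⁻¹.1 u := rfl
    rw [h3, map_sub, h2, sub_zero]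
  rw [ContinuousLinearMap.comp_apply]
  show ‖(Wᗮ).starProjection u‖ ≤ _
  rw [h1]
  refine (Submodule.norm_starProjection_apply_le _ _).trans ?_
  refine (ContinuousLinearMap.le_opNorm _ _).trans ?_
  gcongr
  exact Submodule.norm_starProjection_apply_le _ _

lemma tendsto_grassDist_mapSubspace (hL : Continuous L) (x : SFT A) (W : Submodule ℝ (Vec d)) :
    Tendsto (fun y => grassDist (mapSubspace (L y)⁻¹ W) (mapSubspace (L x)⁻¹ W)) (𝓝 x) (𝓝 0) := by
  have h1 : Tendsto (fun y => ‖1 - (((L y)⁻¹ * L x)⁻¹).1‖) (𝓝 x) (𝓝 0) := by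
    have hc : Continuous fun y => ‖1 - (((L y)⁻¹ * L x)⁻¹).1‖ :=
      (continuous_const.sub (Units.continuous_val.comp
        ((hL.inv.mul continuous_const).inv))).norm
    have := hc.tendsto x
    simpa using this
  refine squeeze_zero (fun y => norm_nonneg _) (fun y => ?_) h1
  have : mapSubspace (L y)⁻¹ W = mapSubspace ((L y)⁻¹ * L x) (mapSubspace (L x)⁻¹ W) := by
    rw [mapSubspace_mul, mapSubspace_mapSubspace_inv]
  rw [this]
  exact grassDist_mapSubspace_le _ _

/-- A strongly irreducible cocycle which only depends on the symbols `x_0`, `x_1` does not preserve a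
finite family of proper subspaces which only depends on the symbol `x_0`. -/
theorem StronglyIrreducible.false_of_family
    (hirr : StronglyIrreducible M (trivHolonomy L) (trivHolonomy L)) (hL : Continuous L)
    {k n : ℕ} (hk : 0 < k) (hkd : k < d) (hn : 0 < n) (U : Fin m → Set (Submodule ℝ (Vec d)))
    (hfin : ∀ a, (U a).Finite) (hdim : ∀ a, ∀ W ∈ U a, Module.finrank ℝ W = k)
    (hcard : ∀ x : SFT A, (U (x.1 0)).ncard = n)
    (hinv : ∀ x : SFT A, mapSubspace (L (shift A x) * M x * (L x)⁻¹) '' U (x.1 0) = U (x.1 1)) :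
    False := by
  -- The enumeration is fixed once for each symbol, so each enumerated subspace is locally constant
  -- in the trivialization and hence continuous on the bundle. The constant `⊥` is a dummy value for
  -- symbols that do not occur.
  have henum : ∀ a, ∃ e : Fin n → Submodule ℝ (Vec d), (U a).ncard = n →
      Function.Injective e ∧ Set.range e = U a := by
    intro a
    by_cases h : (U a).ncard = n
    · have := (hfin a).fintype
      have hc : Fintype.card (U a) = n := by rw [← h, Set.ncard_eq_toFinset_card', Set.toFinset_card]
      let e := (Fintype.equivFinOfCardEq hc).symm
      refine ⟨fun i => e i, fun _ => ⟨Subtype.val_injective.comp e.injective, ?_⟩⟩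
      show Set.range (Subtype.val ∘ e) = U a
      rw [Set.range_comp, e.surjective.range_eq]
      simp
    · exact ⟨fun _ => ⊥, fun h' => absurd h' h⟩
  choose e he using henum
  have hinj : ∀ x : SFT A, Function.Injective (e (x.1 0)) := fun x => (he _ (hcard x)).1
  have hran : ∀ x : SFT A, Set.range (e (x.1 0)) = U (x.1 0) := fun x => (he _ (hcard x)).2
  have hV : ∀ x : SFT A, (Set.range fun i => mapSubspace (L x)⁻¹ (e (x.1 0) i)) =
      mapSubspace (L x)⁻¹ '' U (x.1 0) := fun x => by
    rw [← hran x, ← Set.range_comp]; rfl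
  have hhol : ∀ x y : SFT A, y.1 0 = x.1 0 → mapSubspace (trivHolonomy L x y) ''
      (Set.range fun i => mapSubspace (L x)⁻¹ (e (x.1 0) i)) =
      Set.range fun i => mapSubspace (L y)⁻¹ (e (y.1 0) i) := by
    intro x y hxy
    rw [hV, hV, ← Set.image_comp, hxy]
    refine Set.image_congr fun W _ => ?_
    rw [Function.comp_apply, trivHolonomy, mapSubspace_mul, mapSubspace_mapSubspace_inv]
  refine hirr ⟨k, n, fun i x => mapSubspace (L x)⁻¹ (e (x.1 0) i), hk, hkd, hn, fun i x => ?_,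
    fun x => (mapSubspace_injective _).comp (hinj x), fun i x => ?_, fun x => ?_, fun x y hy => ?_,
    fun x y hy => ?_⟩
  · rw [finrank_mapSubspace]
    exact hdim (x.1 0) _ (by rw [← hran x]; exact Set.mem_range_self i)
  · refine (tendsto_grassDist_mapSubspace hL x (e (x.1 0) i)).congr' ?_
    have : ∀ᶠ y : SFT A in 𝓝 x, y.1 0 = x.1 0 :=
      (continuous_coord 0).continuousAt.eventually (isOpen_discrete {x.1 0} |>.mem_nhds rfl)
    filter_upwards [this] with y hy
    rw [hy]
  · rw [hV, hV]
    have h1 : U ((shift A x).1 0) = U (x.1 1) := rfl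
    rw [h1, ← hinv x, ← Set.image_comp, ← Set.image_comp]
    refine Set.image_congr fun W _ => ?_
    rw [Function.comp_apply, Function.comp_apply, ← mapSubspace_mul, ← mapSubspace_mul]
    congr 1
    group
  · exact hhol x y (hy 0 le_rfl)
  · exact hhol x y (hy 0 le_rfl)

end Irreducibility

/-! ### Invariant `u`-states do not charge proper subspaces -/

section NoMass

variable {m d : ℕ} {A : Fin m → Fin m → Prop} {μ : Measure (SFT A)}

/-- The set of the lines contained in a linear subspace. -/
def projSet (W : Submodule ℝ (Vec d)) : Set (Proj d) := {p | p.rep ∈ W}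

lemma mk_mem_projSet {W : Submodule ℝ (Vec d)} {v : Vec d} (hv : v ≠ 0) :
    Projectivization.mk ℝ v hv ∈ projSet W ↔ v ∈ W := by
  obtain ⟨c, hc⟩ := Projectivization.exists_smul_eq_mk_rep ℝ v hv
  show (Projectivization.mk ℝ v hv).rep ∈ W ↔ v ∈ W
  rw [← hc]
  exact W.smul_mem_iff c.ne_zero

lemma isClosed_projSet (W : Submodule ℝ (Vec d)) : IsClosed (projSet W) := by
  rw [← isOpenQuotientMap_mk'.isQuotientMap.isClosed_preimage]
  have : Projectivization.mk' ℝ ⁻¹' projSet W =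
      (fun v : {v : Vec d // v ≠ 0} => v.1) ⁻¹' (W : Set (Vec d)) := by
    ext v; exact mk_mem_projSet v.2
  rw [this]
  exact (Submodule.closed_of_finiteDimensional W).preimage continuous_subtype_val

lemma measurableSet_projSet (W : Submodule ℝ (Vec d)) : MeasurableSet (projSet W) :=
  (isClosed_projSet W).measurableSet

lemma projSet_inf (W W' : Submodule ℝ (Vec d)) : projSet (W ⊓ W') = projSet W ∩ projSet W' := rfl

lemma projSet_bot : projSet (⊥ : Submodule ℝ (Vec d)) = ∅ := by
  ext p
  exact iff_of_false (fun h => p.rep_nonzero h) (Set.notMem_empty p)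

lemma projMap_mem_projSet {g : GLd d} {W : Submodule ℝ (Vec d)} {p : Proj d} :
    projMap g p ∈ projSet W ↔ p ∈ projSet (mapSubspace g⁻¹ W) := by
  induction p using Projectivization.ind with
  | h v hv => rw [projMap_mk, mk_mem_projSet, mk_mem_projSet, mem_mapSubspace, inv_inv]

/-- Finitely many subspaces of the minimal dimension of charged subspaces have a large mass. -/
lemma finite_setOf_le_measure_projSet {ν : Measure (SFT A × Proj d)} [IsProbabilityMeasure ν]
    {k : ℕ} (hmin : ∀ (a : Fin m) (W : Submodule ℝ (Vec d)), Module.finrank ℝ W < k →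
      ν (symbolSet A a ×ˢ projSet W) = 0) (a : Fin m) {c : ℝ} (hc : 0 < c) :
    {W : Submodule ℝ (Vec d) | Module.finrank ℝ W = k ∧
      c ≤ ν.real (symbolSet A a ×ˢ projSet W)}.Finite := by
  -- Two distinct subspaces of dimension `k` meet in a smaller dimension, which has no mass. A
  -- finite measure admits only finitely many almost disjoint sets of mass at least `c`.
  have hdisj : Pairwise (Function.onFun (AEDisjoint ν)
      fun W : {W : Submodule ℝ (Vec d) // Module.finrank ℝ W = k} =>
        symbolSet A a ×ˢ projSet W.1) := by
    intro W W' hne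
    show ν _ = 0
    rw [← Set.prod_inter, ← projSet_inf]
    refine hmin a _ ?_
    by_contra! h
    have h1 : W.1 ⊓ W'.1 = W.1 := Submodule.eq_of_le_of_finrank_le inf_le_left (by rw [W.2]; exact h)
    have h2 : W.1 ⊓ W'.1 = W'.1 :=
      Submodule.eq_of_le_of_finrank_le inf_le_right (by rw [W'.2]; exact h)
    exact hne (Subtype.ext (h1.symm.trans h2))
  have hfin := Measure.finite_const_le_meas_of_disjoint_iUnion₀ ν (ENNReal.ofReal_pos.2 hc)
    (fun W : {W : Submodule ℝ (Vec d) // Module.finrank ℝ W = k} =>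
      ((measurableSet_symbolSet a).prod (measurableSet_projSet W.1)).nullMeasurableSet) hdisj
    (measure_ne_top _ _)
  refine (hfin.image Subtype.val).subset ?_
  rintro W ⟨hW, hcW⟩
  refine ⟨⟨W, hW⟩, ?_, rfl⟩
  show ENNReal.ofReal c ≤ ν (symbolSet A a ×ˢ projSet W)
  rw [← ofReal_measureReal]
  exact ENNReal.ofReal_le_ofReal hcW

/-- The mass of a subspace, conditionally on a future cylinder. -/
def cylMass (μ : Measure (SFT A)) (ν : Measure (SFT A × Proj d)) (x : SFT A) (n : ℕ)
    (W : Submodule ℝ (Vec d)) : ℝ :=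
  ν.real (cylinder x (n + 1) ×ˢ projSet W) / μ.real (cylinder x (n + 1))

lemma cylinder_congr {x y : SFT A} {n : ℕ} (h : y ∈ cylinder x n) : cylinder y n = cylinder x n := by
  ext z
  exact forall_congr' fun i => forall_congr' fun h0 => forall_congr' fun h1 => by rw [h i h0 h1]

lemma cylinder_one (x : SFT A) : cylinder x (0 + 1) = symbolSet A (x.1 0) := by
  ext y
  refine ⟨fun h => h 0 le_rfl (by simp), fun h i h0 h1 => ?_⟩
  have : i = 0 := by push_cast at h1; omega
  rw [this]; exact h

lemma cylinder_succ_eq (z : SFT A) (n : ℕ) :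
    cylinder z (n + 1) = symbolSet A (z.1 0) ∩ shift A ⁻¹' cylinder (shift A z) n := by
  ext u
  constructor
  · intro h
    refine ⟨h 0 le_rfl (by positivity), fun i h0 h1 => ?_⟩
    rw [shift_apply, shift_apply]
    exact h (i + 1) (by omega) (by push_cast; omega)
  · rintro ⟨h1, h2⟩ i hi hi'
    rcases hi.lt_or_eq with h | rfl
    · have := h2 (i - 1) (by omega) (by push_cast at hi'; omega)
      rw [shift_apply, shift_apply] at this
      simpa using this
    · exact h1

lemma measureReal_eq_sum_symbolSet {E : Set (SFT A)} [IsFiniteMeasure μ] (hE : MeasurableSet E) :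
    μ.real E = ∑ c : Fin m, μ.real (symbolSet A c ∩ E) := by
  have : E = ⋃ c : Fin m, symbolSet A c ∩ E := by
    ext x
    simp only [Set.mem_iUnion]
    exact ⟨fun h => ⟨x.1 0, rfl, h⟩, fun ⟨c, h⟩ => h.2⟩
  conv_lhs => rw [this]
  refine measureReal_iUnion_fintype (fun c c' hcc => Set.disjoint_left.2 fun x hx hx' => ?_)
    fun c => (measurableSet_symbolSet c).inter hE
  exact hcc (Eq.trans (Eq.symm hx.1) hx'.1)

variable {N : SFT A → GLd d} {B : Fin m → Fin m → GLd d}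

/-- The step of the maximum principle: splitting the mass along the preimages of a cylinder. -/
lemma cylMass_le_of_preimage (hμ : IsGibbs μ) (hN : ∀ x, N x = B (x.1 0) (x.1 1))
    {ν : Measure (SFT A × Proj d)} [IsProbabilityMeasure ν]
    (hν : MeasurePreserving (projFibered N) ν ν) {k : ℕ} {H : ℝ}
    (hH : ∀ (x : SFT A) n (W : Submodule ℝ (Vec d)), Module.finrank ℝ W = k →
      cylMass μ ν x n W ≤ H) (z : SFT A) (n : ℕ) {W : Submodule ℝ (Vec d)}
    (hW : Module.finrank ℝ W = k) :
    cylMass μ ν (shift A z) n W * μ.real (cylinder (shift A z) (n + 1)) ≤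
      cylMass μ ν z (n + 1) (mapSubspace (N z)⁻¹ W) * μ.real (cylinder z (n + 1 + 1)) +
        H * (μ.real (cylinder (shift A z) (n + 1)) - μ.real (cylinder z (n + 1 + 1))) := by
  classical
  have := hμ.isProbabilityMeasure
  obtain ⟨D, hD, hqb⟩ := hμ.exists_quasiBernoulli
  have hpos : ∀ x n, 0 < μ.real (cylinder x n) := fun x n => (hqb n 0 x).1
  have hmul : ∀ x n (W : Submodule ℝ (Vec d)), cylMass μ ν x n W * μ.real (cylinder x (n + 1)) =
      ν.real (cylinder x (n + 1) ×ˢ projSet W) := fun x n W => div_mul_cancel₀ _ (hpos _ _).ne'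
  set C := cylinder (shift A z) (n + 1) with hC
  -- The preimage of the cylinder splits according to the new symbol `x_0 = c`. On each piece `N` is
  -- constant, and the piece is a longer cylinder or, when the transition is forbidden, empty.
  set E : Fin m → Set (SFT A) := fun c => symbolSet A c ∩ shift A ⁻¹' C with hE
  have hCm : MeasurableSet C := measurableSet_cylinder _ _
  have hEz : cylinder z (n + 1 + 1) = E (z.1 0) := cylinder_succ_eq z (n + 1)
  have hμC : μ.real C = ∑ c, μ.real (E c) := by
    rw [← measureReal_eq_sum_symbolSet (continuous_shift.measurable hCm)]
    exact congrArg ENNReal.toReal (hμ.invariant.measure_preimage hCm.nullMeasurableSet).symm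
  have hEN : ∀ c, ∀ u ∈ E c, N u = B c (z.1 1) := fun c u hu => by
    have h1 : u.1 0 = c := hu.1
    have h2 : (shift A u).1 0 = (shift A z).1 0 := hu.2 0 le_rfl (by positivity)
    rw [shift_apply, shift_apply, zero_add] at h2
    rw [hN, h1, h2]
  have hνC : ν.real (C ×ˢ projSet W) ≤
      ∑ c, ν.real (E c ×ˢ projSet (mapSubspace (B c (z.1 1))⁻¹ W)) := by
    have h1 : ν.real (C ×ˢ projSet W) = ν.real (projFibered N ⁻¹' (C ×ˢ projSet W)) :=
      congrArg ENNReal.toReal (hν.measure_preimage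
        (hCm.prod (measurableSet_projSet W)).nullMeasurableSet).symm
    rw [h1]
    refine le_trans (measureReal_mono (μ := ν) ?_) (measureReal_iUnion_fintype_le
      (fun c => E c ×ˢ projSet (mapSubspace (B c (z.1 1))⁻¹ W)))
    rintro ⟨u, p⟩ ⟨h1, h2⟩
    have hu : u ∈ E (u.1 0) := ⟨rfl, h1⟩
    refine Set.mem_iUnion.2 ⟨u.1 0, hu, ?_⟩
    rw [← hEN _ u hu]
    exact projMap_mem_projSet.1 h2
  have hterm : ∀ c, ν.real (E c ×ˢ projSet (mapSubspace (B c (z.1 1))⁻¹ W)) ≤ H * μ.real (E c) := by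
    intro c
    by_cases hc : (E c).Nonempty
    · obtain ⟨u, hu⟩ := hc
      have hu0 : u.1 0 = c := hu.1
      have hEu : E c = cylinder u (n + 1 + 1) := by
        rw [cylinder_succ_eq, cylinder_congr hu.2, hu0]
      rw [hEu, ← hmul]
      exact mul_le_mul_of_nonneg_right (hH _ _ _ (by rw [finrank_mapSubspace, hW])) (hpos _ _).le
    · rw [Set.not_nonempty_iff_eq_empty.1 hc]
      simp
  rw [hmul, hmul, hEz]
  refine hνC.trans ?_
  rw [hμC, ← Finset.add_sum_erase _ _ (Finset.mem_univ (z.1 0)),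
    ← Finset.add_sum_erase _ (fun c => μ.real (E c)) (Finset.mem_univ (z.1 0)), add_sub_cancel_left,
    Finset.mul_sum, ← hN z]
  gcongr with c hc
  exact hterm c

/-- The invariant measures on the projective bundle for which the fibers are quasi-independent from
the future do not charge proper subspaces. -/
theorem measure_projSet_eq_zero {M L : SFT A → GLd d} (hA : IsTransitive A) (hμ : IsGibbs μ)
    (hL : Continuous L) (hirr : StronglyIrreducible M (trivHolonomy L) (trivHolonomy L))
    (hB : ∀ x, L (shift A x) * M x * (L x)⁻¹ = B (x.1 0) (x.1 1))
    (hN : ∀ x, N x = B (x.1 0) (x.1 1))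
    {ν : Measure (SFT A × Proj d)} [IsProbabilityMeasure ν] (hfst : ν.map Prod.fst = μ)
    (hν : MeasurePreserving (projFibered N) ν ν) {D : ENNReal} (hD : D ≠ ⊤)
    (hind : ∀ (Q : Set (Proj d)), MeasurableSet Q → ∀ (x : SFT A) (n : ℕ),
      ν (cylinder x (n + 1) ×ˢ Q) ≤ D * (μ (cylinder x (n + 1)) * ν (symbolSet A (x.1 0) ×ˢ Q)))
    (a₀ : Fin m) {W₀ : Submodule ℝ (Vec d)} (hW₀ : W₀ ≠ ⊤) :
    ν (symbolSet A a₀ ×ˢ projSet W₀) = 0 := by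
  classical
  have := hμ.isProbabilityMeasure
  obtain ⟨D', hD', hqb⟩ := hμ.exists_quasiBernoulli
  have hpos : ∀ x n, 0 < μ.real (cylinder x n) := fun x n => (hqb n 0 x).1
  by_contra hne
  have hex : ∃ k, ∃ (a : Fin m) (W : Submodule ℝ (Vec d)), Module.finrank ℝ W = k ∧
      ν (symbolSet A a ×ˢ projSet W) ≠ 0 := ⟨_, a₀, W₀, rfl, hne⟩
  set k := Nat.find hex with hkdef
  have hmin : ∀ (a : Fin m) (W : Submodule ℝ (Vec d)), Module.finrank ℝ W < k →
      ν (symbolSet A a ×ˢ projSet W) = 0 := fun a W h => by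
    by_contra h'
    exact Nat.find_min hex h ⟨a, W, rfl, h'⟩
  have hkd : k < d := by
    have h1 : k ≤ Module.finrank ℝ W₀ := Nat.find_min' hex ⟨a₀, W₀, rfl, hne⟩
    have h2 := Submodule.finrank_lt hW₀
    rw [finrank_euclideanSpace_fin] at h2
    omega
  obtain ⟨a₁, W₁, hW₁, hne₁⟩ := Nat.find_spec hex
  have hk0 : 0 < k := by
    rw [Nat.pos_iff_ne_zero]
    intro h0
    rw [← hkdef, h0, Submodule.finrank_eq_zero] at hW₁
    rw [hW₁, projSet_bot, Set.prod_empty, measure_empty] at hne₁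
    exact hne₁ rfl
  -- the supremum of the conditional masses
  set 𝒬 : Set ℝ := {q | ∃ (x : SFT A) (n : ℕ) (W : Submodule ℝ (Vec d)),
    Module.finrank ℝ W = k ∧ q = cylMass μ ν x n W} with h𝒬
  have hbdd : BddAbove 𝒬 := by
    refine ⟨1, ?_⟩
    rintro q ⟨x, n, W, -, rfl⟩
    rw [cylMass, div_le_one (hpos _ _), ← hfst, map_measureReal_apply measurable_fst
      (measurableSet_cylinder _ _)]
    exact measureReal_mono fun q hq => hq.1
  set H := sSup 𝒬 with hHdef
  have hH : ∀ (x : SFT A) n (W : Submodule ℝ (Vec d)), Module.finrank ℝ W = k →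
      cylMass μ ν x n W ≤ H := fun x n W hW => le_csSup hbdd ⟨x, n, W, hW, rfl⟩
  have hne𝒬 : ∃ x : SFT A, x.1 0 = a₁ := by
    by_contra! h
    have : symbolSet A a₁ = ∅ := by
      ext x; exact iff_of_false (h x) (Set.notMem_empty x)
    rw [this, Set.empty_prod, measure_empty] at hne₁
    exact hne₁ rfl
  obtain ⟨x₁, hx₁⟩ := hne𝒬
  have hH0 : 0 < H := by
    refine lt_of_lt_of_le ?_ (hH x₁ 0 W₁ hW₁)
    refine div_pos ?_ (hpos _ _)
    rw [cylinder_one, hx₁]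
    exact ENNReal.toReal_pos hne₁ (measure_ne_top _ _)
  have hclose : ∀ δ, 0 < δ → ∃ (x : SFT A) (n : ℕ) (W : Submodule ℝ (Vec d)),
      Module.finrank ℝ W = k ∧ H - δ < cylMass μ ν x n W := fun δ hδ => by
    obtain ⟨q, ⟨x, n, W, hW, rfl⟩, hq⟩ := exists_lt_of_lt_csSup
      (⟨_, x₁, 0, W₁, hW₁, rfl⟩ : 𝒬.Nonempty) (sub_lt_self H hδ)
    exact ⟨x, n, W, hW, hq⟩
  -- the subspaces of nearly maximal conditional mass form a finite set
  have hle : ∀ x n (W : Submodule ℝ (Vec d)), cylMass μ ν x n W ≤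
      D.toReal * ν.real (symbolSet A (x.1 0) ×ˢ projSet W) := fun x n W => by
    rw [cylMass, div_le_iff₀ (hpos _ _)]
    have h1 := ENNReal.toReal_mono (ENNReal.mul_ne_top hD (ENNReal.mul_ne_top (measure_ne_top _ _)
      (measure_ne_top _ _))) (hind (projSet W) (measurableSet_projSet W) x n)
    rw [ENNReal.toReal_mul, ENNReal.toReal_mul] at h1
    calc _ ≤ _ := h1
      _ = _ := by simp only [Measure.real]; ring
  -- A conditional mass above `H / 2` forces a mass bounded below over the whole symbol, by
  -- quasi-independence. Adding `1` to the constant keeps the denominator positive.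
  have hFfin : ∀ a, {W : Submodule ℝ (Vec d) | Module.finrank ℝ W = k ∧
      ∃ (x : SFT A) (n : ℕ), x.1 0 = a ∧ H / 2 < cylMass μ ν x n W}.Finite := fun a => by
    refine (finite_setOf_le_measure_projSet hmin a
      (c := H / 2 / (D.toReal + 1)) (by positivity)).subset ?_
    rintro W ⟨hW, x, n, rfl, hq⟩
    refine ⟨hW, ?_⟩
    rw [div_le_iff₀ (by positivity)]
    have := hle x n W
    have h2 : 0 ≤ ν.real (symbolSet A (x.1 0) ×ˢ projSet W) := measureReal_nonneg
    nlinarith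
  -- The supremum ranges over infinitely many cylinders and may not be attained. The family collects
  -- the subspaces whose conditional masses approach it over cylinders starting with `a`.
  set U : Fin m → Set (Submodule ℝ (Vec d)) := fun a => {W | Module.finrank ℝ W = k ∧
    ∀ δ, 0 < δ → ∃ (x : SFT A) (n : ℕ), x.1 0 = a ∧ H - δ < cylMass μ ν x n W} with hU
  have hUfin : ∀ a, (U a).Finite := fun a => (hFfin a).subset fun W hW => by
    obtain ⟨x, n, hx, hq⟩ := hW.2 (H / 2) (half_pos hH0)
    exact ⟨hW.1, x, n, hx, by linarith⟩
  -- Pigeonhole: along a maximizing sequence the pairs of initial symbol and subspace take finitely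
  -- many values, so one of them recurs infinitely often.
  have hUne : ∃ a, (U a).Nonempty := by
    have h1 : ∀ j : ℕ, ∃ (x : SFT A) (n : ℕ) (W : Submodule ℝ (Vec d)),
        Module.finrank ℝ W = k ∧ H - H / 2 * (1 / (j + 1)) < cylMass μ ν x n W :=
      fun j => hclose _ (by positivity)
    choose x n W hW hq using h1
    have h2 : ∀ j, W j ∈ ⋃ a, {W : Submodule ℝ (Vec d) | Module.finrank ℝ W = k ∧
        ∃ (x : SFT A) (n : ℕ), x.1 0 = a ∧ H / 2 < cylMass μ ν x n W} := fun j => by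
      refine Set.mem_iUnion.2 ⟨(x j).1 0, hW j, x j, n j, rfl, lt_of_le_of_lt ?_ (hq j)⟩
      have : (1 : ℝ) / (j + 1) ≤ 1 := by
        rw [div_le_one (by positivity)]
        linarith [Nat.cast_nonneg (α := ℝ) j]
      nlinarith
    have hfin := Set.finite_iUnion hFfin
    have : Finite (⋃ a, {W : Submodule ℝ (Vec d) | Module.finrank ℝ W = k ∧
        ∃ (x : SFT A) (n : ℕ), x.1 0 = a ∧ H / 2 < cylMass μ ν x n W}) := hfin
    obtain ⟨⟨a, V⟩, haV⟩ := Finite.exists_infinite_fiber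
      (fun j : ℕ => ((x j).1 0, (⟨W j, h2 j⟩ : ⋃ a, {W : Submodule ℝ (Vec d) |
        Module.finrank ℝ W = k ∧ ∃ (x : SFT A) (n : ℕ), x.1 0 = a ∧ H / 2 < cylMass μ ν x n W})))
    rw [Set.infinite_coe_iff] at haV
    have hfib : ∀ j, ((x j).1 0, (⟨W j, h2 j⟩ : ⋃ a, {W : Submodule ℝ (Vec d) |
        Module.finrank ℝ W = k ∧ ∃ (x : SFT A) (n : ℕ), x.1 0 = a ∧ H / 2 < cylMass μ ν x n W})) =
        (a, V) → (x j).1 0 = a ∧ W j = V.1 := fun j hj => by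
      have h3 := congrArg Prod.fst hj
      have h4 := congrArg (fun p => p.2.1) hj
      exact ⟨h3, h4⟩
    refine ⟨a, V.1, ?_, fun δ hδ => ?_⟩
    · obtain ⟨j, hj⟩ := haV.nonempty
      rw [← (hfib j hj).2]; exact hW j
    · obtain ⟨j₀, hj₀⟩ := exists_nat_one_div_lt (show 0 < δ / H by positivity)
      obtain ⟨j, hj, hjj⟩ := haV.exists_gt j₀
      refine ⟨x j, n j, (hfib j hj).1, ?_⟩
      rw [← (hfib j hj).2]
      refine lt_of_le_of_lt ?_ (hq j)
      have h5 : (1 : ℝ) / (j + 1) ≤ 1 / (j₀ + 1) := by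
        have : (j₀ : ℝ) ≤ j := by exact_mod_cast hjj.le
        gcongr
      rw [lt_div_iff₀ hH0] at hj₀
      have h6 := mul_le_mul_of_nonneg_right h5 hH0.le
      linarith
  -- the maximum principle
  have hUstep : ∀ y : SFT A, ∀ W ∈ U (y.1 1), mapSubspace (N y)⁻¹ W ∈ U (y.1 0) := by
    rintro y W ⟨hW, hWδ⟩
    refine ⟨by rw [finrank_mapSubspace, hW], fun δ hδ => ?_⟩
    -- The chosen branch has at least the proportion `1 / D'` of the mass, and the others do not
    -- exceed `H`; a total defect below `δ / D'` forces a defect below `δ` on the branch.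
    obtain ⟨x, n, hx, hq⟩ := hWδ (δ / D') (by positivity)
    -- Gluing the past of `shift A y` to the future of `x` stays in the cylinder of `x` and has the
    -- preimage symbol `y_0`, so that `N` takes the same value at `z` and at `y`.
    set w := bracket (shift A y, x)
    have h0 : (shift A y).1 0 = x.1 0 := by rw [hx]; rfl
    have hwx : w ∈ cylinder x (n + 1) := fun i hi _ => bracket_apply_of_nonneg h0 hi
    set z := (shift A).symm w
    have hzw : shift A z = w := (shift A).apply_symm_apply w
    have hz0 : z.1 0 = y.1 0 := by
      have : z.1 0 = w.1 (-1) := rfl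
      rw [this, bracket_apply_of_nonpos _ (by norm_num)]
      rfl
    have hz1 : z.1 1 = y.1 1 := by
      have : z.1 1 = w.1 0 := rfl
      rw [this, bracket_apply_of_nonpos _ le_rfl]
      rfl
    have hNz : N z = N y := by rw [hN, hN, hz0, hz1]
    have hstep := cylMass_le_of_preimage hμ hN hν hH z n hW
    have hqw : cylMass μ ν (shift A z) n W = cylMass μ ν x n W := by
      rw [hzw, cylMass, cylMass, cylinder_congr hwx]
    rw [hqw, hNz] at hstep
    refine ⟨z, n + 1, hz0, ?_⟩
    have hDz := (hqb (n + 1) 0 z).2.2.2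
    have hw0 := hpos (shift A z) (n + 1)
    have hz0 := hpos z (n + 1 + 1)
    set qz := cylMass μ ν z (n + 1) (mapSubspace (N y)⁻¹ W)
    have h1 : (H - δ / D') * μ.real (cylinder (shift A z) (n + 1)) <
        cylMass μ ν x n W * μ.real (cylinder (shift A z) (n + 1)) :=
      mul_lt_mul_of_pos_right hq hw0
    have h2 : δ / D' * μ.real (cylinder (shift A z) (n + 1)) ≤
        δ * μ.real (cylinder z (n + 1 + 1)) := by
      calc _ ≤ δ / D' * (D' * μ.real (cylinder z (n + 1 + 1))) := by gcongr
        _ = _ := by field_simp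
    have h3 : (H - δ) * μ.real (cylinder z (n + 1 + 1)) < qz * μ.real (cylinder z (n + 1 + 1)) := by
      linarith
    exact lt_of_mul_lt_mul_right h3 hz0.le
  have hsub : ∀ y : SFT A, mapSubspace (N y)⁻¹ '' U (y.1 1) ⊆ U (y.1 0) := by
    rintro y _ ⟨W, hW, rfl⟩
    exact hUstep y W hW
  have hcard1 : ∀ y : SFT A, (U (y.1 1)).ncard ≤ (U (y.1 0)).ncard := fun y => by
    rw [← Set.ncard_image_of_injective _ (mapSubspace_injective (N y)⁻¹)]
    exact Set.ncard_le_ncard (hsub y) (hUfin _)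
  have hcardn : ∀ (n : ℕ) (y : SFT A), (U (y.1 n)).ncard ≤ (U (y.1 0)).ncard := by
    intro n
    induction n with
    | zero => intro y; exact le_rfl
    | succ n ih =>
      intro y
      refine le_trans ?_ (ih y)
      have := hcard1 ((shift A)^[n] y)
      rw [shift_iterate_apply, shift_iterate_apply, zero_add, add_comm (1 : ℤ)] at this
      exact_mod_cast this
  -- Cardinalities do not increase along orbits, and transitivity joins any symbol to any other.
  -- They are therefore constant, and the inclusions `hsub` become equalities.
  have hcardle : ∀ x y : SFT A, (U (y.1 0)).ncard ≤ (U (x.1 0)).ncard := by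
    intro x y
    have hopen : ∀ a, IsOpen (symbolSet A a) := fun a =>
      (isOpen_discrete {a}).preimage (continuous_coord 0)
    obtain ⟨n, w, ⟨u, hu, rfl⟩, hw⟩ := hA (symbolSet A (x.1 0)) (symbolSet A (y.1 0)) (hopen _)
      ⟨x, rfl⟩ (hopen _) ⟨y, rfl⟩
    have h1 : u.1 0 = x.1 0 := hu
    have h2 : ((shift A)^[n] u).1 0 = y.1 0 := hw
    rw [shift_iterate_apply, zero_add] at h2
    rw [← h1, ← h2]
    exact hcardn n u
  obtain ⟨a, W, hWa⟩ := hUne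
  obtain ⟨xa, -, hxa, -⟩ := hWa.2 1 one_pos
  refine hirr.false_of_family hL hk0 hkd (n := (U a).ncard)
    ((Set.ncard_pos (hUfin a)).2 ⟨W, hWa⟩) U hUfin (fun a W hW => hW.1) (fun x => ?_) fun x => ?_
  · rw [← hxa]
    exact le_antisymm (hcardle _ _) (hcardle _ _)
  · rw [hB, ← hN]
    have heq : mapSubspace (N x)⁻¹ '' U (x.1 1) = U (x.1 0) := by
      refine Set.eq_of_subset_of_ncard_le (hsub x) ?_ (hUfin _)
      rw [Set.ncard_image_of_injective _ (mapSubspace_injective (N x)⁻¹)]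
      exact hcardle (shift A x) x
    rw [← heq, ← Set.image_comp]
    refine (Set.image_congr fun W _ => ?_).trans (Set.image_id _)
    exact mapSubspace_mapSubspace_inv _ _

end NoMass

/-! ### Growth rates along invariant `u`-states -/

section Uniqueness

variable {m d : ℕ} {A : Fin m → Fin m → Prop} {μ : Measure (SFT A)}
  {N : SFT A → GLd d} {B : Fin m → Fin m → GLd d}

/-- The lines which make a small angle with the hyperplane orthogonal to `r`. -/
def nearHyperplane (r : Vec d) (δ : ℝ) : Set (Proj d) := {p | |inner ℝ r p.rep| ≤ δ * ‖p.rep‖}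

lemma mk_mem_nearHyperplane {r v : Vec d} {δ : ℝ} (hv : v ≠ 0) :
    Projectivization.mk ℝ v hv ∈ nearHyperplane r δ ↔ |inner ℝ r v| ≤ δ * ‖v‖ := by
  obtain ⟨c, hc⟩ := Projectivization.exists_smul_eq_mk_rep ℝ v hv
  show |inner ℝ r (Projectivization.mk ℝ v hv).rep| ≤ δ * ‖(Projectivization.mk ℝ v hv).rep‖ ↔ _
  have hc0 : 0 < |(c : ℝ)| := abs_pos.2 c.ne_zero
  rw [← hc, Units.smul_def, real_inner_smul_right, norm_smul, abs_mul, Real.norm_eq_abs,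
    mul_left_comm, mul_le_mul_iff_right₀ hc0]

lemma measurableSet_nearHyperplane (r : Vec d) (δ : ℝ) : MeasurableSet (nearHyperplane r δ) := by
  refine IsClosed.measurableSet ?_
  rw [← isOpenQuotientMap_mk'.isQuotientMap.isClosed_preimage]
  have : Projectivization.mk' ℝ ⁻¹' nearHyperplane r δ =
      {v : {v : Vec d // v ≠ 0} | |inner ℝ r v.1| ≤ δ * ‖v.1‖} := by
    ext v; exact mk_mem_nearHyperplane v.2
  rw [this]
  refine isClosed_le ?_ ?_ <;> fun_prop

lemma nearHyperplane_subset {r r' : Vec d} {δ δ' : ℝ} (h : δ' + ‖r' - r‖ ≤ δ) :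
    nearHyperplane r' δ' ⊆ nearHyperplane r δ := by
  intro p hp
  have h1 : |inner ℝ r' p.rep| ≤ δ' * ‖p.rep‖ := hp
  have h2 : inner ℝ r p.rep = inner ℝ r' p.rep - inner ℝ (r' - r) p.rep := by
    rw [inner_sub_left]; ring
  have h3 := abs_real_inner_le_norm (r' - r) p.rep
  have h4 := abs_sub (inner ℝ r' p.rep) (inner ℝ (r' - r) p.rep)
  show |inner ℝ r p.rep| ≤ δ * ‖p.rep‖
  rw [h2]
  have h5 := mul_le_mul_of_nonneg_right h (norm_nonneg p.rep)
  rw [add_mul] at h5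
  linarith

/-- If hyperplanes are not charged, then thin neighborhoods of hyperplanes have uniformly small
mass. -/
lemma exists_measure_nearHyperplane_le {ν : Measure (SFT A × Proj d)} [IsProbabilityMeasure ν]
    (hzero : ∀ (a : Fin m) (W : Submodule ℝ (Vec d)), W ≠ ⊤ →
      ν (symbolSet A a ×ˢ projSet W) = 0) (a : Fin m) {η : ENNReal} (hη : 0 < η) :
    ∃ δ : ℝ, 0 < δ ∧ ∀ r : Vec d, ‖r‖ = 1 → ν (symbolSet A a ×ˢ nearHyperplane r δ) ≤ η := by
  have hcomp : IsCompact (Metric.sphere (0 : Vec d) 1) := isCompact_sphere 0 1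
  suffices h : ∃ δ : ℝ, 0 < δ ∧ ∀ r ∈ Metric.sphere (0 : Vec d) 1,
      ν (symbolSet A a ×ˢ nearHyperplane r δ) ≤ η by
    obtain ⟨δ, hδ, h⟩ := h
    exact ⟨δ, hδ, fun r hr => h r (mem_sphere_zero_iff_norm.2 hr)⟩
  -- Compactness of the sphere makes the choice of `δ` uniform in `r`. For a single `r`, the
  -- neighborhoods decrease to the lines in the hyperplane orthogonal to `r`, which are not charged.
  refine hcomp.induction_on (p := fun s => ∃ δ : ℝ, 0 < δ ∧ ∀ r ∈ s,
      ν (symbolSet A a ×ˢ nearHyperplane r δ) ≤ η) ⟨1, one_pos, fun r hr => absurd hr (by simp)⟩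
    (fun s t hst ⟨δ, hδ, h⟩ => ⟨δ, hδ, fun r hr => h r (hst hr)⟩) ?_ ?_
  · rintro s t ⟨δ, hδ, h⟩ ⟨δ', hδ', h'⟩
    have hsub : ∀ (r : Vec d) (ε ε' : ℝ), ε ≤ ε' →
        symbolSet A a ×ˢ nearHyperplane r ε ⊆ symbolSet A a ×ˢ nearHyperplane r ε' :=
      fun r ε ε' hε => Set.prod_mono le_rfl (nearHyperplane_subset (by simpa using hε))
    refine ⟨min δ δ', lt_min hδ hδ', fun r hr => ?_⟩
    rcases hr with hr | hr
    · exact (measure_mono (hsub r _ _ (min_le_left _ _))).trans (h r hr)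
    · exact (measure_mono (hsub r _ _ (min_le_right _ _))).trans (h' r hr)
  · intro r hr
    have hr1 : ‖r‖ = 1 := mem_sphere_zero_iff_norm.1 hr
    set W : Submodule ℝ (Vec d) := (Submodule.span ℝ {r})ᗮ
    have hW : W ≠ ⊤ := fun h => by
      have h1 : r ∈ W := h ▸ Submodule.mem_top
      have h2 := Submodule.mem_orthogonal_singleton_iff_inner_right.1 h1
      rw [real_inner_self_eq_norm_sq, hr1] at h2
      norm_num at h2
    have hanti : Antitone fun k : ℕ => symbolSet A a ×ˢ nearHyperplane r (1 / (k + 1)) :=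
      fun k k' hk => Set.prod_mono le_rfl (nearHyperplane_subset (by
        have : (k : ℝ) ≤ k' := by exact_mod_cast hk
        rw [sub_self, norm_zero, add_zero]
        gcongr))
    have hinter : (⋂ k : ℕ, symbolSet A a ×ˢ nearHyperplane r (1 / (k + 1))) ⊆
        symbolSet A a ×ˢ projSet W := by
      intro q hq
      rw [Set.mem_iInter] at hq
      refine ⟨(hq 0).1, ?_⟩
      show q.2.rep ∈ W
      rw [Submodule.mem_orthogonal_singleton_iff_inner_right, ← abs_eq_zero]
      refine le_antisymm ?_ (abs_nonneg _)
      have hlim : Tendsto (fun k : ℕ => 1 / ((k : ℝ) + 1) * ‖q.2.rep‖) atTop (𝓝 0) := by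
        simpa using tendsto_one_div_add_atTop_nhds_zero_nat.mul_const ‖q.2.rep‖
      exact ge_of_tendsto' hlim fun k => (hq k).2
    have hlim := tendsto_measure_iInter_atTop (μ := ν) (fun k =>
      ((measurableSet_symbolSet a).prod (measurableSet_nearHyperplane r _)).nullMeasurableSet)
      hanti ⟨0, measure_ne_top _ _⟩
    rw [measure_mono_null hinter (hzero a W hW)] at hlim
    obtain ⟨k, hk⟩ := (hlim.eventually (gt_mem_nhds hη)).exists
    set δ : ℝ := 1 / (k + 1)
    have hδ : 0 < δ := by positivity
    -- Half of the width is kept in reserve for moving `r` by less than `δ / 2`.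
    refine ⟨_, mem_nhdsWithin_of_mem_nhds (Metric.ball_mem_nhds r (half_pos hδ)), δ / 2,
      half_pos hδ, fun r' hr' => le_trans (measure_mono (Set.prod_mono le_rfl
        (nearHyperplane_subset ?_))) hk.le⟩
    rw [Metric.mem_ball, dist_eq_norm] at hr'
    linarith

/-- The iterate `N^n` reads the `n + 1` symbols `x_0, …, x_n`, because one step reads two symbols.
-/
lemma iterNat_congr (hN : ∀ x, N x = B (x.1 0) (x.1 1)) (n : ℕ) {x y : SFT A}
    (h : ∀ i : ℤ, 0 ≤ i → i ≤ n → x.1 i = y.1 i) : iterNat N n x = iterNat N n y := by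
  induction n with
  | zero => rfl
  | succ n ih =>
    rw [iterNat_succ_eq, iterNat_succ_eq, ih fun i h0 h1 => h i h0 (by push_cast; omega), hN, hN]
    simp only [shift_iterate_apply]
    rw [h (0 + n) (by omega) (by push_cast; omega), h (1 + n) (by omega) (by push_cast; omega)]

/-- A bound for the mass of a family of sets of lines which depends on the symbols `x_0, …, x_n`. -/
lemma measure_family_le [IsProbabilityMeasure μ] {ν : Measure (SFT A × Proj d)} {D η : ENNReal}
    (hind : ∀ (Q : Set (Proj d)), MeasurableSet Q → ∀ (x : SFT A) (n : ℕ),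
      ν (cylinder x (n + 1) ×ˢ Q) ≤ D * (μ (cylinder x (n + 1)) * ν (symbolSet A (x.1 0) ×ˢ Q)))
    (n : ℕ) (Q : SFT A → Set (Proj d)) (hQm : ∀ x, MeasurableSet (Q x))
    (hQ : ∀ x, ∀ y ∈ cylinder x (n + 1), Q y = Q x)
    (hη : ∀ x, ν (symbolSet A (x.1 0) ×ˢ Q x) ≤ η) :
    ν {q | q.2 ∈ Q q.1} ≤ D * η := by
  classical
  set r : SFT A → (Fin (n + 1) → Fin m) := fun x i => x.1 i
  have hfib : ∀ x, r ⁻¹' {r x} = cylinder x (n + 1) := by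
    intro x
    ext y
    simp only [Set.mem_preimage, Set.mem_singleton_iff, funext_iff, r]
    constructor
    · intro hy i h1 h2
      have := hy ⟨i.toNat, by omega⟩
      simpa [Int.toNat_of_nonneg h1] using this
    · exact fun hy i => hy i (by omega) (by have := i.2; omega)
  have hsub : {q : SFT A × Proj d | q.2 ∈ Q q.1} ⊆
      ⋃ s : Fin (n + 1) → Fin m, {q | r q.1 = s ∧ q.2 ∈ Q q.1} := fun q hq =>
    Set.mem_iUnion.2 ⟨r q.1, rfl, hq⟩
  have hterm : ∀ s, ν {q | r q.1 = s ∧ q.2 ∈ Q q.1} ≤ D * η * μ (r ⁻¹' {s}) := by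
    intro s
    by_cases hs : ∃ x, r x = s
    · obtain ⟨x, rfl⟩ := hs
      have h1 : {q : SFT A × Proj d | r q.1 = r x ∧ q.2 ∈ Q q.1} ⊆ cylinder x (n + 1) ×ˢ Q x := by
        rintro q ⟨h1, h2⟩
        have h3 : q.1 ∈ cylinder x (n + 1) := by rw [← hfib]; exact h1
        exact ⟨h3, by rw [← hQ x q.1 h3]; exact h2⟩
      rw [hfib]
      refine (measure_mono h1).trans ((hind _ (hQm x) x n).trans ?_)
      calc _ ≤ D * (μ (cylinder x (n + 1)) * η) := by gcongr; exact hη x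
        _ = _ := by ring
    · have : {q : SFT A × Proj d | r q.1 = s ∧ q.2 ∈ Q q.1} = ∅ := by
        ext q
        exact iff_of_false (fun h => hs ⟨q.1, h.1⟩) (Set.notMem_empty q)
      rw [this, measure_empty]
      exact zero_le
  have hmeas : ∀ s, MeasurableSet (r ⁻¹' {s}) := by
    intro s
    by_cases hs : ∃ x, r x = s
    · obtain ⟨x, rfl⟩ := hs
      rw [hfib]; exact measurableSet_cylinder x _
    · have : r ⁻¹' {s} = ∅ := by
        ext y; exact iff_of_false (fun hy => hs ⟨y, hy⟩) (Set.notMem_empty y)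
      rw [this]; exact MeasurableSet.empty
  calc ν {q | q.2 ∈ Q q.1} ≤ ∑ s, ν {q | r q.1 = s ∧ q.2 ∈ Q q.1} :=
        (measure_mono hsub).trans (measure_iUnion_fintype_le _ _)
    _ ≤ ∑ s, D * η * μ (r ⁻¹' {s}) := Finset.sum_le_sum fun s _ => hterm s
    _ = D * η := by
      rw [← Finset.mul_sum, sum_measure_preimage_singleton _ fun s _ => hmeas s]
      simp

/-- The lines selected by a measure which is quasi-independent from the future and does not charge
proper subspaces grow in mean at the top rate. -/
theorem tendsto_integral_logExp [NeZero d] [IsProbabilityMeasure μ] {ν : Measure (SFT A × Proj d)}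
    [IsProbabilityMeasure ν] (hN : ∀ x, N x = B (x.1 0) (x.1 1)) (hNl : IsLocallyConstant N)
    (hfst : ν.map Prod.fst = μ) {D : ENNReal} (hD : D ≠ ⊤)
    (hind : ∀ (Q : Set (Proj d)), MeasurableSet Q → ∀ (x : SFT A) (n : ℕ),
      ν (cylinder x (n + 1) ×ˢ Q) ≤ D * (μ (cylinder x (n + 1)) * ν (symbolSet A (x.1 0) ×ˢ Q)))
    (hzero : ∀ (a : Fin m) (W : Submodule ℝ (Vec d)), W ≠ ⊤ →
      ν (symbolSet A a ×ˢ projSet W) = 0) {l : ℝ}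
    (hnorm : ∀ᵐ x ∂μ, Tendsto (fun n : ℕ => Real.log ‖(iterNat N n x).1‖ / n) atTop (𝓝 l)) :
    Tendsto (fun n : ℕ => ∫ q, |logExp (iterNat N n q.1) q.2 / n - l| ∂ν) atTop (𝓝 0) := by
  obtain ⟨K, hK1, hK⟩ := exists_bound_units hNl.continuous
  have hb : ∀ q, |logExpFibered N q| ≤ Real.log K := fun q => abs_logExp_le _ (hK _).1 (hK _).2 _
  have hmS : ∀ n : ℕ, Measurable fun q : SFT A × Proj d => logExp (iterNat N n q.1) q.2 / n :=
    fun n => ((continuous_logExp_prod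
      (isLocallyConstant_iterNat hNl n).continuous).measurable).div_const _
  refine tendsto_integral_abs_sub hmS (K := Real.log K) (fun n q => ?_) fun ε hε => ?_
  · rw [← birkhoffSum_logExpFibered]
    exact abs_birkhoffSum_div_le hb n q
  have hr : ∀ g : GLd d, ∃ r : Vec d, ‖r‖ = 1 ∧ ∀ v, ‖g.1‖ * |inner ℝ r v| ≤ ‖g.1 v‖ := fun g => by
    have := exists_top_singular_vector g.1
    rwa [singularValues_zero_eq_norm] at this
  choose r hr1 hr2 using hr
  set G : ℕ → Set (SFT A) := fun n => {x | ε / 2 < |Real.log ‖(iterNat N n x).1‖ / n - l|}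
  have hGm : ∀ n, MeasurableSet (G n) := fun n =>
    (isLocallyConstant_iterNat hNl n {g | ε / 2 < |Real.log ‖g.1‖ / n - l|}).measurableSet
  have hG : Tendsto (fun n => μ (G n)) atTop (𝓝 0) := by
    refine tendsto_measure_zero_of_ae_eventually hGm ?_
    filter_upwards [hnorm] with x hx
    filter_upwards [Metric.tendsto_nhds.1 hx (ε / 2) (half_pos hε)] with n hn hxn
    rw [Real.dist_eq] at hn
    exact absurd hn (not_lt.2 (le_of_lt hxn))
  -- Expansion never exceeds the norm, so off `G n` a deviation by `ε` must be downward. The line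
  -- then loses a factor `exp (-(n * (ε / 2)))` against the norm, which makes it nearly orthogonal
  -- to the top right singular vector.
  have hkey : ∀ n : ℕ, 0 < n → {q : SFT A × Proj d | ε < |logExp (iterNat N n q.1) q.2 / n - l|} ⊆
      Prod.fst ⁻¹' G n ∪ {q | q.2 ∈ nearHyperplane (r (iterNat N n q.1))
        (Real.exp (-(n * (ε / 2))))} := by
    rintro n hn ⟨x, p⟩ hq
    have hn' : (0 : ℝ) < n := by exact_mod_cast hn
    by_cases hx : x ∈ G n
    · exact Or.inl hx
    right
    have hx' : |Real.log ‖(iterNat N n x).1‖ / n - l| ≤ ε / 2 := not_lt.1 hx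
    have hq' : ε < |logExp (iterNat N n x) p / n - l| := hq
    have hle : logExp (iterNat N n x) p / n ≤ Real.log ‖(iterNat N n x).1‖ / n :=
      div_le_div_of_nonneg_right (logExp_le _ le_rfl _) hn'.le
    have h1 : logExp (iterNat N n x) p / n < Real.log ‖(iterNat N n x).1‖ / n - ε / 2 := by
      rw [abs_le] at hx'
      rcases lt_abs.1 hq' with h | h <;> linarith
    rw [div_lt_iff₀ hn', sub_mul, div_mul_cancel₀ _ hn'.ne'] at h1
    have hp := norm_pos_iff.2 p.rep_nonzero
    have hgp := norm_apply_pos (iterNat N n x) p.rep_nonzero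
    have hg : 0 < ‖(iterNat N n x).1‖ := by
      have := (iterNat N n x).1.le_opNorm p.rep
      by_contra h
      have h0 : ‖(iterNat N n x).1‖ = 0 := le_antisymm (not_lt.1 h) (norm_nonneg _)
      rw [h0, zero_mul] at this
      linarith
    have h2 : ‖(iterNat N n x).1 p.rep‖ / ‖p.rep‖ <
        ‖(iterNat N n x).1‖ * Real.exp (-(n * (ε / 2))) := by
      rw [← Real.log_lt_log_iff (div_pos hgp hp) (by positivity), Real.log_mul hg.ne'
        (Real.exp_pos _).ne', Real.log_exp]
      have : Real.log (‖(iterNat N n x).1 p.rep‖ / ‖p.rep‖) = logExp (iterNat N n x) p := rfl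
      linarith
    rw [div_lt_iff₀ hp, mul_assoc] at h2
    show |inner ℝ (r (iterNat N n x)) p.rep| ≤ Real.exp (-(n * (ε / 2))) * ‖p.rep‖
    exact le_of_mul_le_mul_left ((hr2 (iterNat N n x) p.rep).trans h2.le) hg
  -- The hyperplane varies with `x`, but only through the future symbols `x_0, …, x_n`;
  -- quasi-independence reduces to fixed hyperplanes, for which the estimate is uniform.
  have hnear : Tendsto (fun n : ℕ => ν {q | q.2 ∈ nearHyperplane (r (iterNat N n q.1))
      (Real.exp (-(n * (ε / 2))))}) atTop (𝓝 0) := by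
    have hη : ∀ η : ENNReal, 0 < η → ∀ᶠ n : ℕ in atTop,
        ν {q | q.2 ∈ nearHyperplane (r (iterNat N n q.1)) (Real.exp (-(n * (ε / 2))))} ≤ D * η := by
      intro η hη
      choose δ hδ hδν using fun a => exists_measure_nearHyperplane_le hzero a hη
      have hexp : Tendsto (fun n : ℕ => Real.exp (-(n * (ε / 2)))) atTop (𝓝 0) := by
        refine Real.tendsto_exp_neg_atTop_nhds_zero.comp ?_
        exact tendsto_natCast_atTop_atTop.atTop_mul_const (half_pos hε)
      have hev : ∀ᶠ n : ℕ in atTop, ∀ a, Real.exp (-(n * (ε / 2))) < δ a :=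
        eventually_all.2 fun a => hexp.eventually (gt_mem_nhds (hδ a))
      filter_upwards [hev] with n hn
      have hQ : ∀ x : SFT A, ∀ y ∈ cylinder x (n + 1),
          nearHyperplane (r (iterNat N n y)) (Real.exp (-(n * (ε / 2)))) =
            nearHyperplane (r (iterNat N n x)) (Real.exp (-(n * (ε / 2)))) := fun x y hy => by
        rw [iterNat_congr hN n (x := y) (y := x) fun i h0 h1 => hy i h0 (by push_cast; omega)]
      have hQη : ∀ x : SFT A, ν (symbolSet A (x.1 0) ×ˢ
          nearHyperplane (r (iterNat N n x)) (Real.exp (-(n * (ε / 2))))) ≤ η := fun x => by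
        refine (measure_mono (Set.prod_mono le_rfl (nearHyperplane_subset ?_))).trans
          (hδν (x.1 0) (r (iterNat N n x)) (hr1 _))
        rw [sub_self, norm_zero, add_zero]
        exact (hn _).le
      exact measure_family_le hind n
        (fun x => nearHyperplane (r (iterNat N n x)) (Real.exp (-(n * (ε / 2)))))
        (fun x => measurableSet_nearHyperplane _ _) hQ hQη
    rw [ENNReal.tendsto_nhds_zero]
    intro η hη0
    have hη1 : 0 < η / (D + 1) := ENNReal.div_pos hη0.ne' (by finiteness)
    filter_upwards [hη _ hη1] with n hn
    refine hn.trans ?_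
    calc D * (η / (D + 1)) ≤ (D + 1) * (η / (D + 1)) := by gcongr; exact le_self_add
      _ ≤ η := ENNReal.mul_div_le
  have hsum := hG.add hnear
  rw [add_zero] at hsum
  refine tendsto_of_tendsto_of_tendsto_of_le_of_le' tendsto_const_nhds hsum
    (Eventually.of_forall fun _ => zero_le) ?_
  filter_upwards [eventually_gt_atTop 0] with n hn
  refine (measure_mono (hkey n hn)).trans ((measure_union_le _ _).trans ?_)
  gcongr
  rw [← hfst, Measure.map_apply measurable_fst (hGm n)]

end Uniqueness

/-! ### The trivialized cocycle -/

section Trivialization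

variable {m d : ℕ} {A : Fin m → Fin m → Prop} {μ : Measure (SFT A)}
  {M N L : SFT A → GLd d} {B : Fin m → Fin m → GLd d}

lemma isLocallyConstant_of_coord (hN : ∀ x, N x = B (x.1 0) (x.1 1)) : IsLocallyConstant N := by
  have h : Continuous fun x : SFT A => (x.1 0, x.1 1) :=
    (continuous_coord 0).prodMk (continuous_coord 1)
  have : N = (fun p : Fin m × Fin m => B p.1 p.2) ∘ fun x : SFT A => (x.1 0, x.1 1) := funext hN
  rw [this]
  exact ((IsLocallyConstant.iff_continuous _).2 h).comp _

lemma units_norm_pos [NeZero d] (g : GLd d) : 0 < ‖g.1‖ := by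
  obtain ⟨v, hv⟩ := exists_ne (0 : Vec d)
  refine norm_pos_iff.2 fun h => units_val_apply_ne_zero g hv ?_
  rw [h]; rfl

lemma units_norm_mul_mul_le {K : ℝ} (g h k : GLd d) (hg : ‖g.1‖ ≤ K) (hk : ‖k.1‖ ≤ K) :
    ‖(g * h * k).1‖ ≤ K * K * ‖h.1‖ := by
  have hK : 0 ≤ K := (norm_nonneg _).trans hg
  rw [Units.val_mul, Units.val_mul]
  calc _ ≤ ‖g.1‖ * ‖h.1‖ * ‖k.1‖ := (norm_mul_le _ _).trans (by gcongr; exact norm_mul_le _ _)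
    _ ≤ K * ‖h.1‖ * K := by gcongr
    _ = _ := by ring

/-- The top exponent in the trivialization. -/
lemma ae_tendsto_log_norm [NeZero d] {lam : Fin d → ℝ} (hlam : IsLyapunovSpectrum μ M lam)
    (hL : Continuous L) (hN : ∀ x, N x = L (shift A x) * M x * (L x)⁻¹) :
    ∀ᵐ x ∂μ, Tendsto (fun n : ℕ => Real.log ‖(iterNat N n x).1‖ / n) atTop (𝓝 (lam 0)) := by
  obtain ⟨K, hK1, hK⟩ := exists_bound_units hL
  filter_upwards [hlam] with x hx
  have h0 := hx 0
  have hIic : Finset.Iic (0 : Fin d) = {0} := by ext i; simp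
  rw [hIic, Finset.sum_singleton] at h0
  simp only [exteriorNorm_zero] at h0
  refine tendsto_log_div_of_comparable (K := K * K) (fun n => units_norm_pos _)
    (fun n => units_norm_pos _) (by positivity) (fun n => ?_) (fun n => ?_) h0
  · have e : iterNat M n x = (L ((shift A)^[n] x))⁻¹ * iterNat N n x * L x := by
      rw [iterNat_conj hN]; group
    rw [e]
    exact units_norm_mul_mul_le _ _ _ (hK _).2 (hK _).1
  · rw [iterNat_conj hN]
    exact units_norm_mul_mul_le _ _ _ (hK _).1 (hK _).2

lemma lt_exp_of_log_div_lt {a c : ℝ} {n : ℕ} (hn : 0 < n) (h : Real.log a / n < c) :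
    a ≤ Real.exp (n * c) := by
  rcases le_or_gt a 0 with ha | ha
  · exact ha.trans (Real.exp_pos _).le
  · have hn' : (0 : ℝ) < n := by exact_mod_cast hn
    rw [div_lt_iff₀ hn'] at h
    rw [← Real.log_le_iff_le_exp ha]
    linarith

lemma exteriorNorm_nonneg (i : Fin d) (g : GLd d) : 0 ≤ exteriorNorm i g :=
  Finset.prod_nonneg fun _ _ => LinearMap.singularValues_nonneg _ _

/-- The area growth in the trivialization is slower than the square of the top growth. -/
lemma exists_area_growth [NeZero d] {lam : Fin d → ℝ} (hlam : IsLyapunovSpectrum μ M lam)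
    (hsimple : ∀ j : Fin d, j ≠ 0 → lam j < lam 0)
    (hL : Continuous L) (hN : ∀ x, N x = L (shift A x) * M x * (L x)⁻¹) :
    ∃ γ : ℝ, γ < 2 * lam 0 ∧ ∀ᵐ x ∂μ, ∀ᶠ n : ℕ in atTop, ∀ u v : Vec d,
      gram ((iterNat N n x).1 u) ((iterNat N n x).1 v) ≤ Real.exp (2 * n * γ) * gram u v := by
  -- In dimension one there is no second exponent; all areas vanish and any rate below `2 * lam 0`
  -- serves.
  by_cases hd : d = 1
  · refine ⟨2 * lam 0 - 1, by linarith, ae_of_all _ fun x => Eventually.of_forall fun n u v => ?_⟩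
    rw [gram_eq_zero_of_subsingleton hd, gram_eq_zero_of_subsingleton hd, mul_zero]
  have hd1 : 1 < d := by have := NeZero.ne d; omega
  set i : Fin d := ⟨1, hd1⟩
  have hi : (i : ℕ) = 1 := rfl
  have hi0 : (0 : Fin d) ≠ i := fun h => by
    have := congrArg Fin.val h
    simp [hi] at this
  have hlt := hsimple i (Ne.symm hi0)
  set η := (lam 0 - lam i) / 4 with hη
  have hη0 : 0 < η := by rw [hη]; linarith
  obtain ⟨K, hK1, hK⟩ := exists_bound_units hL
  have hK0 : 0 < K := by linarith
  -- One `η` covers the convergence of the exterior norm, the other absorbs the factor `K ^ 8` from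
  -- the change of trivialization. By the choice of `η`, the sum is `2 * lam 0 - 2 * η`.
  refine ⟨lam 0 + lam i + 2 * η, by rw [hη]; linarith, ?_⟩
  have hexp : ∀ᶠ n : ℕ in atTop, K ^ 8 ≤ Real.exp (n * (2 * η)) := by
    have : Tendsto (fun n : ℕ => Real.exp (n * (2 * η))) atTop atTop :=
      Real.tendsto_exp_atTop.comp
        (tendsto_natCast_atTop_atTop.atTop_mul_const (by linarith))
    exact this.eventually_ge_atTop _
  filter_upwards [hlam] with x hx
  have h1 := hx i
  rw [Iic_one_eq i hi, Finset.sum_pair hi0] at h1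
  filter_upwards [hexp, eventually_gt_atTop 0, h1.eventually
    (gt_mem_nhds (show lam 0 + lam i < lam 0 + lam i + η by linarith))] with n hn hn0 hn1 u v
  have h2 := lt_exp_of_log_div_lt hn0 hn1
  have e : ∀ w, (iterNat N n x).1 w =
      (L ((shift A)^[n] x)).1 ((iterNat M n x).1 (((L x)⁻¹).1 w)) := fun w => by
    rw [iterNat_conj hN]; rfl
  have hpow : ∀ g : GLd d, ‖g.1‖ ≤ K → ∀ u v, gram (g.1 u) (g.1 v) ≤ K ^ 4 * gram u v :=
    fun g hg u v => (gram_map_le_norm g.1 u v).trans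
      (mul_le_mul_of_nonneg_right (pow_le_pow_left₀ (norm_nonneg _) hg 4) (gram_nonneg _ _))
  rw [e, e]
  have hgr := gram_nonneg u v
  calc _ ≤ K ^ 4 * (exteriorNorm i (iterNat M n x) ^ 2 * (K ^ 4 * gram u v)) := by
        refine (hpow _ (hK _).1 _ _).trans ?_
        gcongr
        refine (gram_map_le_exteriorNorm _ i hi _ _).trans ?_
        gcongr
        exact hpow _ (hK _).2 _ _
    _ = K ^ 8 * exteriorNorm i (iterNat M n x) ^ 2 * gram u v := by ring
    _ ≤ Real.exp (n * (2 * η)) * Real.exp (n * (lam 0 + lam i + η)) ^ 2 * gram u v := by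
        have := exteriorNorm_nonneg i (iterNat M n x)
        gcongr
    _ = _ := by
        rw [← Real.exp_nat_mul, ← Real.exp_add]
        congr 2
        push_cast
        ring

/-- The map between projective bundles given by the trivialization. -/
def projTriv (L : SFT A → GLd d) (q : SFT A × Proj d) : SFT A × Proj d :=
  (q.1, projMap (L q.1) q.2)

lemma measurable_projTriv (hL : Continuous L) : Measurable (projTriv L) :=
  measurable_fst.prodMk (measurable_projMap_prod hL)

lemma projTriv_semiconj (hN : ∀ x, N x = L (shift A x) * M x * (L x)⁻¹) :
    Function.Semiconj (projTriv L) (projFibered M) (projFibered N) := fun q => by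
  refine Prod.ext rfl ?_
  show projMap (L (shift A q.1)) (projMap (M q.1) q.2) = projMap (N q.1) (projMap (L q.1) q.2)
  rw [← projMap_mul, ← projMap_mul, hN, inv_mul_cancel_right]

/-- In the trivialization, the fibers of a `u`-state are quasi-independent from the future. -/
lemma IsUState.exists_cylinder_le (hμ : IsGibbs μ) (hL : Continuous L)
    {ν : Measure (SFT A × Proj d)} (hν : IsUState μ (trivHolonomy L) ν) :
    ∃ D : ENNReal, D ≠ ⊤ ∧ ∀ (Q : Set (Proj d)), MeasurableSet Q → ∀ (x : SFT A) (n : ℕ),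
      ν.map (projTriv L) (cylinder x (n + 1) ×ˢ Q) ≤
        D * (μ (cylinder x (n + 1)) * ν.map (projTriv L) (symbolSet A (x.1 0) ×ˢ Q)) := by
  have := hμ.isProbabilityMeasure
  obtain ⟨D, hD, h⟩ := hμ.exists_lintegral_cylinder_le
  obtain ⟨-, -, κ, hκ, rfl, S, hS, hinv⟩ := hν
  refine ⟨D, hD, fun Q hQ x n => ?_⟩
  have hm : MeasurableSet {q : SFT A × Proj d | projMap (L q.1) q.2 ∈ Q} :=
    measurable_projMap_prod hL hQ
  have hform : ∀ C : Set (SFT A), MeasurableSet C →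
      (μ ⊗ₘ κ).map (projTriv L) (C ×ˢ Q) = ∫⁻ y in C, κ y (projMap (L y) ⁻¹' Q) ∂μ := by
    intro C hC
    rw [Measure.map_apply (measurable_projTriv hL) (hC.prod hQ),
      Measure.compProd_apply (measurable_projTriv hL (hC.prod hQ)), ← lintegral_indicator hC]
    refine lintegral_congr fun y => ?_
    by_cases hy : y ∈ C
    · rw [Set.indicator_of_mem hy]
      congr 1
      ext p
      exact ⟨fun hp => hp.2, fun hp => ⟨hy, hp⟩⟩
    · rw [Set.indicator_of_notMem hy]
      refine measure_mono_null (fun p hp => ?_) (measure_empty (μ := κ y))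
      exact hy hp.1
  rw [hform _ (measurableSet_cylinder _ _), hform _ (measurableSet_symbolSet _)]
  -- The image of `κ y` under `L y` is constant along local unstable sets, because the holonomy is
  -- the identity in the trivialization.
  refine h (fun y => κ y (projMap (L y) ⁻¹' Q)) S
    (Kernel.measurable_kernel_prodMk_left hm) hS (fun y hy z hz hyz => ?_) x n
  rw [← hinv y hy z hz hyz, Measure.map_apply (continuous_projMap _).measurable
    ((continuous_projMap _).measurable hQ)]
  congr 1
  ext p
  show _ ↔ projMap (L z) (projMap ((L z)⁻¹ * L y) p) ∈ Q
  rw [← projMap_mul, mul_inv_cancel_left]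
  rfl

/-- The iterates `N^n` at `T^{-n} x` read only symbols in positions `-n` to `0`. This is why the
Oseledets line is constant along local unstable sets. -/
lemma bwdGrowth_congr_of_mem_Wuloc (hN : ∀ x, N x = B (x.1 0) (x.1 1)) {x y : SFT A}
    (h : y ∈ Wuloc x) {l : ℝ} {v : Vec d} (hv : BwdGrowth N l x v) : BwdGrowth N l y v := by
  refine hv.congr fun n => ?_
  rw [iterNat_congr hN n (x := (shift A).symm^[n] x) (y := (shift A).symm^[n] y) fun i h0 h1 => ?_]
  rw [shift_symm_iterate_apply, shift_symm_iterate_apply]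
  exact (h _ (by omega)).symm

/-- The backward orbit of the image passes through the original vector after one step; the index
shift costs a factor `n / (n + 1)`. With uniqueness of the line, this gives invariance of the line
field. -/
lemma BwdGrowth.apply_cocycle {l : ℝ} {x : SFT A} {v : Vec d} (h : BwdGrowth N l x v) :
    BwdGrowth N l (shift A x) ((N x).1 v) := by
  unfold BwdGrowth at h ⊢
  rw [← tendsto_add_atTop_iff_nat 1]
  have hlim := h.mul (tendsto_natCast_div_add_atTop (1 : ℝ))
  rw [mul_one] at hlim
  refine hlim.congr' ?_
  filter_upwards [eventually_gt_atTop 0] with n hn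
  have hn' : (n : ℝ) ≠ 0 := by exact_mod_cast hn.ne'
  have e1 : (shift A).symm^[n + 1] (shift A x) = (shift A).symm^[n] x := by
    rw [Function.iterate_succ_apply, Equiv.symm_apply_apply]
  have e2 : ((iterNat N (n + 1) ((shift A).symm^[n] x))⁻¹).1 ((N x).1 v) =
      ((iterNat N n ((shift A).symm^[n] x))⁻¹).1 v := by
    rw [iterNat_succ_eq, shift_iterate_symm_iterate, mul_inv_rev, Units.val_mul,
      mul_apply_eq_comp, units_inv_apply_apply]
  rw [e1, e2]
  push_cast
  field_simp

lemma mk_eq_mk_of_gram_eq_zero {u v : Vec d} (hu : u ≠ 0) (hv : v ≠ 0) (h : gram u v = 0) :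
    Projectivization.mk ℝ u hu = Projectivization.mk ℝ v hv := by
  obtain ⟨c, hc⟩ := Submodule.mem_span_singleton.1 (mem_span_of_gram_eq_zero hu h)
  exact ((Projectivization.mk_eq_mk_iff' ℝ v u hv hu).2 ⟨c, hc⟩).symm

/-- The line field spanned by a measurable vector field, as a section of the projective bundle. -/
lemma measurable_section {v₁ : SFT A → Vec d} (hv : Measurable v₁) (hv₁ : ∀ x, v₁ x ≠ 0) :
    Measurable fun x => Projectivization.mk ℝ (v₁ x) (hv₁ x) :=
  isOpenQuotientMap_mk'.continuous.measurable.comp (hv.subtype_mk (h := hv₁))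

end Trivialization

end SFTCocycle

/-! ### Conclusion in the original bundle. -/

open SFTCocycle in
theorem theorem3p7 {m d : ℕ} [NeZero d] (A : Fin m → Fin m → Prop)
    (hA : SFTCocycle.IsTransitive A)
    (μ : Measure (SFTCocycle.SFT A)) (hμ : SFTCocycle.IsGibbs μ)
    (M L : SFTCocycle.SFT A → SFTCocycle.GLd d) (hM : SFTCocycle.IsLocallyConstantIn M L)
    (hirr : SFTCocycle.StronglyIrreducible M
      (SFTCocycle.trivHolonomy L) (SFTCocycle.trivHolonomy L))
    (lam : Fin d → ℝ) (hlam : SFTCocycle.IsLyapunovSpectrum μ M lam)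
    (hsimple : ∀ j : Fin d, j ≠ 0 → lam j < lam 0) :
    ∃ (v₁ : SFTCocycle.SFT A → SFTCocycle.Vec d) (hv₁ : ∀ x, v₁ x ≠ 0),
      Measurable v₁ ∧
      (∀ᵐ x ∂μ, SFTCocycle.oseledets M (lam 0) x
        = (Submodule.span ℝ {v₁ x} : Submodule ℝ (SFTCocycle.Vec d))) ∧
      ∀ ν : Measure (SFTCocycle.SFT A × SFTCocycle.Proj d),
        SFTCocycle.IsInvariantUState μ M (SFTCocycle.trivHolonomy L) ν ↔
          ν = μ.map (fun x => (x, Projectivization.mk ℝ (v₁ x) (hv₁ x))) := by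
  have := hμ.isProbabilityMeasure
  obtain ⟨hL, B, hB⟩ := hM
  set N : SFT A → GLd d := fun x => B (x.1 0) (x.1 1)
  have hN : ∀ x, N x = B (x.1 0) (x.1 1) := fun x => rfl
  have hNM : ∀ x, N x = L (shift A x) * M x * (L x)⁻¹ := fun x => (hB x).symm
  have hNl : IsLocallyConstant N := isLocallyConstant_of_coord hN
  have hMc : Continuous M := by
    have e : M = fun x => (L (shift A x))⁻¹ * N x * L x := funext fun x => by rw [hNM]; group
    rw [e]
    exact ((hL.comp continuous_shift).inv.mul hNl.continuous).mul hL
  have hnorm := ae_tendsto_log_norm hlam hL hNM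
  obtain ⟨γ, hγ, harea⟩ := exists_area_growth hlam hsimple hL hNM
  have huniq := ae_gram_eq_zero_of_bwdGrowth hμ.invariant hNl hγ harea
  obtain ⟨w₁, hw₁m, hw₁0, hw₁⟩ := exists_measurable_growth hμ.invariant hNl hnorm huniq
  have hv₁0 : ∀ x, ((L x)⁻¹).1 (w₁ x) ≠ 0 := fun x => units_val_apply_ne_zero _ (hw₁0 x)
  have hv₁m : Measurable fun x => ((L x)⁻¹).1 (w₁ x) := by
    have hc : Continuous fun p : SFT A × Vec d => ((L p.1)⁻¹).1 p.2 :=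
      (Units.continuous_val.comp (hL.comp continuous_fst).inv).clm_apply continuous_snd
    exact hc.measurable.comp (measurable_id.prodMk hw₁m)
  have hsec := measurable_section hv₁m hv₁0
  have hsec' : Measurable fun x => (x, Projectivization.mk ℝ _ (hv₁0 x)) :=
    measurable_id.prodMk hsec
  have hproj : ∀ x, Projectivization.mk ℝ _ (hv₁0 x) =
      projMap (L x)⁻¹ (Projectivization.mk ℝ _ (hw₁0 x)) := fun x => rfl
  refine ⟨fun x => ((L x)⁻¹).1 (w₁ x), hv₁0, hv₁m, ?_, fun ν => ⟨fun hν => ?_, ?_⟩⟩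
  · filter_upwards [huniq, hw₁] with x hux hwx
    ext v
    rw [mem_oseledets, SetLike.mem_coe]
    have hLv : (L x).1 (((L x)⁻¹).1 (w₁ x)) = w₁ x := units_apply_inv_apply _ _
    constructor
    -- Backward growth alone already forces a vector onto the line.
    · rintro (rfl | ⟨-, hb⟩)
      · exact Submodule.zero_mem _
      by_cases hv : v = 0
      · rw [hv]; exact Submodule.zero_mem _
      have h1 := hux (w₁ x) ((L x).1 v) (hw₁0 x) (units_val_apply_ne_zero _ hv) hwx.2
        ((bwdGrowth_conj hL hNM hv).2 hb)
      obtain ⟨c, hc⟩ := Submodule.mem_span_singleton.1 (mem_span_of_gram_eq_zero (hw₁0 x) h1)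
      refine Submodule.mem_span_singleton.2 ⟨c, ?_⟩
      rw [← map_smul, hc, units_inv_apply_apply]
    · intro hv
      obtain ⟨c, rfl⟩ := Submodule.mem_span_singleton.1 hv
      by_cases hc : c = 0
      · left; rw [hc, zero_smul]
      · right
        exact ⟨((fwdGrowth_conj hL hNM (hv₁0 x)).1 (by rw [hLv]; exact hwx.1)).smul hc (hv₁0 x),
          ((bwdGrowth_conj hL hNM (hv₁0 x)).1 (by rw [hLv]; exact hwx.2)).smul hc (hv₁0 x)⟩
  · obtain ⟨hu, hinv⟩ := hν
    have hfst : ν.map Prod.fst = μ := hu.2.1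
    have hνp := hu.1
    obtain ⟨D, hD, hind⟩ := hu.exists_cylinder_le hμ hL
    set ν' := ν.map (projTriv L) with hν'
    have hΘ := measurable_projTriv hL
    have hν'p : IsProbabilityMeasure ν' := Measure.isProbabilityMeasure_map hΘ.aemeasurable
    have hfst' : ν'.map Prod.fst = μ := by
      rw [hν', Measure.map_map measurable_fst hΘ]; exact hfst
    have hinv' : MeasurePreserving (projFibered N) ν' ν' := by
      refine ⟨measurable_projFibered hNl.continuous, ?_⟩
      rw [hν', Measure.map_map (measurable_projFibered hNl.continuous) hΘ,
        ← (projTriv_semiconj hNM).comp_eq, ← Measure.map_map hΘ hinv.measurable, hinv.map_eq]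
    have hzero : ∀ (a : Fin m) (W : Submodule ℝ (Vec d)), W ≠ ⊤ →
        ν' (symbolSet A a ×ˢ projSet W) = 0 := fun a W hW =>
      measure_projSet_eq_zero hA hμ hL hirr hB hN hfst' hinv' hD hind a hW
    have hlim := tendsto_integral_logExp hN hNl hfst' hD hind hzero hnorm
    have hgrow := ae_of_ae_map hΘ.aemeasurable
      (ae_growth_of_tendsto_integral hNl.continuous hinv' hlim)
    have hμν : ∀ᵐ q ∂ν, (∀ u v : Vec d, u ≠ 0 → v ≠ 0 → BwdGrowth N (lam 0) q.1 u →
        BwdGrowth N (lam 0) q.1 v → gram u v = 0) ∧ BwdGrowth N (lam 0) q.1 (w₁ q.1) := by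
      have h1 : ∀ᵐ x ∂(ν.map Prod.fst), (∀ u v : Vec d, u ≠ 0 → v ≠ 0 →
          BwdGrowth N (lam 0) x u → BwdGrowth N (lam 0) x v → gram u v = 0) ∧
          BwdGrowth N (lam 0) x (w₁ x) := by
        rw [hfst]
        filter_upwards [huniq, hw₁] with x h1 h2 using ⟨h1, h2.2⟩
      exact ae_of_ae_map measurable_fst.aemeasurable h1
    -- In the trivialization, the line selected by `ν` and the vector `w₁` both have the top rate in
    -- the past, so they agree. Hence `ν` is carried by the graph of the section.
    have heq : ∀ᵐ q ∂ν, (q.1, Projectivization.mk ℝ _ (hv₁0 q.1)) = q := by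
      filter_upwards [hgrow, hμν] with q hq hq2
      refine Prod.ext rfl ?_
      have h1 := hq2.1 (w₁ q.1) (projMap (L q.1) q.2).rep (hw₁0 _)
        (Projectivization.rep_nonzero _) hq2.2 hq.2
      have h2 := mk_eq_mk_of_gram_eq_zero (hw₁0 _) (Projectivization.rep_nonzero _) h1
      rw [Projectivization.mk_rep] at h2
      show Projectivization.mk ℝ _ (hv₁0 q.1) = q.2
      rw [hproj, h2, projMap_inv_projMap]
    calc ν = ν.map id := Measure.map_id.symm
      _ = ν.map ((fun x => (x, Projectivization.mk ℝ _ (hv₁0 x))) ∘ Prod.fst) :=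
        Measure.map_congr (by filter_upwards [heq] with q hq using hq.symm)
      _ = (ν.map Prod.fst).map fun x => (x, Projectivization.mk ℝ _ (hv₁0 x)) :=
        (Measure.map_map hsec' measurable_fst).symm
      _ = _ := by rw [hfst]
  · rintro rfl
    have hp : IsProbabilityMeasure (μ.map fun x => (x, Projectivization.mk ℝ _ (hv₁0 x))) :=
      Measure.isProbabilityMeasure_map hsec'.aemeasurable
    refine ⟨⟨hp, ?_, Kernel.deterministic _ hsec, inferInstance,
      (Measure.compProd_deterministic hsec).symm, _, huniq.and hw₁, ?_⟩,
      measurable_projFibered hMc, ?_⟩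
    · rw [Measure.map_map measurable_fst hsec']
      exact Measure.map_id
    · rintro x ⟨-, hx⟩ y ⟨huy, hy⟩ hxy
      rw [Kernel.deterministic_apply, Kernel.deterministic_apply,
        Measure.map_dirac' (continuous_projMap _).measurable]
      congr 1
      -- The vector `w₁ x` keeps its backward rate when seen from `y`, which has the same past;
      -- uniqueness at `y` identifies the lines.
      have h1 := huy (w₁ x) (w₁ y) (hw₁0 x) (hw₁0 y) (bwdGrowth_congr_of_mem_Wuloc hN hxy hx.2) hy.2
      have h2 := mk_eq_mk_of_gram_eq_zero (hw₁0 x) (hw₁0 y) h1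
      rw [hproj, hproj, ← h2, ← projMap_mul, trivHolonomy, mul_inv_cancel_right]
    · rw [Measure.map_map (measurable_projFibered hMc) hsec']
      have hT := hμ.invariant
      have heq : (projFibered M ∘ fun x => (x, Projectivization.mk ℝ _ (hv₁0 x))) =ᵐ[μ]
          (fun x => (x, Projectivization.mk ℝ _ (hv₁0 x))) ∘ shift A := by
        filter_upwards [hw₁, hT.quasiMeasurePreserving.ae (huniq.and hw₁)] with x hx hTx
        refine Prod.ext rfl ?_
        show projMap (M x) (Projectivization.mk ℝ _ (hv₁0 x)) =
          Projectivization.mk ℝ _ (hv₁0 (shift A x))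
        have h1 := hTx.1 ((N x).1 (w₁ x)) (w₁ (shift A x)) (units_val_apply_ne_zero _ (hw₁0 x))
          (hw₁0 _) hx.2.apply_cocycle hTx.2.2
        have h2 := mk_eq_mk_of_gram_eq_zero (units_val_apply_ne_zero _ (hw₁0 x)) (hw₁0 _) h1
        rw [hproj, hproj, ← h2, ← projMap_mk _ _ (hw₁0 x), ← projMap_mul, ← projMap_mul, hNM]
        congr 1
        group
      rw [Measure.map_congr heq, ← Measure.map_map hsec' hT.measurable, hT.map_eq]

end
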